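/- **Good atlases.** Let $X$ be a paracompact, second countable Hausdorff space. An (effective orbifold) chart of dimension $n$ over an open set $U\subseteq X$ is a triple $(\tilde U,G,\pi)$ with $\tilde U\subseteq\mathbb R^n$ open and connected (possibly empty), $G$ a finite group of diffeomorphisms of $\tilde U$, and $\pi:\tilde U\to U$ a $G$-invariant continuous surjection inducing a homeomorphism $\tilde U/G\cong U$. An embedding of charts $(\tilde U,G,\pi)\to(\tilde V,H,\tau)$ with $U\subseteq V$ is a smooth embedding $\lambda:\tilde U\to\tilde V$ with $\tau\lambda=\pi$. A good atlas $\mathcal U=\{(\tilde U_I,G_I,\pi_I)\mid I\in F(V_{\mathcal U})\}$ on $X$ is a family of charts of one dimension indexed by the set $F(V_{\mathcal U})$ of non-empty finite subsets of a countable set $V_{\mathcal U}$ such that: the sets $U_{\{i\}}$, $i\in V_{\mathcal U}$, form a locally finite open cover of $X$; each non-empty $\tilde U_I$ and each non-empty $U_I$ is contractible; $U_{I\cup J}=U_I\cap U_J$; and there is an embedding $\tilde U_I\to\tilde U_J$ whenever $U_I\subseteq U_J$. It is a category, with the indices $I$ as objects and all embeddings of charts as morphisms. **The 2-category $\mathbf{GPreOrb}$.**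 Objects are good atlases. A 1-cell (compatible system) $\tilde f:\mathcal U\to\mathcal V$ over a continuous map $f:X\to Y$ is a functor $\tilde f$ with $f(U_I)\subseteq V_{\tilde fI}$ and $\tilde f(I\cup J)=\tilde fI\cup\tilde fJ$, together with smooth maps $\tilde f_I:\tilde U_I\to\tilde V_{\tilde fI}$ lifting $f|_{U_I}$ such that $\tilde f_J\circ\lambda=(\tilde f\lambda)\circ\tilde f_I$ for all embeddings $\lambda:\tilde U_I\to\tilde U_J$. A 2-cell $\alpha:\tilde f^1\Rightarrow\tilde f^2$ between compatible systems of the same map $f$ is a natural transformation of functors with $\tilde f^2_I=\alpha_I\circ\tilde f^1_I$ for all $I$. Compositions are those of functors, of liftings and of natural transformations. **The 2-category $\mathbf{SpCx}$.** A spark complex is a triple $(F^*,E^*,I^*)$ of cochain complexes of abelian groups, zero in negative degrees, with $E^*,I^*$ subcomplexes of $F^*$, $E^k\cap I^k=0$ for $k>0$, and $E^*\hookrightarrow F^*$ inducing an isomorphism in cohomology. Spark homomorphisms (1-cells) are cochain maps preserving $E^*$ and $I^*$. A spark homotopy $\Phi:f\Rightarrow g$ is a graded homomorphism $\Phi$ of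 degree $-1$ with $d\Phi+\Phi d=g-f$, vanishing on $E^*$ and preserving $I^*$. A homotopy $\Gamma$ from $\Phi$ to $\Psi$ is a graded homomorphism of degree $-2$ with $d\Gamma-\Gamma d=\Psi-\Phi$, vanishing on $E^*$ and preserving $I^*$. The 2-cells are the resulting homotopy classes $[\Phi]$; the vertical composite of $[\Phi]:f\Rightarrow g$ and $[\Psi]:g\Rightarrow h$ is $[\Psi+\Phi]$, and the horizontal composite of $[\Phi]:f\Rightarrow g$ and $[\Psi]:h\Rightarrow k$ is $[\Psi\circ f+k\circ\Phi]$. **The triple $S_{\mathcal U}$.** For a string $\mathbf I=I_0\dots I_p$ of elements of $F(V_{\mathcal U})$ put $\cup\mathbf I=I_0\cup\dots\cup I_p$. Let $C^p(\mathcal U,\Omega^q)$ be the group of families $(\omega_{\mathbf I})$, indexed by the strings of length $p+1$, of smooth $G_{\cup\mathbf I}$-invariant $q$-forms on $\tilde U_{\cup\mathbf I}$ which change sign whenever two distinct positions of $\mathbf I$ are interchanged. For $U_I\subseteq U_J$, let $|_{\tilde U_I}$ denote the pullback of a $G_J$-invariant form along any embedding $\tilde U_I\to\tilde U_J$. Let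 $F^k_{\mathcal U}=\bigoplus_{p+q=k}C^p(\mathcal U,\Omega^q)$ with differential $\delta+(-1)^pd$ on $C^p(\mathcal U,\Omega^q)$, where $(\delta\omega)_{\mathbf I}=\sum_{k=0}^{p+1}(-1)^k\,\omega_{I_0\dots\widehat{I_k}\dots I_{p+1}}|_{\tilde U_{\cup\mathbf I}}$ and $d$ is the exterior derivative. Let $E^k_{\mathcal U}\subseteq C^0(\mathcal U,\Omega^k)$ be the group of families $(\omega_I)$ with $\lambda^*\omega_J=\omega_I$ for all embeddings $\lambda:\tilde U_I\to\tilde U_J$, and let $I^k_{\mathcal U}\subseteq C^k(\mathcal U,\Omega^0)$ be the group of families of integer constants. Put $S_{\mathcal U}=(F^*_{\mathcal U},E^*_{\mathcal U},I^*_{\mathcal U})$. **Theorem.** Each $S_{\mathcal U}$ is a spark complex, and there is a (strict) 2-functor $S:\mathbf{GPreOrb}^{\mathrm{op}}\to\mathbf{SpCx}$, contravariant on 1-cells and covariant on 2-cells, which sends 1. each good atlas $\mathcal U$ to $S_{\mathcal U}$; 2. each compatible system $\tilde f:\mathcal U\to\mathcal V$ to the spark homomorphism $\underline{\tilde f}:S_{\mathcal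 V}\to S_{\mathcal U}$ given by $(\underline{\tilde f}\,\omega)_{\mathbf I}=\tilde f_{\cup\mathbf I}^{\,*}\big(\omega_{(\tilde fI_0)\dots(\tilde fI_p)}\big)$; 3. each natural transformation $\alpha:\tilde f^1\Rightarrow\tilde f^2:\mathcal U\to\mathcal V$ to a class $[\underline\alpha]:\underline{\tilde f}^1\Rightarrow\underline{\tilde f}^2$ as follows: for every strict total order on $F(V_{\mathcal U})$ there is a spark homotopy $\underline\alpha:\underline{\tilde f}^1\Rightarrow\underline{\tilde f}^2$ that maps $C^{p+1}(\mathcal V,\Omega^q)$ to $C^p(\mathcal U,\Omega^q)$ and is given on strictly increasing strings $\mathbf I=I_0\dots I_p$ by $$(\underline\alpha\,\omega)_{\mathbf I}=\sum_{j=0}^{p}(-1)^j\,(\tilde f^1_{\cup\mathbf I})^*\Big(\omega_{(\tilde f^1I_0)\dots(\tilde f^1I_j)(\tilde f^2I_j)\dots(\tilde f^2I_p)}\big|_{\tilde V_{\tilde f^1(\cup\mathbf I)}}\Big)$$ (and hence on all strings by alternation), and its class $[\underline\alpha]$ does not depend on the order. -/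

import Mathlib

open CategoryTheory Set Topology
open scoped ContDiff

universe u v w

namespace SparkOrb

noncomputable section

/-- Euclidean space of dimension `n`. -/
abbrev EE (n : ℕ) : Type := EuclideanSpace ℝ (Fin n)

/-- A map between subsets of Euclidean spaces, extended by zero to the whole space, so that smoothness
and derivatives can be expressed with Mathlib's notions. On the (open) subset all values and
derivatives are those of the given map. -/
def extendMap {n m : ℕ} {S : Set (EE n)} {T : Set (EE m)} (f : S → T) : EE n → EE m :=
  Function.extend Subtype.val (fun x => (f x : EE m)) 0

theorem extendMap_apply {n m : ℕ} {S : Set (EE n)} {T : Set (EE m)} (f : S → T) (x : S) :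
    extendMap f (x : EE n) = (f x : EE m) :=
  Subtype.val_injective.extend_apply _ _ _

/-- Smooth maps between (open) subsets of Euclidean spaces. -/
def SmoothMap {n m : ℕ} {S : Set (EE n)} {T : Set (EE m)} (f : S → T) : Prop :=
  ContDiffOn ℝ ∞ (extendMap f) S

theorem mapsTo_extendMap {n m : ℕ} {S : Set (EE n)} {T : Set (EE m)} (f : S → T) :
    MapsTo (extendMap f) S T := by
  intro x hx
  rw [extendMap_apply f ⟨x, hx⟩]
  exact (f _).2

theorem SmoothMap.id {n : ℕ} (S : Set (EE n)) : SmoothMap (id : S → S) :=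
  contDiffOn_id.congr fun x hx => extendMap_apply _ ⟨x, hx⟩

theorem extendMap_comp {n m l : ℕ} {S : Set (EE n)} {T : Set (EE m)} {R : Set (EE l)}
    (g : T → R) (f : S → T) : EqOn (extendMap (g ∘ f)) (extendMap g ∘ extendMap f) S := by
  intro x hx
  rw [extendMap_apply _ ⟨x, hx⟩, Function.comp_apply, Function.comp_apply,
    extendMap_apply f ⟨x, hx⟩, extendMap_apply]

theorem SmoothMap.comp {n m l : ℕ} {S : Set (EE n)} {T : Set (EE m)} {R : Set (EE l)}
    {g : T → R} {f : S → T} (hg : SmoothMap g) (hf : SmoothMap f) : SmoothMap (g ∘ f) :=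
  (ContDiffOn.comp hg hf (mapsTo_extendMap f)).congr (extendMap_comp g f)

theorem SmoothMap.contDiffAt {n m : ℕ} {S : Set (EE n)} {T : Set (EE m)} {f : S → T}
    (hf : SmoothMap f) (hS : IsOpen S) (x : S) : ContDiffAt ℝ ∞ (extendMap f) x :=
  ContDiffOn.contDiffAt hf (hS.mem_nhds x.2)

theorem SmoothMap.differentiableAt {n m : ℕ} {S : Set (EE n)} {T : Set (EE m)} {f : S → T}
    (hf : SmoothMap f) (hS : IsOpen S) (x : S) : DifferentiableAt ℝ (extendMap f) x :=
  (hf.contDiffAt hS x).differentiableAt (by simp)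

theorem fderiv_extendMap_id {n : ℕ} {S : Set (EE n)} (hS : IsOpen S) (x : S) :
    fderiv ℝ (extendMap (id : S → S)) x = ContinuousLinearMap.id ℝ (EE n) := by
  have h : extendMap (id : S → S) =ᶠ[𝓝 (x : EE n)] id :=
    Filter.eventuallyEq_of_mem (hS.mem_nhds x.2) fun y hy => extendMap_apply _ ⟨y, hy⟩
  rw [h.fderiv_eq, fderiv_id]

theorem fderiv_extendMap_comp {n m l : ℕ} {S : Set (EE n)} {T : Set (EE m)} {R : Set (EE l)}
    {g : T → R} {f : S → T} (hg : SmoothMap g) (hf : SmoothMap f) (hS : IsOpen S) (hT : IsOpen T)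
    (x : S) : fderiv ℝ (extendMap (g ∘ f)) x =
      (fderiv ℝ (extendMap g) (f x)).comp (fderiv ℝ (extendMap f) x) := by
  have h : extendMap (g ∘ f) =ᶠ[𝓝 (x : EE n)] extendMap g ∘ extendMap f :=
    Filter.eventuallyEq_of_mem (hS.mem_nhds x.2) (extendMap_comp g f)
  have h2 := hg.differentiableAt hT (f x)
  rw [← extendMap_apply f x] at h2
  rw [h.fderiv_eq, fderiv_comp _ h2 (hf.differentiableAt hS x), extendMap_apply]

/-- An effective orbifold chart of dimension `n` on `X`: a connected (possibly empty) open set `dom` of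
`ℝⁿ`, a finite group `group` of diffeomorphisms of `dom` (as a subgroup of the permutations of `dom`,
so that the action is effective), and a map `proj` from `dom` onto an open set `base` of `X` which
induces a homeomorphism from the orbit space of `group` to `base`: a quotient map whose fibres are
the orbits. The inverse of a member of `group` is again in `group`, hence smooth. The set `base` is
connected, as the image of `dom`. -/
structure Chart (X : Type u) [TopologicalSpace X] (n : ℕ) where
  dom : Set (EE n)
  isOpen_dom : IsOpen dom
  isPreconnected_dom : IsPreconnected dom
  base : Set X
  isOpen_base : IsOpen base
  group : Subgroup (Equiv.Perm dom)
  finite_group : Finite group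
  smooth_group : ∀ g ∈ group, SmoothMap (g : dom → dom)
  proj : dom → base
  isQuotientMap_proj : IsQuotientMap proj
  proj_eq_iff : ∀ x y, proj x = proj y ↔ ∃ g ∈ group, g x = y

variable {X : Type u} [TopologicalSpace X] {n m : ℕ}

/-- An embedding of charts: a smooth embedding (an immersion that is a topological embedding) that
commutes with the projections to `X`. In particular `C.base ⊆ D.base`. -/
@[ext]
structure Chart.Emb (C D : Chart X n) where
  toFun : C.dom → D.dom
  smooth : SmoothMap toFun
  immersive : ∀ x : C.dom, Function.Injective (fderiv ℝ (extendMap toFun) (x : EE n))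
  isEmbedding : IsEmbedding toFun
  lift : ∀ x, (D.proj (toFun x) : X) = C.proj x

/-- The identity embedding. -/
def Chart.Emb.id (C : Chart X n) : C.Emb C where
  toFun := _root_.id
  smooth := SmoothMap.id _
  immersive x := by
    rw [fderiv_extendMap_id C.isOpen_dom]; exact Function.injective_id
  isEmbedding := IsEmbedding.id
  lift _ := rfl

/-- Composition of embeddings. -/
def Chart.Emb.comp {C D E : Chart X n} (l : C.Emb D) (k : D.Emb E) : C.Emb E where
  toFun := k.toFun ∘ l.toFun
  smooth := k.smooth.comp l.smooth
  immersive x := by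
    rw [fderiv_extendMap_comp k.smooth l.smooth C.isOpen_dom D.isOpen_dom]
    exact (k.immersive _).comp (l.immersive x)
  isEmbedding := k.isEmbedding.comp l.isEmbedding
  lift x := (k.lift _).trans (l.lift x)

/-- Each element of the group of a chart is an embedding of the chart into itself. -/
def Chart.Emb.ofGroup (C : Chart X n) (g : Equiv.Perm C.dom) (hg : g ∈ C.group) : C.Emb C where
  toFun := g
  smooth := C.smooth_group g hg
  immersive x := by
    have h1 := C.smooth_group g hg
    have h2 := C.smooth_group g⁻¹ (inv_mem hg)
    have h3 := fderiv_extendMap_comp h2 h1 C.isOpen_dom C.isOpen_dom x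
    have h4 : ((g⁻¹ : Equiv.Perm C.dom) : C.dom → C.dom) ∘ g = _root_.id := by
      funext y; simp
    rw [h4, fderiv_extendMap_id C.isOpen_dom] at h3
    intro a b hab
    have := congrArg (fderiv ℝ (extendMap ((g⁻¹ : Equiv.Perm C.dom) : C.dom → C.dom)) (g x)) hab
    rw [← ContinuousLinearMap.comp_apply, ← ContinuousLinearMap.comp_apply, ← h3] at this
    exact this
  isEmbedding := by
    have hc : ∀ h ∈ C.group, Continuous (h : C.dom → C.dom) := fun h hh => by
      have h5 := (C.smooth_group h hh).continuousOn
      rw [continuousOn_iff_continuous_domRestrict] at h5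
      refine Continuous.subtype_mk (p := (· ∈ C.dom)) h5 (fun x => mapsTo_extendMap _ x.2) |>.congr ?_
      intro x; exact Subtype.ext (extendMap_apply _ x)
    exact (Homeomorph.mk g (hc g hg) (hc g⁻¹ (inv_mem hg))).isEmbedding
  lift x := by
    have := (C.proj_eq_iff x (g x)).2 ⟨g, hg, rfl⟩
    rw [← this]

/-- Fields of alternating `q`-linear forms on `ℝⁿ`. A differential form on an open set `S` is represented
by its extension by zero off `S`, so that forms on equal sets have the same type. -/
abbrev FormFun (n q : ℕ) : Type := EE n → (EE n) [⋀^Fin q]→L[ℝ] ℝ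

/-- Pullback of a form along a map from `S` to `T`, extended by zero off `S`. -/
def pullback {S : Set (EE n)} {T : Set (EE m)} (f : S → T) {q : ℕ} (θ : FormFun m q) :
    FormFun n q :=
  S.indicator fun x => (θ (extendMap f x)).compContinuousLinearMap (fderiv ℝ (extendMap f) x)

/-- Exterior derivative of a form on `S`, extended by zero off `S`. -/
def extD (S : Set (EE n)) {q : ℕ} (θ : FormFun n q) : FormFun n (q + 1) :=
  S.indicator (extDeriv θ)

/-- The group of smooth `q`-forms on the domain of a chart that are invariant under its group. -/
def Chart.invForms (C : Chart X n) (q : ℕ) : AddSubgroup (FormFun n q) where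
  carrier := {θ | ContDiffOn ℝ ∞ θ C.dom ∧ (∀ x, x ∉ C.dom → θ x = 0) ∧
    ∀ g ∈ C.group, pullback (g : C.dom → C.dom) θ = θ}
  zero_mem' := ⟨contDiffOn_const, fun _ _ => rfl, fun g _ => by
    funext x; by_cases hx : x ∈ C.dom <;> simp [pullback, hx]
    rfl⟩
  add_mem' {a b} ha hb := ⟨ha.1.add hb.1, fun x hx => by simp [ha.2.1 x hx, hb.2.1 x hx],
    fun g hg => by
      conv_rhs => rw [← ha.2.2 g hg, ← hb.2.2 g hg]
      funext x; by_cases hx : x ∈ C.dom <;> simp [pullback, hx]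
      rfl⟩
  neg_mem' {a} ha := ⟨ha.1.neg, fun x hx => by simp [ha.2.1 x hx],
    fun g hg => by
      conv_rhs => rw [← ha.2.2 g hg]
      funext x; by_cases hx : x ∈ C.dom <;> simp [pullback, hx]
      rfl⟩

theorem pullback_add {S : Set (EE n)} {T : Set (EE m)} (f : S → T) {q : ℕ} (θ η : FormFun m q) :
    pullback f (θ + η) = pullback f θ + pullback f η := by
  funext x; by_cases hx : x ∈ S <;> simp [pullback, hx]; rfl

theorem contDiffOn_alternating {q : ℕ} {S : Set (EE n)} (θ : FormFun n q)
    (h : ContDiffOn ℝ ∞ (fun x => (θ x).toContinuousMultilinearMap) S) : ContDiffOn ℝ ∞ θ S := by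
  have : FiniteDimensional ℝ (ContinuousMultilinearMap ℝ (fun _ : Fin q => EE n) ℝ) :=
    FiniteDimensional.of_injective
      (ContinuousMultilinearMap.toMultilinearMapLinear :
        ContinuousMultilinearMap ℝ (fun _ : Fin q => EE n) ℝ →ₗ[ℝ] _)
      ContinuousMultilinearMap.toMultilinearMap_injective
  let L : ((EE n) [⋀^Fin q]→L[ℝ] ℝ) →ₗ[ℝ] ContinuousMultilinearMap ℝ (fun _ : Fin q => EE n) ℝ :=
    ContinuousAlternatingMap.toContinuousMultilinearMapLinear
  obtain ⟨K, hK⟩ := L.exists_leftInverse_of_injective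
    (LinearMap.ker_eq_bot.2 ContinuousAlternatingMap.toContinuousMultilinearMap_injective)
  have h2 := (LinearMap.toContinuousLinearMap K).contDiff.comp_contDiffOn h
  refine h2.congr fun x _ => ?_
  exact (LinearMap.congr_fun hK (θ x)).symm

theorem contDiffOn_pullback {S : Set (EE n)} {T : Set (EE m)} {f : S → T} (hf : SmoothMap f)
    (hS : IsOpen S) {q : ℕ} {θ : FormFun m q} (hθ : ContDiffOn ℝ ∞ θ T) :
    ContDiffOn ℝ ∞ (pullback f θ) S := by
  apply contDiffOn_alternating
  have h1 : ContDiffOn ℝ ∞ (fderiv ℝ (extendMap f)) S :=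
    ContDiffOn.fderiv_of_isOpen hf hS le_rfl
  have h2 : ContDiffOn ℝ ∞ (fun x => (θ (extendMap f x)).toContinuousMultilinearMap) S :=
    (ContinuousAlternatingMap.toContinuousMultilinearMapCLM ℝ :
      ((EE m) [⋀^Fin q]→L[ℝ] ℝ) →L[ℝ] _).contDiff.comp_contDiffOn
      (hθ.comp hf (mapsTo_extendMap f))
  have h3 : ContDiffOn ℝ ∞ (fun x =>
      (ContinuousMultilinearMap.compContinuousLinearMapContinuousMultilinear ℝ
        (fun _ : Fin q => EE n) (fun _ : Fin q => EE m) ℝ) fun _ => fderiv ℝ (extendMap f) x) S :=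
    (ContinuousMultilinearMap.contDiff _).comp_contDiffOn (contDiffOn_pi.2 fun _ => h1)
  refine (h3.clm_apply h2).congr fun x hx => ?_
  simp only [pullback, indicator_of_mem hx]
  rfl

theorem pullback_comp {l : ℕ} {S : Set (EE n)} {T : Set (EE m)} {R : Set (EE l)}
    {g : T → R} {f : S → T} (hg : SmoothMap g) (hf : SmoothMap f) (hS : IsOpen S) (hT : IsOpen T)
    {q : ℕ} (θ : FormFun l q) : pullback (g ∘ f) θ = pullback f (pullback g θ) := by
  funext x
  by_cases hx : x ∈ S
  · simp only [pullback, indicator_of_mem hx, indicator_of_mem (mapsTo_extendMap f hx)]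
    have h := fderiv_extendMap_comp hg hf hS hT ⟨x, hx⟩
    simp only at h
    rw [h, extendMap_comp g f hx, Function.comp_apply, ← extendMap_apply f ⟨x, hx⟩]
    rfl
  · simp [pullback, hx]

/-- Two embeddings into the same chart pull back an invariant form to the same form. -/
theorem pullback_emb_eq {C D : Chart X n} (l k : C.Emb D) {q : ℕ} {θ : FormFun n q}
    (hθ : θ ∈ D.invForms q) : pullback l.toFun θ = pullback k.toFun θ := by
  have := D.finite_group
  have : LocallyCompactSpace C.dom := C.isOpen_dom.locallyCompactSpace
  let A : D.group → Set C.dom := fun h => {x | k.toFun x = (h : Equiv.Perm D.dom) (l.toFun x)}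
  have hgc : ∀ h : D.group, Continuous ((h : Equiv.Perm D.dom) : D.dom → D.dom) := fun h =>
    (Chart.Emb.ofGroup D h h.2).isEmbedding.continuous
  have hA : ∀ h, IsClosed (A h) := fun h =>
    isClosed_eq k.isEmbedding.continuous ((hgc h).comp l.isEmbedding.continuous)
  have hU : ⋃ h, A h = univ := by
    refine eq_univ_of_forall fun x => ?_
    have : D.proj (l.toFun x) = D.proj (k.toFun x) :=
      Subtype.ext ((l.lift x).trans (k.lift x).symm)
    obtain ⟨g, hg, hgx⟩ := (D.proj_eq_iff _ _).1 this
    exact mem_iUnion.2 ⟨⟨g, hg⟩, hgx.symm⟩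
  have hd := dense_iUnion_interior_of_closed hA hU
  have hl := (contDiffOn_pullback l.smooth C.isOpen_dom hθ.1).continuousOn
  have hk := (contDiffOn_pullback k.smooth C.isOpen_dom hθ.1).continuousOn
  rw [continuousOn_iff_continuous_domRestrict] at hl hk
  have key : C.dom.domRestrict (pullback l.toFun θ) = C.dom.domRestrict (pullback k.toFun θ) := by
    refine Continuous.ext_on hd hl hk ?_
    intro x hx
    obtain ⟨h, hxh⟩ := mem_iUnion.1 hx
    have h1 : pullback l.toFun θ = pullback (((h : Equiv.Perm D.dom) : D.dom → D.dom) ∘ l.toFun) θ := by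
      rw [pullback_comp (D.smooth_group h h.2) l.smooth C.isOpen_dom D.isOpen_dom,
        hθ.2.2 h h.2]
    have h2 : extendMap k.toFun =ᶠ[𝓝 (x : EE n)]
        extendMap (((h : Equiv.Perm D.dom) : D.dom → D.dom) ∘ l.toFun) := by
      have h3 : Subtype.val '' (interior (A h)) ∈ 𝓝 (x : EE n) :=
        (C.isOpen_dom.isOpenMap_subtype_val _ isOpen_interior).mem_nhds ⟨x, hxh, rfl⟩
      filter_upwards [h3]
      rintro _ ⟨y, hy, rfl⟩
      rw [extendMap_apply, extendMap_apply]
      exact congrArg Subtype.val (interior_subset (s := A h) hy)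
    simp only [domRestrict_apply]
    rw [h1]
    simp only [pullback, indicator_of_mem x.2]
    rw [h2.fderiv_eq, h2.eq_of_nhds]
  funext x
  by_cases hx : x ∈ C.dom
  · exact congrFun key ⟨x, hx⟩
  · simp [pullback, hx]

theorem pullback_mem_invForms {C D : Chart X n} (l : C.Emb D) {q : ℕ} {θ : FormFun n q}
    (hθ : θ ∈ D.invForms q) : pullback l.toFun θ ∈ C.invForms q := by
  refine ⟨contDiffOn_pullback l.smooth C.isOpen_dom hθ.1, fun x hx => by simp [pullback, hx], ?_⟩
  intro g hg
  rw [← pullback_comp l.smooth (C.smooth_group g hg) C.isOpen_dom C.isOpen_dom]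
  exact pullback_emb_eq ((Chart.Emb.ofGroup C g hg).comp l) l hθ

theorem extD_add {S : Set (EE n)} (hS : IsOpen S) {q : ℕ} {θ η : FormFun n q}
    (hθ : ContDiffOn ℝ ∞ θ S) (hη : ContDiffOn ℝ ∞ η S) :
    extD S (θ + η) = extD S θ + extD S η := by
  funext x
  by_cases hx : x ∈ S
  · simp only [extD, indicator_of_mem hx, Pi.add_apply]
    exact extDeriv_add ((hθ.contDiffAt (hS.mem_nhds hx)).differentiableAt (by simp))
      ((hη.contDiffAt (hS.mem_nhds hx)).differentiableAt (by simp))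
  · simp [extD, hx]

theorem extD_mem_invForms {C : Chart X n} {q : ℕ} {θ : FormFun n q} (hθ : θ ∈ C.invForms q) :
    extD C.dom θ ∈ C.invForms (q + 1) := by
  refine ⟨?_, fun x hx => by simp [extD, hx], ?_⟩
  · have h1 : ContDiffOn ℝ ∞ (fderiv ℝ θ) C.dom :=
      ContDiffOn.fderiv_of_isOpen hθ.1 C.isOpen_dom le_rfl
    refine ((ContinuousAlternatingMap.alternatizeUncurryFinCLM ℝ (EE n) ℝ).contDiff.comp_contDiffOn h1).congr
      fun x hx => ?_
    simp only [extD, indicator_of_mem hx]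
    rfl
  · intro g hg
    funext x
    by_cases hx : x ∈ C.dom
    · have hs := C.smooth_group g hg
      have h1 : extDeriv θ x = extDeriv (pullback (g : C.dom → C.dom) θ) x := by
        rw [hθ.2.2 g hg]
      have h2 : pullback (g : C.dom → C.dom) θ =ᶠ[𝓝 x] fun x =>
          (θ (extendMap g x)).compContinuousLinearMap (fderiv ℝ (extendMap g) x) :=
        Filter.eventuallyEq_of_mem (C.isOpen_dom.mem_nhds hx) fun y hy => by
          simp [pullback, hy]
      have hgx := mapsTo_extendMap (g : C.dom → C.dom) hx
      simp only [pullback, extD, indicator_of_mem hx, indicator_of_mem hgx]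
      rw [h1, h2.extDeriv_eq, extDeriv_pullback (r := ∞)
        ((hθ.1.contDiffAt (C.isOpen_dom.mem_nhds hgx)).differentiableAt (by simp))
        (hs.contDiffAt C.isOpen_dom ⟨x, hx⟩) (by simp; exact WithTop.coe_le_coe.2 le_top)]
    · simp [pullback, extD, hx]

theorem Chart.Emb.base_subset {C D : Chart X n} (l : C.Emb D) : C.base ⊆ D.base := by
  intro x hx
  obtain ⟨y, hy⟩ := C.isQuotientMap_proj.surjective ⟨x, hx⟩
  have h := l.lift y
  rw [hy] at h
  rw [← show ((D.proj (l.toFun y) : D.base) : X) = x from h]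
  exact (D.proj _).2

/-- The set of non-empty finite subsets of `V`. -/
def FinIdx (V : Type v) : Type v := {s : Finset V // s.Nonempty}

instance {V : Type v} : SemilatticeSup (FinIdx V) :=
  letI : DecidableEq V := Classical.decEq V
  Subtype.semilatticeSup fun _ _ h _ => h.mono Finset.subset_union_left

def FinIdx.single {V : Type v} (i : V) : FinIdx V := ⟨{i}, Finset.singleton_nonempty i⟩

/-- A good atlas on `X` of dimension `n`, indexed by the non-empty finite subsets of a countable set `V`.
The local compatibility of charts that is required of an atlas (a chart around each point of
`base I ∩ base J` which embeds into both charts) is a consequence of `base_sup` and `exists_emb`,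
take the chart with index `I ⊔ J`. -/
structure GoodAtlas (X : Type u) [TopologicalSpace X] (n : ℕ) where
  V : Type v
  countable_V : Countable V
  chart : FinIdx V → Chart X n
  cover : ⋃ i, (chart (FinIdx.single i)).base = univ
  locallyFinite : LocallyFinite fun i => (chart (FinIdx.single i)).base
  contractible_dom : ∀ I, (chart I).dom.Nonempty → ContractibleSpace (chart I).dom
  contractible_base : ∀ I, (chart I).base.Nonempty → ContractibleSpace (chart I).base
  base_sup : ∀ I J, (chart (I ⊔ J)).base = (chart I).base ∩ (chart J).base
  exists_emb : ∀ I J, (chart I).base ⊆ (chart J).base → Nonempty ((chart I).Emb (chart J))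

namespace GoodAtlas

variable (U : GoodAtlas.{u, v} X n)

/-- The index set of the charts, with union as the join. -/
def Idx : Type v := FinIdx U.V

instance : SemilatticeSup U.Idx := inferInstanceAs (SemilatticeSup (FinIdx U.V))

/-- The chart with index `I`. -/
def ch (I : U.Idx) : Chart X n := U.chart I

/-- A good atlas as a category: objects are (indices of) charts, morphisms are all embeddings. -/
instance : Category U.Idx where
  Hom I J := (U.ch I).Emb (U.ch J)
  id I := Chart.Emb.id (U.ch I)
  comp l k := Chart.Emb.comp l k

variable {U} in
/-- The underlying map of an embedding. -/
def embFun {I J : U.Idx} (l : I ⟶ J) : (U.ch I).dom → (U.ch J).dom := Chart.Emb.toFun l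

theorem base_anti {I J : U.Idx} (h : I ≤ J) : (U.ch J).base ⊆ (U.ch I).base := by
  have h1 := U.base_sup I J
  have h2 : (I ⊔ J : FinIdx U.V) = J := sup_eq_right.2 h
  rw [h2] at h1
  intro x hx
  exact (h1.subset hx).1

/-- The union of the entries of a string of indices. -/
def cup {p : ℕ} (I : Fin (p + 1) → U.Idx) : U.Idx :=
  Finset.univ.sup' Finset.univ_nonempty I

theorem le_cup {p : ℕ} (I : Fin (p + 1) → U.Idx) (k : Fin (p + 1)) : I k ≤ U.cup I :=
  Finset.le_sup' I (Finset.mem_univ k)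

theorem subset_base_cup {p : ℕ} (I : Fin (p + 1) → U.Idx) {A : Set X}
    (h : ∀ k, A ⊆ (U.ch (I k)).base) : A ⊆ (U.ch (U.cup I)).base := by
  refine Finset.sup'_induction (p := fun J : U.Idx => A ⊆ (U.ch J).base) Finset.univ_nonempty I
    ?_ fun k _ => h k
  intro J hJ K hK
  exact (subset_inter hJ hK).trans (U.base_sup J K).superset

theorem base_cup_subset {p r : ℕ} (I : Fin (p + 1) → U.Idx) (s : Fin (r + 1) → Fin (p + 1)) :
    (U.ch (U.cup I)).base ⊆ (U.ch (U.cup (I ∘ s))).base :=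
  U.subset_base_cup _ fun k => U.base_anti (U.le_cup I (s k))

/-- Some embedding between charts whose bases are nested. The pullback of an invariant form does not
depend on it, see `pullback_emb_eq`. -/
def emb {I J : U.Idx} (h : (U.ch I).base ⊆ (U.ch J).base) : I ⟶ J :=
  Classical.choice (U.exists_emb I J h)

/-- Restriction of an invariant form along an embedding. -/
def restr {I J : U.Idx} (h : (U.ch I).base ⊆ (U.ch J).base) {q : ℕ} (θ : FormFun n q) :
    FormFun n q :=
  pullback (embFun (U.emb h)) θ

end GoodAtlas

variable {Y : Type u} [TopologicalSpace Y] {Z : Type u} [TopologicalSpace Z] {l : ℕ}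

/-- A compatible system of liftings of a continuous map: a functor between good atlases that preserves
unions of indices, with smooth liftings of the map to the charts that commute with all embeddings. -/
structure CompatSys (U : GoodAtlas.{u, v} X n) (W : GoodAtlas.{u, v} Y m) where
  base : C(X, Y)
  functor : U.Idx ⥤ W.Idx
  image_base : ∀ I, base '' (U.ch I).base ⊆ (W.ch (functor.obj I)).base
  map_sup : ∀ I J, functor.obj (I ⊔ J) = functor.obj I ⊔ functor.obj J
  lift : ∀ I, (U.ch I).dom → (W.ch (functor.obj I)).dom
  smooth_lift : ∀ I, SmoothMap (lift I)
  proj_lift : ∀ I x, ((W.ch (functor.obj I)).proj (lift I x) : Y) = base ((U.ch I).proj x)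
  lift_emb : ∀ {I J : U.Idx} (e : I ⟶ J) (x : (U.ch I).dom),
    lift J (GoodAtlas.embFun e x) = GoodAtlas.embFun (functor.map e) (lift I x)

namespace CompatSys

/-- The identity compatible system. -/
def id (U : GoodAtlas.{u, v} X n) : CompatSys U U where
  base := ContinuousMap.id X
  functor := 𝟭 U.Idx
  image_base I := by simp
  map_sup _ _ := rfl
  lift _ := _root_.id
  smooth_lift _ := SmoothMap.id _
  proj_lift _ _ := rfl
  lift_emb _ _ := rfl

/-- The composite `g ∘ f` of compatible systems, in diagrammatic order. -/
def comp {U : GoodAtlas.{u, v} X n} {V : GoodAtlas.{u, v} Y m} {W : GoodAtlas.{u, v} Z l}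
    (f : CompatSys U V) (g : CompatSys V W) : CompatSys U W where
  base := g.base.comp f.base
  functor := f.functor ⋙ g.functor
  image_base I := by
    rintro _ ⟨x, hx, rfl⟩
    exact g.image_base _ ⟨_, f.image_base I ⟨x, hx, rfl⟩, rfl⟩
  map_sup I J := by simp [f.map_sup, g.map_sup]
  lift I := g.lift (f.functor.obj I) ∘ f.lift I
  smooth_lift I := (g.smooth_lift _).comp (f.smooth_lift I)
  proj_lift I x := (g.proj_lift _ _).trans (congrArg g.base (f.proj_lift I x))
  lift_emb l x := (congrArg (g.lift _) (f.lift_emb l x)).trans (g.lift_emb (f.functor.map l) _)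

/-- A natural transformation of compatible systems of the same continuous map. -/
@[ext]
structure Trans {U : GoodAtlas.{u, v} X n} {V : GoodAtlas.{u, v} Y m} (f g : CompatSys U V) where
  base_eq : f.base = g.base
  nat : f.functor ⟶ g.functor
  lift_eq : ∀ I x, g.lift I x = GoodAtlas.embFun (nat.app I) (f.lift I x)

instance {U : GoodAtlas.{u, v} X n} {V : GoodAtlas.{u, v} Y m} : Category (CompatSys U V) where
  Hom f g := Trans f g
  id f := ⟨rfl, 𝟙 _, fun _ _ => rfl⟩
  comp a b := ⟨a.base_eq.trans b.base_eq, a.nat ≫ b.nat, fun I x =>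
    (b.lift_eq I x).trans (congrArg (GoodAtlas.embFun (b.nat.app I)) (a.lift_eq I x))⟩
  id_comp a := Trans.ext (Category.id_comp a.nat)
  comp_id a := Trans.ext (Category.comp_id a.nat)
  assoc a b c := Trans.ext (Category.assoc a.nat b.nat c.nat)

/-- Precomposition of a natural transformation with a compatible system. -/
def whiskerLeft {U : GoodAtlas.{u, v} X n} {V : GoodAtlas.{u, v} Y m} {W : GoodAtlas.{u, v} Z l}
    (f : CompatSys U V) {g h : CompatSys V W} (b : g ⟶ h) : f.comp g ⟶ f.comp h where
  base_eq := congrArg (fun c : C(Y, Z) => c.comp f.base) b.base_eq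
  nat := Functor.whiskerLeft f.functor b.nat
  lift_eq I x := b.lift_eq _ _

/-- Postcomposition of a natural transformation with a compatible system. -/
def whiskerRight {U : GoodAtlas.{u, v} X n} {V : GoodAtlas.{u, v} Y m} {W : GoodAtlas.{u, v} Z l}
    {f g : CompatSys U V} (a : f ⟶ g) (h : CompatSys V W) : f.comp h ⟶ g.comp h where
  base_eq := congrArg h.base.comp a.base_eq
  nat := Functor.whiskerRight a.nat h.functor
  lift_eq I x := (congrArg (h.lift _) (a.lift_eq I x)).trans (h.lift_emb (a.nat.app I) _)

end CompatSys

/-- A good effective orbifold atlas together with its underlying space. -/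
structure GPreOrb : Type (max (u + 1) (v + 1)) where
  carrier : Type u
  [top : TopologicalSpace carrier]
  [t2 : T2Space carrier]
  [secondCountable : SecondCountableTopology carrier]
  [paracompact : ParacompactSpace carrier]
  dim : ℕ
  atlas : GoodAtlas.{u, v} carrier dim

attribute [instance] GPreOrb.top

/-- The 2-category of good atlases, compatible systems and natural transformations. -/
instance : Bicategory GPreOrb.{u, v} where
  Hom U V := CompatSys U.atlas V.atlas
  id U := CompatSys.id U.atlas
  comp f g := CompatSys.comp f g
  homCategory _ _ := inferInstance
  whiskerLeft f _ _ b := CompatSys.whiskerLeft f b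
  whiskerRight a h := CompatSys.whiskerRight a h
  associator f g h := Iso.refl (f.comp (g.comp h))
  leftUnitor f := Iso.refl f
  rightUnitor f := Iso.refl f
  whiskerLeft_id _ _ := rfl
  whiskerLeft_comp _ _ _ _ _ _ := rfl
  id_whiskerLeft b := CompatSys.Trans.ext <| by
    ext I; exact ((Category.id_comp _).trans (Category.comp_id _)).symm
  comp_whiskerLeft f g _ _ b := CompatSys.Trans.ext <| by
    ext I; exact ((Category.id_comp _).trans (Category.comp_id _)).symm
  id_whiskerRight f g := CompatSys.Trans.ext <| by
    ext I; exact g.functor.map_id _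
  comp_whiskerRight a b g := CompatSys.Trans.ext <| by
    ext I; exact g.functor.map_comp _ _
  whiskerRight_id b := CompatSys.Trans.ext <| by
    ext I; exact ((Category.id_comp _).trans (Category.comp_id _)).symm
  whiskerRight_comp b g h := CompatSys.Trans.ext <| by
    ext I; exact ((Category.id_comp _).trans (Category.comp_id _)).symm
  whisker_assoc f _ _ b h := CompatSys.Trans.ext <| by
    ext I; exact ((Category.id_comp _).trans (Category.comp_id _)).symm
  whisker_exchange {_ _ _ f g h i} a b := CompatSys.Trans.ext <| by
    ext I; exact (b.nat.naturality (a.nat.app I)).symm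
  pentagon f g h i := CompatSys.Trans.ext <| by
    ext I
    refine Eq.trans ?_ rfl
    exact congrArg (· ≫ _) (i.functor.map_id _) |>.trans (Category.id_comp _)
  triangle f g := CompatSys.Trans.ext <| by
    ext I
    exact (Category.id_comp _).trans (g.functor.map_id _).symm

instance : Bicategory.Strict GPreOrb.{u, v} where
  id_comp _ := rfl
  comp_id _ := rfl
  assoc _ _ _ := rfl
  leftUnitor_eqToIso _ := rfl
  rightUnitor_eqToIso _ := rfl
  associator_eqToIso _ _ _ := rfl

/-- The data of a triple `(F, E, I)`: a graded abelian group `F` with an operator `d` of degree one and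
graded subgroups `E` and `I`. All groups vanish in negative degrees, so degrees are natural numbers. -/
structure SparkTriple : Type (w + 1) where
  F : ℕ → Type w
  [addCommGroup : ∀ k, AddCommGroup (F k)]
  d : ∀ k, F k →+ F (k + 1)
  E : ∀ k, AddSubgroup (F k)
  I : ∀ k, AddSubgroup (F k)

attribute [instance] SparkTriple.addCommGroup

namespace SparkTriple

variable (S : SparkTriple.{w})

/-- The image of the differential in degree `k`. -/
def coboundaries : ∀ k, AddSubgroup (S.F k)
  | 0 => ⊥
  | k + 1 => (S.d k).range

/-- The image of the differential of `E` in degree `k`. -/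
def coboundariesE : ∀ k, AddSubgroup (S.F k)
  | 0 => ⊥
  | k + 1 => (S.E k).map (S.d k)

/-- A triple is a spark complex if `F` is a cochain complex, `E` and `I` are subcomplexes which meet only
in zero in positive degrees, and the inclusion of `E` into `F` induces an isomorphism in cohomology. -/
structure IsSparkComplex : Prop where
  d_d : ∀ k x, S.d (k + 1) (S.d k x) = 0
  d_mem_E : ∀ k, ∀ x ∈ S.E k, S.d k x ∈ S.E (k + 1)
  d_mem_I : ∀ k, ∀ x ∈ S.I k, S.d k x ∈ S.I (k + 1)
  I_inf_E : ∀ k, 0 < k → S.I k ⊓ S.E k = ⊥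
  cohomology_injective : ∀ k, ∀ e ∈ S.E k, e ∈ S.coboundaries k → e ∈ S.coboundariesE k
  cohomology_surjective : ∀ k x, S.d k x = 0 →
    ∃ e ∈ S.E k, S.d k e = 0 ∧ x - e ∈ S.coboundaries k

end SparkTriple

/-- Spark complexes. -/
structure SpCx : Type (w + 1) extends SparkTriple.{w} where
  isSparkComplex : toSparkTriple.IsSparkComplex

/-- Spark homomorphisms: cochain maps that preserve the two subcomplexes. -/
@[ext]
structure SparkHom (S T : SpCx.{w}) : Type w where
  toFun : ∀ k, S.F k →+ T.F k
  comm : ∀ k x, toFun (k + 1) (S.d k x) = T.d k (toFun k x)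
  map_E : ∀ k, ∀ x ∈ S.E k, toFun k x ∈ T.E k
  map_I : ∀ k, ∀ x ∈ S.I k, toFun k x ∈ T.I k

/-- The identity spark homomorphism. -/
def SparkHom.id (S : SpCx.{w}) : SparkHom S S where
  toFun k := AddMonoidHom.id (S.F k)
  comm _ _ := rfl
  map_E _ _ h := h
  map_I _ _ h := h

/-- Composition of spark homomorphisms, in diagrammatic order. -/
def SparkHom.comp {S T R : SpCx.{w}} (f : SparkHom S T) (g : SparkHom T R) : SparkHom S R where
  toFun k := (g.toFun k).comp (f.toFun k)
  comm k x := (congrArg (g.toFun (k + 1)) (f.comm k x)).trans (g.comm k _)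
  map_E k x h := g.map_E k _ (f.map_E k x h)
  map_I k x h := g.map_I k _ (f.map_I k x h)

/-- A spark homotopy from `f` to `g`: maps `F^(k+1) → F^k` with `d Φ + Φ d = g - f` (the term `d Φ` is
absent in degree zero), zero on `E`, and preserving `I`. -/
@[ext]
structure SparkHomotopy {S T : SpCx.{w}} (f g : SparkHom S T) : Type w where
  toFun : ∀ k, S.F (k + 1) →+ T.F k
  eq_zero : ∀ x, toFun 0 (S.d 0 x) = g.toFun 0 x - f.toFun 0 x
  eq_succ : ∀ k x, T.d k (toFun k x) + toFun (k + 1) (S.d (k + 1) x) =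
    g.toFun (k + 1) x - f.toFun (k + 1) x
  vanish_E : ∀ k, ∀ x ∈ S.E (k + 1), toFun k x = 0
  map_I : ∀ k, ∀ x ∈ S.I (k + 1), toFun k x ∈ T.I k

namespace SparkHomotopy

variable {S T R : SpCx.{w}}

/-- The zero homotopy. -/
def refl (f : SparkHom S T) : SparkHomotopy f f where
  toFun _ := 0
  eq_zero _ := by simp
  eq_succ _ _ := by simp
  vanish_E _ _ _ := rfl
  map_I k _ _ := (T.I k).zero_mem

/-- Vertical composition of spark homotopies. -/
def trans {f g h : SparkHom S T} (P : SparkHomotopy f g) (Q : SparkHomotopy g h) :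
    SparkHomotopy f h where
  toFun k := Q.toFun k + P.toFun k
  eq_zero x := by
    simp only [AddMonoidHom.add_apply, P.eq_zero, Q.eq_zero]; abel
  eq_succ k x := by
    have h1 := P.eq_succ k x
    have h2 := Q.eq_succ k x
    simp only [AddMonoidHom.add_apply, map_add]
    rw [← sub_add_sub_cancel _ (g.toFun (k + 1) x), ← h1, ← h2]; abel
  vanish_E k x hx := by simp [P.vanish_E k x hx, Q.vanish_E k x hx]
  map_I k x hx := (T.I k).add_mem (Q.map_I k x hx) (P.map_I k x hx)

/-- Precomposition of a spark homotopy with a spark homomorphism. -/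
def preComp (f : SparkHom S T) {g h : SparkHom T R} (P : SparkHomotopy g h) :
    SparkHomotopy (f.comp g) (f.comp h) where
  toFun k := (P.toFun k).comp (f.toFun (k + 1))
  eq_zero x := (congrArg (P.toFun 0) (f.comm 0 x)).trans (P.eq_zero _)
  eq_succ k x := by
    have h1 := P.eq_succ k (f.toFun (k + 1) x)
    rw [← f.comm] at h1
    exact h1
  vanish_E k x hx := P.vanish_E k _ (f.map_E _ x hx)
  map_I k x hx := P.map_I k _ (f.map_I _ x hx)

/-- Postcomposition of a spark homotopy with a spark homomorphism. -/
def postComp {f g : SparkHom S T} (P : SparkHomotopy f g) (h : SparkHom T R) :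
    SparkHomotopy (f.comp h) (g.comp h) where
  toFun k := (h.toFun k).comp (P.toFun k)
  eq_zero x := (congrArg (h.toFun 0) (P.eq_zero x)).trans (map_sub _ _ _)
  eq_succ k x := by
    have h1 := congrArg (h.toFun (k + 1)) (P.eq_succ k x)
    rw [map_add, h.comm, map_sub] at h1
    exact h1
  vanish_E k x hx := (congrArg (h.toFun k) (P.vanish_E k x hx)).trans (map_zero _)
  map_I k x hx := h.map_I k _ (P.map_I k x hx)

/-- A homotopy from `P` to `Q` between spark homotopies: maps `F^(k+2) → F^k` with `d Γ - Γ d = Q - P`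
(the term `d Γ` is absent in degree one, and in degree zero both sides vanish), zero on `E`, and
preserving `I`. -/
structure Htpy {f g : SparkHom S T} (P Q : SparkHomotopy f g) : Type w where
  toFun : ∀ k, S.F (k + 2) →+ T.F k
  eq_zero : ∀ x, - toFun 0 (S.d 1 x) = Q.toFun 0 x - P.toFun 0 x
  eq_succ : ∀ k x, T.d k (toFun k x) - toFun (k + 1) (S.d (k + 2) x) =
    Q.toFun (k + 1) x - P.toFun (k + 1) x
  vanish_E : ∀ k, ∀ x ∈ S.E (k + 2), toFun k x = 0
  map_I : ∀ k, ∀ x ∈ S.I (k + 2), toFun k x ∈ T.I k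

def Htpy.refl {f g : SparkHom S T} (P : SparkHomotopy f g) : Htpy P P where
  toFun _ := 0
  eq_zero _ := by simp
  eq_succ _ _ := by simp
  vanish_E _ _ _ := rfl
  map_I k _ _ := (T.I k).zero_mem

def Htpy.symm {f g : SparkHom S T} {P Q : SparkHomotopy f g} (G : Htpy P Q) : Htpy Q P where
  toFun k := - G.toFun k
  eq_zero x := by
    have h := G.eq_zero x
    simp only [AddMonoidHom.neg_apply]
    rw [← neg_sub, ← h]
  eq_succ k x := by
    have h := G.eq_succ k x
    simp only [AddMonoidHom.neg_apply, map_neg]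
    rw [← neg_sub (Q.toFun (k + 1) x), ← h]; abel
  vanish_E k x hx := by simp [G.vanish_E k x hx]
  map_I k x hx := (T.I k).neg_mem (G.map_I k x hx)

/-- Homotopies are added under vertical composition, both along the second and along the first
direction. -/
def Htpy.add {f g h : SparkHom S T} {P P' : SparkHomotopy f g} {Q Q' : SparkHomotopy g h}
    (G : Htpy P P') (H : Htpy Q Q') : Htpy (P.trans Q) (P'.trans Q') where
  toFun k := G.toFun k + H.toFun k
  eq_zero x := by
    have h1 := G.eq_zero x
    have h2 := H.eq_zero x
    simp only [AddMonoidHom.add_apply, trans]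
    rw [add_sub_add_comm, ← h1, ← h2]; abel
  eq_succ k x := by
    have h1 := G.eq_succ k x
    have h2 := H.eq_succ k x
    simp only [AddMonoidHom.add_apply, trans, map_add]
    rw [add_sub_add_comm _ _ (Q.toFun _ _), ← h1, ← h2]; abel
  vanish_E k x hx := by simp [G.vanish_E k x hx, H.vanish_E k x hx]
  map_I k x hx := (T.I k).add_mem (G.map_I k x hx) (H.map_I k x hx)

def Htpy.trans {f g : SparkHom S T} {P Q R : SparkHomotopy f g} (G : Htpy P Q) (H : Htpy Q R) :
    Htpy P R where
  toFun k := G.toFun k + H.toFun k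
  eq_zero x := by
    have h1 := G.eq_zero x
    have h2 := H.eq_zero x
    simp only [AddMonoidHom.add_apply]
    rw [← sub_add_sub_cancel _ (Q.toFun 0 x), ← h1, ← h2]; abel
  eq_succ k x := by
    have h1 := G.eq_succ k x
    have h2 := H.eq_succ k x
    simp only [AddMonoidHom.add_apply, map_add]
    rw [← sub_add_sub_cancel (R.toFun (k + 1) x) (Q.toFun (k + 1) x), ← h1, ← h2]; abel
  vanish_E k x hx := by simp [G.vanish_E k x hx, H.vanish_E k x hx]
  map_I k x hx := (T.I k).add_mem (G.map_I k x hx) (H.map_I k x hx)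

def Htpy.preComp (f : SparkHom S T) {g h : SparkHom T R} {P Q : SparkHomotopy g h}
    (G : Htpy P Q) : Htpy (P.preComp f) (Q.preComp f) where
  toFun k := (G.toFun k).comp (f.toFun (k + 2))
  eq_zero x := by
    have h1 := G.eq_zero (f.toFun 1 x)
    rw [← f.comm] at h1
    exact h1
  eq_succ k x := by
    have h1 := G.eq_succ k (f.toFun (k + 2) x)
    rw [← f.comm] at h1
    exact h1
  vanish_E k x hx := G.vanish_E k _ (f.map_E _ x hx)
  map_I k x hx := G.map_I k _ (f.map_I _ x hx)

def Htpy.postComp {f g : SparkHom S T} {P Q : SparkHomotopy f g} (G : Htpy P Q)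
    (h : SparkHom T R) : Htpy (P.postComp h) (Q.postComp h) where
  toFun k := (h.toFun k).comp (G.toFun k)
  eq_zero x := by
    have h1 := congrArg (h.toFun 0) (G.eq_zero x)
    rw [map_neg, map_sub] at h1
    exact h1
  eq_succ k x := by
    have h1 := congrArg (h.toFun (k + 1)) (G.eq_succ k x)
    rw [map_sub, map_sub, h.comm] at h1
    exact h1
  vanish_E k x hx := (congrArg (h.toFun k) (G.vanish_E k x hx)).trans (map_zero _)
  map_I k x hx := h.map_I k _ (G.map_I k x hx)

/-- The two ways to compose two homotopies horizontally are homotopic. -/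
def Htpy.exchange {f g : SparkHom S T} {h i : SparkHom T R} (P : SparkHomotopy f g)
    (Q : SparkHomotopy h i) :
    Htpy ((P.postComp h).trans (Q.preComp g)) ((Q.preComp f).trans (P.postComp i)) where
  toFun k := (Q.toFun k).comp (P.toFun (k + 1))
  eq_zero x := by
    have h1 := P.eq_succ 0 x
    have h2 := Q.eq_zero (P.toFun 0 x)
    have h3 := congrArg (Q.toFun 0) h1
    rw [map_add, map_sub, h2] at h3
    simp only [SparkHomotopy.trans, SparkHomotopy.preComp, SparkHomotopy.postComp, AddMonoidHom.comp_apply,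
      AddMonoidHom.add_apply]
    rw [← sub_eq_zero] at h3 ⊢
    rw [← neg_eq_zero, ← h3]
    abel
  eq_succ k x := by
    have h1 := P.eq_succ (k + 1) x
    have h2 := Q.eq_succ k (P.toFun (k + 1) x)
    have h3 := congrArg (Q.toFun (k + 1)) h1
    rw [map_add, map_sub] at h3
    simp only [SparkHomotopy.trans, SparkHomotopy.preComp, SparkHomotopy.postComp, AddMonoidHom.comp_apply,
      AddMonoidHom.add_apply]
    rw [← sub_eq_zero] at h2 h3 ⊢
    rw [← sub_zero (0 : R.F (k + 1))]
    nth_rw 1 [← h2]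
    rw [← h3]
    abel
  vanish_E k x hx := by
    simp [P.vanish_E _ x hx]
  map_I k x hx := Q.map_I k _ (P.map_I _ x hx)

instance setoid (f g : SparkHom S T) : Setoid (SparkHomotopy f g) where
  r P Q := Nonempty (Htpy P Q)
  iseqv := ⟨fun P => ⟨Htpy.refl P⟩, fun ⟨G⟩ => ⟨G.symm⟩, fun ⟨G⟩ ⟨H⟩ => ⟨G.trans H⟩⟩

/-- Spark homotopy classes. -/
def Class (f g : SparkHom S T) : Type w := Quotient (setoid f g)

/-- The class of a spark homotopy. -/
def toClass {f g : SparkHom S T} (P : SparkHomotopy f g) : Class f g := Quotient.mk _ P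

end SparkHomotopy

/-- Spark homotopy classes under vertical composition. -/
instance (S T : SpCx.{w}) : Category (SparkHom S T) where
  Hom f g := SparkHomotopy.Class f g
  id f := (SparkHomotopy.refl f).toClass
  comp a b := Quotient.map₂ SparkHomotopy.trans
    (fun _ _ (h1 : Nonempty _) _ _ (h2 : Nonempty _) => ⟨h1.some.add h2.some⟩) a b
  id_comp a := by
    induction a using Quotient.inductionOn with | h a =>
    exact congrArg SparkHomotopy.toClass (SparkHomotopy.ext (funext fun k => add_zero _))
  comp_id a := by
    induction a using Quotient.inductionOn with | h a =>
    exact congrArg SparkHomotopy.toClass (SparkHomotopy.ext (funext fun k => zero_add _))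
  assoc a b c := by
    induction a using Quotient.inductionOn with | h a =>
    induction b using Quotient.inductionOn with | h b =>
    induction c using Quotient.inductionOn with | h c =>
    exact congrArg SparkHomotopy.toClass
      (SparkHomotopy.ext (funext fun k => (add_assoc _ _ _).symm))

namespace SparkHom

variable {S T R : SpCx.{w}}

def whiskerLeft (f : SparkHom S T) {g h : SparkHom T R} (b : g ⟶ h) : f.comp g ⟶ f.comp h :=
  Quotient.map (SparkHomotopy.preComp f) (fun _ _ (h : Nonempty _) => ⟨h.some.preComp f⟩) b

def whiskerRight {f g : SparkHom S T} (a : f ⟶ g) (h : SparkHom T R) : f.comp h ⟶ g.comp h :=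
  Quotient.map (fun P => P.postComp h) (fun _ _ (h' : Nonempty _) => ⟨h'.some.postComp h⟩) a

end SparkHom

/-- The 2-category of spark complexes, spark homomorphisms and spark homotopy classes. -/
instance : Bicategory SpCx.{w} where
  Hom S T := SparkHom S T
  id S := SparkHom.id S
  comp f g := SparkHom.comp f g
  homCategory _ _ := inferInstance
  whiskerLeft f _ _ b := SparkHom.whiskerLeft f b
  whiskerRight a h := SparkHom.whiskerRight a h
  associator f g h := Iso.refl (f.comp (g.comp h))
  leftUnitor f := Iso.refl f
  rightUnitor f := Iso.refl f
  whiskerLeft_id _ _ := rfl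
  whiskerLeft_comp f _ _ _ a b := by
    induction a using Quotient.inductionOn with | h a =>
    induction b using Quotient.inductionOn with | h b =>
    rfl
  id_whiskerLeft {_ _ f g} b := by
    refine Eq.trans ?_ ((Category.id_comp _).trans (Category.comp_id _)).symm
    induction b using Quotient.inductionOn with | h b =>
    rfl
  comp_whiskerLeft f g _ _ b := by
    refine Eq.trans ?_ ((Category.id_comp _).trans (Category.comp_id _)).symm
    induction b using Quotient.inductionOn with | h b =>
    rfl
  id_whiskerRight f g := congrArg SparkHomotopy.toClass <|
    SparkHomotopy.ext <| funext fun k => AddMonoidHom.ext fun x => map_zero (g.toFun k)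
  comp_whiskerRight a b g := by
    induction a using Quotient.inductionOn with | h a =>
    induction b using Quotient.inductionOn with | h b =>
    exact congrArg SparkHomotopy.toClass <|
      SparkHomotopy.ext <| funext fun k => AddMonoidHom.ext fun x => map_add (g.toFun k) _ _
  whiskerRight_id b := by
    refine Eq.trans ?_ ((Category.id_comp _).trans (Category.comp_id _)).symm
    induction b using Quotient.inductionOn with | h b =>
    rfl
  whiskerRight_comp b g h := by
    refine Eq.trans ?_ ((Category.id_comp _).trans (Category.comp_id _)).symm
    induction b using Quotient.inductionOn with | h b =>
    rfl
  whisker_assoc f _ _ b h := by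
    refine Eq.trans ?_ ((Category.id_comp _).trans (Category.comp_id _)).symm
    induction b using Quotient.inductionOn with | h b =>
    rfl
  whisker_exchange a b := by
    induction a using Quotient.inductionOn with | h a =>
    induction b using Quotient.inductionOn with | h b =>
    exact Quotient.sound ⟨(SparkHomotopy.Htpy.exchange a b).symm⟩
  pentagon f g h i := by
    refine Eq.trans (congrArg (· ≫ _) ?_) (Category.id_comp _)
    exact congrArg SparkHomotopy.toClass <|
      SparkHomotopy.ext <| funext fun k => AddMonoidHom.ext fun x => map_zero (i.toFun k)
  triangle f g := by
    refine (Category.id_comp _).trans ?_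
    exact congrArg SparkHomotopy.toClass (a₁ := SparkHomotopy.refl (f.comp g)) <|
      SparkHomotopy.ext <| funext fun k => AddMonoidHom.ext fun x => (map_zero (g.toFun k)).symm

instance : Bicategory.Strict SpCx.{w} where
  id_comp _ := rfl
  comp_id _ := rfl
  assoc _ _ _ := rfl
  leftUnitor_eqToIso _ := rfl
  rightUnitor_eqToIso _ := rfl
  associator_eqToIso _ _ _ := rfl

/-- Pullback of forms as a homomorphism of groups. -/
def pullbackHom {S : Set (EE n)} {T : Set (EE m)} (f : S → T) (q : ℕ) :
    FormFun m q →+ FormFun n q where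
  toFun := pullback f
  map_zero' := by
    funext x; by_cases hx : x ∈ S <;> simp [pullback, hx]; rfl
  map_add' := pullback_add f

namespace GoodAtlas

variable (U : GoodAtlas.{u, v} X n)

/-- Alternating `p`-cochains with values in invariant `q`-forms: families indexed by strings `I` of length
`p + 1` whose member at `I` is an invariant form on the chart of the union of `I`. -/
def cochain (p q : ℕ) : AddSubgroup ((Fin (p + 1) → U.Idx) → FormFun n q) where
  carrier := {θ | (∀ I, θ I ∈ (U.ch (U.cup I)).invForms q) ∧
    ∀ I j k, j ≠ k → θ (I ∘ Equiv.swap j k) = - θ I}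
  zero_mem' := ⟨fun _ => zero_mem _, fun _ _ _ _ => by simp⟩
  add_mem' ha hb := ⟨fun I => add_mem (ha.1 I) (hb.1 I), fun I j k h => by
    simp only [Pi.add_apply, ha.2 I j k h, hb.2 I j k h]; abel⟩
  neg_mem' ha := ⟨fun I => neg_mem (ha.1 I), fun I j k h => by
    simp only [Pi.neg_apply, ha.2 I j k h]⟩

theorem restr_congr {I I' J J' : U.Idx} (hI : I = I') (hJ : J = J')
    (h : (U.ch I).base ⊆ (U.ch J).base) (h' : (U.ch I').base ⊆ (U.ch J').base) {q : ℕ}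
    (θ : FormFun n q) : U.restr h θ = U.restr h' θ := by
  subst hI hJ; rfl

theorem restr_neg {I J : U.Idx} (h : (U.ch I).base ⊆ (U.ch J).base) {q : ℕ}
    (θ : FormFun n q) : U.restr h (-θ) = - U.restr h θ :=
  map_neg (pullbackHom (embFun (U.emb h)) q) θ

theorem cup_comp_perm {p : ℕ} (I : Fin (p + 1) → U.Idx) (s : Equiv.Perm (Fin (p + 1))) :
    U.cup (I ∘ s) = U.cup I := by
  apply le_antisymm
  · exact Finset.sup'_le _ _ fun k _ => U.le_cup I (s k)
  · refine Finset.sup'_le _ _ fun k _ => ?_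
    have h := U.le_cup (I ∘ s) (s.symm k)
    simpa using h

/-- The Čech differential on families of forms. -/
def deltaFun {p q : ℕ} (θ : (Fin (p + 1) → U.Idx) → FormFun n q) :
    (Fin (p + 2) → U.Idx) → FormFun n q := fun I =>
  ∑ k : Fin (p + 2), (-1 : ℤ) ^ (k : ℕ) •
    U.restr (U.base_cup_subset I k.succAbove) (θ (I ∘ k.succAbove))

theorem deltaFun_adjacent {p q : ℕ} {θ : (Fin (p + 1) → U.Idx) → FormFun n q}
    (hθ : ∀ I j k, j ≠ k → θ (I ∘ Equiv.swap j k) = - θ I) (I : Fin (p + 2) → U.Idx)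
    (j : Fin (p + 1)) :
    U.deltaFun θ (I ∘ Equiv.swap j.castSucc j.succ) = - U.deltaFun θ I := by
  have hne : j.castSucc ≠ j.succ := (Fin.castSucc_lt_succ).ne
  set s := Equiv.swap j.castSucc j.succ with hs
  unfold deltaFun
  rw [← Finset.sum_neg_distrib]
  refine Fintype.sum_equiv s _ _ fun k => ?_
  by_cases h1 : k = j.castSucc
  · subst h1
    have e : (I ∘ s) ∘ j.castSucc.succAbove = I ∘ j.succ.succAbove := by
      funext x
      simp only [Function.comp_apply]
      congr 1
      rcases lt_trichotomy x j with hx | hx | hx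
      · rw [Fin.succAbove_of_castSucc_lt _ _ (Fin.castSucc_lt_castSucc_iff.2 hx),
          Fin.succAbove_of_castSucc_lt _ _ ((Fin.castSucc_lt_castSucc_iff.2 hx).trans
            Fin.castSucc_lt_succ), hs, Equiv.swap_apply_of_ne_of_ne]
        · exact (Fin.castSucc_lt_castSucc_iff.2 hx).ne
        · exact ((Fin.castSucc_lt_castSucc_iff.2 hx).trans Fin.castSucc_lt_succ).ne
      · subst hx
        rw [Fin.succAbove_castSucc_self, Fin.succAbove_succ_self, hs, Equiv.swap_apply_right]
      · rw [Fin.succAbove_of_le_castSucc _ _ (Fin.castSucc_le_castSucc_iff.2 hx.le),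
          Fin.succAbove_of_le_castSucc j.succ _ (Fin.succ_le_castSucc_iff.2 hx), hs,
          Equiv.swap_apply_of_ne_of_ne]
        · exact (Fin.castSucc_lt_succ_iff.2 hx.le).ne'
        · exact fun h => hx.ne' (Fin.succ_injective _ h)
    have h2 : s j.castSucc = j.succ := Equiv.swap_apply_left _ _
    rw [h2, U.restr_congr (U.cup_comp_perm I s) (congrArg U.cup e) _
      (U.base_cup_subset I j.succ.succAbove), e]
    simp [pow_succ]
  by_cases h2 : k = j.succ
  · subst h2
    have e : (I ∘ s) ∘ j.succ.succAbove = I ∘ j.castSucc.succAbove := by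
      funext x
      simp only [Function.comp_apply]
      congr 1
      rcases lt_trichotomy x j with hx | hx | hx
      · rw [Fin.succAbove_of_castSucc_lt _ _ (Fin.castSucc_lt_castSucc_iff.2 hx),
          Fin.succAbove_of_castSucc_lt _ _ ((Fin.castSucc_lt_castSucc_iff.2 hx).trans
            Fin.castSucc_lt_succ), hs, Equiv.swap_apply_of_ne_of_ne]
        · exact (Fin.castSucc_lt_castSucc_iff.2 hx).ne
        · exact ((Fin.castSucc_lt_castSucc_iff.2 hx).trans Fin.castSucc_lt_succ).ne
      · subst hx
        rw [Fin.succAbove_castSucc_self, Fin.succAbove_succ_self, hs, Equiv.swap_apply_left]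
      · rw [Fin.succAbove_of_le_castSucc _ _ (Fin.castSucc_le_castSucc_iff.2 hx.le),
          Fin.succAbove_of_le_castSucc j.succ _ (Fin.succ_le_castSucc_iff.2 hx), hs,
          Equiv.swap_apply_of_ne_of_ne]
        · exact (Fin.castSucc_lt_succ_iff.2 hx.le).ne'
        · exact fun h => hx.ne' (Fin.succ_injective _ h)
    have h2 : s j.succ = j.castSucc := Equiv.swap_apply_right _ _
    rw [h2, U.restr_congr (U.cup_comp_perm I s) (congrArg U.cup e) _
      (U.base_cup_subset I j.castSucc.succAbove), e]
    simp [pow_succ]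
  · obtain ⟨a, ha⟩ := Fin.exists_succAbove_eq (Ne.symm h1)
    obtain ⟨b, hb⟩ := Fin.exists_succAbove_eq (Ne.symm h2)
    have hab : a ≠ b := by
      rintro rfl; exact hne (ha.symm.trans hb)
    have e : (I ∘ s) ∘ k.succAbove = (I ∘ k.succAbove) ∘ Equiv.swap a b := by
      funext x
      simp only [Function.comp_apply]
      rw [(Fin.succAbove_right_injective (p := k)).map_swap, ha, hb]
    have h3 : s k = k := Equiv.swap_apply_of_ne_of_ne h1 h2
    rw [h3, U.restr_congr (U.cup_comp_perm I s) ((congrArg U.cup e).trans (U.cup_comp_perm _ _)) _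
      (U.base_cup_subset I k.succAbove), e, hθ _ _ _ hab, restr_neg, smul_neg]

theorem alternating_of_adjacent {A : Type*} [AddCommGroup A] {B : Type*} {p : ℕ}
    (c : (Fin (p + 1) → B) → A)
    (h : ∀ I (j : Fin p), c (I ∘ Equiv.swap j.castSucc j.succ) = - c I) (I : Fin (p + 1) → B)
    (j k : Fin (p + 1)) (hjk : j ≠ k) : c (I ∘ Equiv.swap j k) = - c I := by
  have key : ∀ s : Equiv.Perm (Fin (p + 1)), ∀ I, c (I ∘ s) = ((Equiv.Perm.sign s : ℤˣ) : ℤ) • c I := by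
    intro s
    have hs : s ∈ Submonoid.closure
        (Set.range fun i : Fin p => Equiv.swap i.castSucc i.succ) := by
      rw [Equiv.Perm.mclosure_swap_castSucc_succ]; trivial
    induction hs using Submonoid.closure_induction with
    | mem x hx =>
      obtain ⟨i, rfl⟩ := hx
      intro I
      rw [h, Equiv.Perm.sign_swap (Fin.castSucc_lt_succ).ne]
      simp
    | one => intro I; simp
    | mul x y _ _ hx hy =>
      intro I
      rw [Equiv.Perm.coe_mul, ← Function.comp_assoc, hy, hx, smul_smul, Equiv.Perm.sign_mul,
        Units.val_mul, mul_comm]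
  rw [key, Equiv.Perm.sign_swap hjk]
  simp

theorem deltaFun_add {p q : ℕ} (a b : (Fin (p + 1) → U.Idx) → FormFun n q) :
    U.deltaFun (a + b) = U.deltaFun a + U.deltaFun b := by
  funext I
  have h : ∀ k : Fin (p + 2), (-1 : ℤ) ^ (k : ℕ) •
      U.restr (U.base_cup_subset I k.succAbove) ((a + b) (I ∘ k.succAbove)) =
      (-1 : ℤ) ^ (k : ℕ) • U.restr (U.base_cup_subset I k.succAbove) (a (I ∘ k.succAbove)) +
      (-1 : ℤ) ^ (k : ℕ) • U.restr (U.base_cup_subset I k.succAbove) (b (I ∘ k.succAbove)) := by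
    intro k
    rw [← smul_add]
    exact congrArg _ (pullback_add _ _ _)
  simp only [Pi.add_apply, deltaFun, ← Finset.sum_add_distrib]
  exact Finset.sum_congr rfl fun k _ => h k

/-- The Čech differential on cochains. -/
def delta (p q : ℕ) : U.cochain p q →+ U.cochain (p + 1) q :=
  AddMonoidHom.mk' (fun θ => ⟨U.deltaFun θ, fun I => sum_mem fun k _ => zsmul_mem
      (pullback_mem_invForms (U.emb (U.base_cup_subset I k.succAbove)) (θ.2.1 _)) _,
    alternating_of_adjacent _ (U.deltaFun_adjacent θ.2.2)⟩) fun a b =>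
    Subtype.ext (U.deltaFun_add a.1 b.1)

/-- The exterior derivative on cochains. -/
def extDer (p q : ℕ) : U.cochain p q →+ U.cochain p (q + 1) :=
  AddMonoidHom.mk' (fun θ => ⟨fun I => extD (U.ch (U.cup I)).dom (θ.1 I),
    fun I => extD_mem_invForms (θ.2.1 I), fun I j k h => by
      beta_reduce
      rw [θ.2.2 I j k h, U.cup_comp_perm]
      funext x
      by_cases hx : x ∈ (U.ch (U.cup I)).dom
      · simp only [extD, indicator_of_mem hx, Pi.neg_apply]
        rw [← neg_one_smul ℝ (θ.1 I), extDeriv_smul, neg_one_smul]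
      · simp [extD, hx]⟩) fun a b => by
    ext1; funext I
    exact extD_add (U.ch (U.cup I)).isOpen_dom (a.2.1 I).1 (b.2.1 I).1

end GoodAtlas

/-- Bidegrees `(p, q)` of total degree `k`. -/
abbrev Bideg (k : ℕ) : Type := {b : ℕ × ℕ // b.1 + b.2 = k}

namespace GoodAtlas

variable (U : GoodAtlas.{u, v} X n)

/-- The total complex in degree `k`, the direct sum of the cochain groups with `p + q = k`. -/
abbrev Tot (k : ℕ) : Type v := ∀ b : Bideg k, U.cochain b.1.1 b.1.2

/-- The total differential, `δ + (-1)^p d` in bidegree `(p, q)`. -/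
def totalDFun (k : ℕ) (θ : U.Tot k) : U.Tot (k + 1)
  | ⟨(0, 0), _⟩ => 0
  | ⟨(0, q + 1), h⟩ => U.extDer 0 q (θ ⟨(0, q), by simp only at h ⊢; omega⟩)
  | ⟨(p + 1, 0), h⟩ => U.delta p 0 (θ ⟨(p, 0), by simp only at h ⊢; omega⟩)
  | ⟨(p + 1, q + 1), h⟩ => U.delta p (q + 1) (θ ⟨(p, q + 1), by simp only at h ⊢; omega⟩) +
      (-1 : ℤ) ^ (p + 1) • U.extDer (p + 1) q (θ ⟨(p + 1, q), by simp only at h ⊢; omega⟩)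

theorem totalDFun_add (k : ℕ) (a b : U.Tot k) :
    U.totalDFun k (a + b) = U.totalDFun k a + U.totalDFun k b := by
  funext ⟨⟨p, q⟩, h⟩
  rcases p with _ | p <;> rcases q with _ | q
  · exact (add_zero _).symm
  · exact map_add (U.extDer 0 q) _ _
  · exact map_add (U.delta p 0) _ _
  · refine (congrArg₂ (· + ·) (map_add (U.delta p (q + 1)) _ _)
      ((congrArg _ (map_add (U.extDer (p + 1) q) _ _)).trans (smul_add ((-1 : ℤ) ^ (p + 1)) _ _))).trans ?_
    exact add_add_add_comm _ _ _ _

/-- The total differential as a homomorphism. -/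
def totalD (k : ℕ) : U.Tot k →+ U.Tot (k + 1) :=
  AddMonoidHom.mk' (U.totalDFun k) (U.totalDFun_add k)

/-- The `k`-forms on the good atlas: families of invariant forms on the charts which are compatible with
all embeddings, placed in bidegree `(0, k)`. -/
def globalForms (k : ℕ) : AddSubgroup (U.Tot k) where
  carrier := {θ | (∀ b : Bideg k, b.1.1 ≠ 0 → θ b = 0) ∧
    ∀ {I J : U.Idx} (l : I ⟶ J), pullback (embFun l) ((θ ⟨(0, k), zero_add k⟩).1 fun _ => J) =
      (θ ⟨(0, k), zero_add k⟩).1 fun _ => I}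
  zero_mem' := ⟨fun _ _ => rfl, fun l => map_zero (pullbackHom (embFun l) k)⟩
  add_mem' {a b} ha hb := ⟨fun c hc => by simp [ha.1 c hc, hb.1 c hc], fun l => by
    refine (pullback_add _ _ _).trans ?_
    rw [ha.2 l, hb.2 l]; rfl⟩
  neg_mem' {a} ha := ⟨fun c hc => by simp [ha.1 c hc], fun l => by
    refine (map_neg (pullbackHom (embFun l) k) _).trans ?_
    exact congrArg _ (ha.2 l)⟩

/-- The constant function `c` on `S`, as a `0`-form. -/
def constForm (S : Set (EE n)) (c : ℝ) : FormFun n 0 :=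
  S.indicator fun _ => ContinuousAlternatingMap.constOfIsEmpty ℝ (EE n) (Fin 0) c

/-- The alternating `k`-cochains of integer constants, placed in bidegree `(k, 0)`. -/
def intCochains (k : ℕ) : AddSubgroup (U.Tot k) where
  carrier := {θ | (∀ b : Bideg k, b.1.2 ≠ 0 → θ b = 0) ∧
    ∀ I, ∃ c : ℤ, (θ ⟨(k, 0), add_zero k⟩).1 I = constForm (U.ch (U.cup I)).dom c}
  zero_mem' := ⟨fun _ _ => rfl, fun I => ⟨0, by
    funext x; by_cases hx : x ∈ (U.ch (U.cup I)).dom <;> simp [constForm, hx]; rfl⟩⟩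
  add_mem' {a b} ha hb := ⟨fun c hc => by simp [ha.1 c hc, hb.1 c hc], fun I => by
    obtain ⟨c, hc⟩ := ha.2 I
    obtain ⟨d, hd⟩ := hb.2 I
    refine ⟨c + d, (congrArg₂ (· + ·) hc hd).trans ?_⟩
    funext x; by_cases hx : x ∈ (U.ch (U.cup I)).dom <;> simp [constForm, hx]; rfl⟩
  neg_mem' {a} ha := ⟨fun c hc => by simp [ha.1 c hc], fun I => by
    obtain ⟨c, hc⟩ := ha.2 I
    refine ⟨-c, (congrArg Neg.neg hc).trans ?_⟩
    funext x; by_cases hx : x ∈ (U.ch (U.cup I)).dom <;> simp [constForm, hx]; rfl⟩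

end GoodAtlas

/-- The triple of the total complex, the forms and the integral cochains of a good atlas. -/
def GPreOrb.sparkTriple (U : GPreOrb.{u, v}) : SparkTriple.{v} where
  F := U.atlas.Tot
  d := U.atlas.totalD
  E := U.atlas.globalForms
  I := U.atlas.intCochains

namespace CompatSys

variable {U : GoodAtlas.{u, v} X n} {V : GoodAtlas.{u, v} Y m}

/-- Pullback of cochains along a compatible system: the member at `I` is the pullback, along the lifting
on the chart of the union of `I`, of the member at the image of the string `I`. -/
def pullbackFun (f : CompatSys U V) {p q : ℕ} (θ : (Fin (p + 1) → V.Idx) → FormFun m q) :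
    (Fin (p + 1) → U.Idx) → FormFun n q := fun I =>
  pullback (f.lift (U.cup I)) (θ fun k => f.functor.obj (I k))

/-- For `I = I₀ … I_p` the string `f I₀, …, f I_j, g I_j, …, g I_p`. -/
def mixed (f g : CompatSys U V) {p : ℕ} (I : Fin (p + 1) → U.Idx) (j : Fin (p + 1)) :
    Fin (p + 2) → V.Idx := fun k =>
  if k ≤ j.castSucc then f.functor.obj (I (j.predAbove k))
  else g.functor.obj (I (j.predAbove k))

theorem obj_mono (f : CompatSys U V) {I J : U.Idx} (h : I ≤ J) :
    f.functor.obj I ≤ f.functor.obj J := by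
  have h1 := f.map_sup I J
  rw [sup_eq_right.2 h] at h1
  exact sup_eq_right.1 h1.symm

theorem base_subset_mixed {f g : CompatSys U V} (a : f ⟶ g) {p : ℕ} (I : Fin (p + 1) → U.Idx)
    (j : Fin (p + 1)) :
    (V.ch (f.functor.obj (U.cup I))).base ⊆ (V.ch (V.cup (mixed f g I j))).base := by
  refine V.subset_base_cup _ fun k => ?_
  have h1 : (V.ch (f.functor.obj (U.cup I))).base ⊆
      (V.ch (f.functor.obj (I (j.predAbove k)))).base := V.base_anti (f.obj_mono (U.le_cup I _))
  unfold mixed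
  split_ifs
  · exact h1
  · exact h1.trans (Chart.Emb.base_subset (a.nat.app _))

/-- The sum over `j` of `(-1)^j` times the pullback along `f` of the restriction, to the chart of
`f (I₀ ∪ … ∪ I_p)`, of the member of the cochain at the string `f I₀, …, f I_j, g I_j, …, g I_p`. -/
def prism {f g : CompatSys U V} (a : f ⟶ g) {p q : ℕ}
    (θ : (Fin (p + 2) → V.Idx) → FormFun m q) : (Fin (p + 1) → U.Idx) → FormFun n q := fun I =>
  ∑ j : Fin (p + 1), (-1 : ℤ) ^ (j : ℕ) •
    pullback (f.lift (U.cup I)) (V.restr (base_subset_mixed a I j) (θ (mixed f g I j)))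

end CompatSys

/-- The triple of a good atlas as a spark complex. -/
def GPreOrb.toSpCx (hS : ∀ U : GPreOrb.{u, v}, U.sparkTriple.IsSparkComplex)
    (U : GPreOrb.{u, v}) : SpCx.{v} :=
  ⟨U.sparkTriple, hS U⟩


end

end SparkOrb

open SparkOrb

/-! Spark complexes. The point is that `E → F` is an isomorphism in cohomology, and this follows
from exactness of the rows of the Čech–de Rham double complex. Given a partition of unity `ρ`
subordinate to the cover and smooth in all charts, `η ↦ ∑ ρ_i η_{i I}` contracts the Čech
differential on closed cochains. To read `η_{i I}` on the chart of `I` near a point over `U_i`,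
invert an embedding locally (inverse function theorem); the resulting form does not depend on the
choice, since two lifts over the base differ by group elements on a dense open set (Baire) and the
forms are invariant. The kernel of the Čech differential in column zero is `E`, and the usual
staircase (`exists_globalForm`) shows that a total cochain whose differential lies in column zero is
cohomologous to a global form, which gives injectivity and surjectivity at once.

The 2-functor. All operators between cochain groups are obtained by evaluating cochains at integral
alternating chains of strings. A family of chains `φ I`, whose vertices `J` have a base containing
that of `f (∪ I)`, gives an operator `real φ`: evaluate on the chart of `f (∪ I)` and pull back
along the lifting of `f`. The Čech differential of the source of the operator corresponds to the
boundary of the chains (`real_delta`), that of the target to the alternating sum over the faces of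
`I` (`delta_real`), and the exterior derivative commutes with everything. Pullback along `f` is the
family `I ↦ f ∘ I`. A natural transformation `α : f ⟶ g` embeds the chart of `f (∪ I)` into that of
`g (∪ I)`, so that pullback along `g` is also an operator of this kind relative to `f`
(`real_mk_obj`). A chain homotopy between the two families (`ChainHtpy`) therefore yields a spark
homotopy, and the prism formula gives one for each total order (`prismHtpy`).

The index `f (∪ I)` is itself an admissible vertex, so admissible chains can be coned off: this is
an acyclic carrier. Hence any two chain homotopies differ by a boundary (`fill`) and their spark
homotopies have the same class (`toClass_eq_of_chainHtpy`). Independence of the order and the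
compatibility with units, vertical composition and whiskering are all instances of this, because
every spark homotopy that occurs comes from a chain homotopy. On 1-cells the laws are strict
equalities of pullbacks. -/

namespace SparkOrb

noncomputable section

/-! ### Strings, their faces and alternating functions -/

section Strings

variable {K L A B : Type*} [AddCommGroup A] [AddCommGroup B]

/-- The alternating sum of the values of `F` at the strings that arise from `I` by omission of one entry. -/
def bd {N : ℕ} (F : (Fin N → K) → A) (I : Fin (N + 1) → K) : A :=
  ∑ k : Fin (N + 1), (-1 : ℤ) ^ (k : ℕ) • F (I ∘ k.succAbove)

theorem cons_comp_succAbove_zero {N : ℕ} (i : K) (I : Fin N → K) :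
    (Fin.cons i I : Fin (N + 1) → K) ∘ (0 : Fin (N + 1)).succAbove = I := by
  funext x; simp

theorem cons_comp_succAbove_succ {N : ℕ} (i : K) (I : Fin (N + 1) → K) (k : Fin (N + 1)) :
    (Fin.cons i I : Fin (N + 2) → K) ∘ k.succ.succAbove = Fin.cons i (I ∘ k.succAbove) := by
  funext x
  refine Fin.cases ?_ (fun y => ?_) x <;> simp

theorem cons_comp {N : ℕ} (h : K → L) (i : K) (I : Fin N → K) :
    h ∘ (Fin.cons i I : Fin (N + 1) → K) = Fin.cons (h i) (h ∘ I) := by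
  funext x
  refine Fin.cases ?_ (fun y => ?_) x <;> simp

/-- The faces of `Fin.cons i I` are `I` itself and the faces of `I` preceded by `i`; the latter have
their position shifted by one, whence the minus sign. Inductions on the length of a string rest on
this formula. -/
theorem bd_cons {N : ℕ} (F : (Fin (N + 1) → K) → A) (i : K) (I : Fin (N + 1) → K) :
    bd F (Fin.cons i I) = F I - bd (fun J => F (Fin.cons i J)) I := by
  unfold bd
  rw [Fin.sum_univ_succ, cons_comp_succAbove_zero, sub_eq_add_neg, ← Finset.sum_neg_distrib]
  simp only [cons_comp_succAbove_succ]
  simp [pow_succ]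

/-- Strings of length zero are kept, that is, the complex is augmented. This spares the cone formula
a special case in the lowest degree. -/
theorem bd_singleton (F : (Fin 0 → K) → A) (I : Fin 1 → K) : bd F I = F Fin.elim0 := by
  simp [bd, Subsingleton.elim (I ∘ Fin.succ) Fin.elim0]

theorem bd_add {N : ℕ} (F G : (Fin N → K) → A) (I : Fin (N + 1) → K) :
    bd (F + G) I = bd F I + bd G I := by
  simp [bd, Finset.sum_add_distrib]

theorem bd_sub {N : ℕ} (F G : (Fin N → K) → A) (I : Fin (N + 1) → K) :
    bd (F - G) I = bd F I - bd G I := by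
  simp [bd, smul_sub]

theorem map_bd {N : ℕ} (f : A →+ B) (F : (Fin N → K) → A) (I : Fin (N + 1) → K) :
    f (bd F I) = bd (fun J => f (F J)) I := by
  simp [bd, map_sum, map_zsmul]

theorem bd_congr {N : ℕ} {F G : (Fin N → K) → A} {I : Fin (N + 1) → K}
    (h : ∀ k : Fin (N + 1), F (I ∘ k.succAbove) = G (I ∘ k.succAbove)) : bd F I = bd G I := by
  simp [bd, h]

theorem bd_comp {N : ℕ} (F : (Fin N → L) → A) (h : K → L) (I : Fin (N + 1) → K) :
    bd (fun J : Fin N → K => F (h ∘ J)) I = bd F (h ∘ I) := rfl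

/-- Two applications of `bd_cons` reduce the claim to the same one for a string with one entry less,
as the two terms in the tail alone cancel. -/
theorem bd_bd : ∀ {N : ℕ} (F : (Fin N → K) → A) (I : Fin (N + 2) → K), bd (bd F) I = 0
  | 0, F, I => by
    rw [bd, Fin.sum_univ_two]
    simp [bd_singleton]
  | N + 1, F, I => by
    rw [← Fin.cons_self_tail I, bd_cons]
    have h : (fun J => bd F (Fin.cons (I 0) J)) =
        F - bd (fun J => F (Fin.cons (I 0) J)) := funext fun J => bd_cons F (I 0) J
    rw [h, bd_sub, bd_bd, sub_zero, sub_self]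

/-- Functions on strings which change sign when two distinct positions are interchanged. -/
def Alternating {N : ℕ} (F : (Fin N → K) → A) : Prop :=
  ∀ I j k, j ≠ k → F (I ∘ Equiv.swap j k) = - F I

namespace Alternating

variable {N : ℕ} {F G : (Fin N → K) → A}

theorem comp_perm (hF : Alternating F) (s : Equiv.Perm (Fin N)) (I : Fin N → K) :
    F (I ∘ s) = ((Equiv.Perm.sign s : ℤˣ) : ℤ) • F I := by
  induction s using Equiv.Perm.swap_induction_on generalizing I with
  | one => simp
  | swap_mul f x y hxy ih =>
    rw [Equiv.Perm.coe_mul, ← Function.comp_assoc, ih, hF _ _ _ hxy, Equiv.Perm.sign_mul,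
      Equiv.Perm.sign_swap hxy]
    simp

theorem sub (hF : Alternating F) (hG : Alternating G) : Alternating (F - G) := fun I j k h => by
  simp only [Pi.sub_apply, hF I j k h, hG I j k h]; abel

theorem add (hF : Alternating F) (hG : Alternating G) : Alternating (F + G) := fun I j k h => by
  simp only [Pi.add_apply, hF I j k h, hG I j k h]; abel

theorem map (hF : Alternating F) (f : A →+ B) : Alternating fun I => f (F I) := fun I j k h => by
  simp only [hF I j k h, map_neg]

theorem comp_left {F : (Fin N → L) → A} (hF : Alternating F) (h : K → L) :
    Alternating fun I : Fin N → K => F (h ∘ I) := fun I j k hjk => by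
  exact hF (h ∘ I) j k hjk

/-- Interchanging two equal entries fixes the string, so the value is its own negative;
torsion-freeness turns this into zero. -/
theorem eq_zero [IsAddTorsionFree A] (hF : Alternating F) {I : Fin N → K}
    (hI : ¬ Function.Injective I) : F I = 0 := by
  obtain ⟨j, k, h, hjk⟩ := Function.not_injective_iff.1 hI
  have h1 : I ∘ Equiv.swap j k = I := by
    funext x
    simp only [Function.comp_apply, Equiv.swap_apply_def]
    split_ifs with h2 h3
    · rw [h2, h]
    · rw [h3, h]
    · rfl
  have h2 := hF I j k hjk
  rw [h1] at h2
  exact self_eq_neg.1 h2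

/-- Adjacent transpositions suffice. Such a transposition exchanges the two faces that omit one of
the two positions, whose signs are opposite, and it interchanges two entries of every other face. -/
theorem bd {F : (Fin N → K) → A} (hF : Alternating F) : Alternating (bd F) := by
  have key : ∀ (I : Fin (N + 1) → K) (j : Fin N),
      SparkOrb.bd F (I ∘ Equiv.swap j.castSucc j.succ) = - SparkOrb.bd F I := by
    intro I j
    obtain ⟨N, rfl⟩ : ∃ M, N = M + 1 := ⟨N - 1, by have := j.2; omega⟩
    have hne : j.castSucc ≠ j.succ := (Fin.castSucc_lt_succ).ne
    set s := Equiv.swap j.castSucc j.succ with hs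
    have e1 : ∀ I : Fin (N + 2) → K, (I ∘ s) ∘ j.castSucc.succAbove = I ∘ j.succ.succAbove := by
      intro I
      funext x
      simp only [Function.comp_apply]
      congr 1
      rcases lt_trichotomy x j with hx | hx | hx
      · rw [Fin.succAbove_of_castSucc_lt _ _ (Fin.castSucc_lt_castSucc_iff.2 hx),
          Fin.succAbove_of_castSucc_lt _ _ ((Fin.castSucc_lt_castSucc_iff.2 hx).trans
            Fin.castSucc_lt_succ), hs, Equiv.swap_apply_of_ne_of_ne]
        · exact (Fin.castSucc_lt_castSucc_iff.2 hx).ne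
        · exact ((Fin.castSucc_lt_castSucc_iff.2 hx).trans Fin.castSucc_lt_succ).ne
      · subst hx
        rw [Fin.succAbove_castSucc_self, Fin.succAbove_succ_self, hs, Equiv.swap_apply_right]
      · rw [Fin.succAbove_of_le_castSucc _ _ (Fin.castSucc_le_castSucc_iff.2 hx.le),
          Fin.succAbove_of_le_castSucc j.succ _ (Fin.succ_le_castSucc_iff.2 hx), hs,
          Equiv.swap_apply_of_ne_of_ne]
        · exact (Fin.castSucc_lt_succ_iff.2 hx.le).ne'
        · exact fun h => hx.ne' (Fin.succ_injective _ h)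
    have e2 : (I ∘ s) ∘ j.succ.succAbove = I ∘ j.castSucc.succAbove := by
      rw [← e1 (I ∘ s)]
      funext x
      simp [hs]
    unfold SparkOrb.bd
    rw [← Finset.sum_neg_distrib]
    refine Fintype.sum_equiv s _ _ fun k => ?_
    by_cases h1 : k = j.castSucc
    · subst h1
      rw [show s j.castSucc = j.succ from Equiv.swap_apply_left _ _, e1]
      simp [pow_succ]
    by_cases h2 : k = j.succ
    · subst h2
      rw [show s j.succ = j.castSucc from Equiv.swap_apply_right _ _, e2]
      simp [pow_succ]
    obtain ⟨a, ha⟩ := Fin.exists_succAbove_eq (Ne.symm h1)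
    obtain ⟨b, hb⟩ := Fin.exists_succAbove_eq (Ne.symm h2)
    have hab : a ≠ b := by
      rintro rfl; exact hne (ha.symm.trans hb)
    have e : (I ∘ s) ∘ k.succAbove = (I ∘ k.succAbove) ∘ Equiv.swap a b := by
      funext x
      simp only [Function.comp_apply]
      rw [(Fin.succAbove_right_injective (p := k)).map_swap, ha, hb]
    rw [show s k = k from Equiv.swap_apply_of_ne_of_ne h1 h2, e, hF _ _ _ hab, smul_neg]
  exact GoodAtlas.alternating_of_adjacent _ key

theorem exists_increasing (r : K → K → Prop) [IsStrictTotalOrder K r] {I : Fin N → K}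
    (hI : Function.Injective I) :
    ∃ s : Equiv.Perm (Fin N), ∀ i j, i < j → r ((I ∘ s) i) ((I ∘ s) j) := by
  classical
  let _ : LinearOrder K := linearOrderOfSTO r
  exact ⟨Tuple.sort I, fun i j h =>
    ((Tuple.monotone_sort I).strictMono_of_injective (hI.comp (Tuple.sort I).injective)) h⟩

/-- Both functions vanish on strings with a repetition, and elsewhere sorting changes their values
by the same sign. This extends identities that are only accessible on increasing strings, such as
those of the prism operator, to all strings. -/
theorem ext_of_increasing [IsAddTorsionFree A] (r : K → K → Prop) [IsStrictTotalOrder K r]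
    (hF : Alternating F) (hG : Alternating G)
    (h : ∀ I : Fin N → K, (∀ i j, i < j → r (I i) (I j)) → F I = G I) : F = G := by
  funext I
  by_cases hI : Function.Injective I
  · obtain ⟨s, hs⟩ := exists_increasing r hI
    have h1 := h _ hs
    rw [hF.comp_perm, hG.comp_perm] at h1
    rcases Int.units_eq_one_or (Equiv.Perm.sign s) with h2 | h2 <;> simpa [h2] using h1
  · rw [hF.eq_zero hI, hG.eq_zero hI]

end Alternating

theorem injective_of_increasing {N : ℕ} {r : K → K → Prop} [IsStrictTotalOrder K r]
    {I : Fin N → K} (hI : ∀ i j, i < j → r (I i) (I j)) : Function.Injective I := by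
  intro i j h
  rcases lt_trichotomy i j with hij | hij | hij
  · exact absurd (h ▸ hI i j hij) (irrefl_of r _)
  · exact hij
  · exact absurd (h ▸ hI j i hij) (irrefl_of r _)

/-- A permutation of the positions that sorts the string `I`, if there is one. -/
def sorter {N : ℕ} (r : K → K → Prop) (I : Fin N → K) : Equiv.Perm (Fin N) :=
  open scoped Classical in
  if h : ∃ s : Equiv.Perm (Fin N), ∀ i j, i < j → r ((I ∘ s) i) ((I ∘ s) j) then h.choose else 1

/-- Makes the sign and the string in `altExt` independent of the choice in `sorter`. -/
theorem sorter_unique {N : ℕ} {r : K → K → Prop} [IsStrictTotalOrder K r] {I : Fin N → K}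
    {s : Equiv.Perm (Fin N)} (hs : ∀ i j, i < j → r ((I ∘ s) i) ((I ∘ s) j)) :
    sorter r I = s := by
  classical
  have h : ∃ s : Equiv.Perm (Fin N), ∀ i j, i < j → r ((I ∘ s) i) ((I ∘ s) j) := ⟨s, hs⟩
  let _ : LinearOrder K := linearOrderOfSTO r
  have hI : Function.Injective I := by
    have h1 := injective_of_increasing hs
    have h2 := h1.comp s.symm.injective
    rwa [Function.comp_assoc, Equiv.self_comp_symm, Function.comp_id] at h2
  have h1 : ∀ t : Equiv.Perm (Fin N), (∀ i j, i < j → r ((I ∘ t) i) ((I ∘ t) j)) →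
      t = Tuple.sort I := by
    intro t ht
    have hm : StrictMono (I ∘ t) := fun i j hij => ht i j hij
    -- Monotone rearrangements of `I` coincide with `I ∘ Tuple.sort I`, and `I` is injective.
    have h3 := (Tuple.comp_sort_eq_comp_iff_monotone (f := I) (σ := t)).2 hm.monotone
    exact Equiv.ext fun x => hI (congrFun h3 x)
  rw [sorter, dif_pos h, h1 _ h.choose_spec, h1 s hs]

/-- The alternating function which agrees with `F` on increasing strings. -/
def altExt {N : ℕ} (r : K → K → Prop) (F : (Fin N → K) → A) (I : Fin N → K) : A :=
  open scoped Classical in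
  if Function.Injective I then
    ((Equiv.Perm.sign (sorter r I) : ℤˣ) : ℤ) • F (I ∘ sorter r I) else 0

theorem altExt_of_increasing {N : ℕ} {r : K → K → Prop} [IsStrictTotalOrder K r]
    (F : (Fin N → K) → A) {I : Fin N → K} (hI : ∀ i j, i < j → r (I i) (I j)) :
    altExt r F I = F I := by
  rw [altExt, if_pos (injective_of_increasing hI), sorter_unique (s := 1) (by simpa using hI)]
  simp

/-- If `s` sorts `I`, then `swap j k * s` sorts `I ∘ swap j k`: the increasing string is the same
and the signs are opposite. -/
theorem alternating_altExt {N : ℕ} (r : K → K → Prop) [IsStrictTotalOrder K r]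
    (F : (Fin N → K) → A) : Alternating (altExt r F) := by
  intro I j k hjk
  by_cases hI : Function.Injective I
  · have hI' : Function.Injective (I ∘ Equiv.swap j k) := hI.comp (Equiv.injective _)
    obtain ⟨s, hs⟩ := Alternating.exists_increasing r hI
    have hs' : sorter r (I ∘ Equiv.swap j k) = Equiv.swap j k * s := by
      refine sorter_unique ?_
      have : (I ∘ Equiv.swap j k) ∘ (Equiv.swap j k * s : Equiv.Perm (Fin N)) = I ∘ s := by
        funext x; simp
      rwa [this]
    rw [altExt, altExt, if_pos hI, if_pos hI', hs', sorter_unique hs, Equiv.Perm.sign_mul,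
      Equiv.Perm.sign_swap hjk]
    have : (I ∘ Equiv.swap j k) ∘ (Equiv.swap j k * s : Equiv.Perm (Fin N)) = I ∘ s := by
      funext x; simp
    rw [this]; simp
  · have hI' : ¬ Function.Injective (I ∘ Equiv.swap j k) := fun h => hI <| by
      have := h.comp (Equiv.swap j k).injective
      rwa [Function.comp_assoc, ← Equiv.Perm.coe_mul, Equiv.swap_mul_self] at this
    rw [altExt, altExt, if_neg hI, if_neg hI', neg_zero]

/-- The relations between strings under alternation, up to torsion. -/
def altRel (K : Type*) (N : ℕ) : AddSubgroup ((Fin N → K) →₀ ℤ) where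
  carrier := {c | ∃ n : ℕ, n ≠ 0 ∧ n • c ∈ AddSubgroup.closure
    {c | ∃ (J : Fin N → K) (j k : Fin N), j ≠ k ∧
      c = Finsupp.single (J ∘ Equiv.swap j k) 1 + Finsupp.single J 1}}
  zero_mem' := ⟨1, one_ne_zero, by simp⟩
  add_mem' := by
    rintro a b ⟨m, hm, ha⟩ ⟨n, hn, hb⟩
    refine ⟨m * n, mul_ne_zero hm hn, ?_⟩
    rw [smul_add, mul_comm, mul_smul, mul_comm, mul_smul]
    exact add_mem (nsmul_mem ha n) (nsmul_mem hb m)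
  neg_mem' := by
    rintro a ⟨m, hm, ha⟩
    exact ⟨m, hm, by rw [smul_neg]; exact neg_mem ha⟩

/-- Alternating chains of strings of length `N` in `K`. -/
def Chain (K : Type*) (N : ℕ) : Type _ := ((Fin N → K) →₀ ℤ) ⧸ altRel K N

/-! ### Alternating integral chains: boundary, cone and support -/

namespace Chain

variable {N : ℕ}

instance : AddCommGroup (Chain K N) := inferInstanceAs (AddCommGroup (_ ⧸ altRel K N))

/-- The subgroup `altRel` contains every element with a nonzero multiple in the span of the
relations. With the bare relations a string with a repeated entry would only be killed by two, and
`Alternating.eq_zero` would not apply to functions with values in chains. -/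
instance : IsAddTorsionFree (Chain K N) where
  nsmul_right_injective n hn := by
    have key : ∀ x : Chain K N, n • x = 0 → x = 0 := by
      intro x hx
      obtain ⟨c, rfl⟩ := QuotientAddGroup.mk_surjective x
      have h1 : n • c ∈ altRel K N := (QuotientAddGroup.eq_zero_iff _).1 hx
      obtain ⟨m, hm, h2⟩ := h1
      refine (QuotientAddGroup.eq_zero_iff _).2 ⟨m * n, mul_ne_zero hm hn, ?_⟩
      rwa [mul_smul]
    intro x y hxy
    refine sub_eq_zero.1 (key _ ?_)
    simp only at hxy
    rw [smul_sub, hxy, sub_self]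

/-- The class of a string. -/
def mk (J : Fin N → K) : Chain K N := QuotientAddGroup.mk (Finsupp.single J 1)

theorem alternating_mk : Alternating (mk : (Fin N → K) → Chain K N) := by
  intro J j k h
  refine eq_neg_of_add_eq_zero_left ?_
  refine (QuotientAddGroup.eq_zero_iff _).2 ⟨1, one_ne_zero, ?_⟩
  rw [one_smul]
  exact AddSubgroup.subset_closure ⟨J, j, k, h, rfl⟩

theorem hom_ext {f g : Chain K N →+ A} (h : ∀ J, f (mk J) = g (mk J)) : f = g := by
  refine QuotientAddGroup.addMonoidHom_ext _ (Finsupp.addHom_ext' fun J => ?_)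
  refine AddMonoidHom.ext_int ?_
  exact h J

/-- The homomorphism on chains given by an alternating function. -/
def lift [IsAddTorsionFree A] (F : (Fin N → K) → A) (hF : Alternating F) : Chain K N →+ A :=
  QuotientAddGroup.lift (altRel K N)
    (Finsupp.liftAddHom fun J => (zmultiplesHom A (F J))) <| by
      rintro c ⟨n, hn, hc⟩
      have h : ∀ d ∈ AddSubgroup.closure {c | ∃ (J : Fin N → K) (j k : Fin N), j ≠ k ∧
          c = Finsupp.single (J ∘ Equiv.swap j k) 1 + Finsupp.single J 1},
          (Finsupp.liftAddHom fun J => (zmultiplesHom A (F J))) d = 0 := by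
        intro d hd
        induction hd using AddSubgroup.closure_induction with
        | mem x hx =>
          obtain ⟨J, j, k, hjk, rfl⟩ := hx
          simp [hF J j k hjk]
        | zero => exact map_zero _
        | add x y _ _ hx hy => rw [map_add, hx, hy, add_zero]
        | neg x _ hx => rw [map_neg, hx, neg_zero]
      -- Only a nonzero multiple of `c` is a combination of the relations; that `A` is torsion free
      -- makes up for it.
      have h1 := h _ hc
      rw [map_nsmul] at h1
      exact (nsmul_eq_zero_iff_right hn).1 h1

@[simp]
theorem lift_mk [IsAddTorsionFree A] (F : (Fin N → K) → A) (hF : Alternating F) (J : Fin N → K) :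
    lift F hF (mk J) = F J := by
  refine (QuotientAddGroup.lift_mk' _ _ _).trans ?_
  simp

/-- The boundary of a chain. -/
def boundary : Chain K (N + 1) →+ Chain K N := lift (bd mk) alternating_mk.bd

@[simp]
theorem boundary_mk (J : Fin (N + 1) → K) : boundary (mk J) = bd mk J := lift_mk _ _ _

theorem cons_comp_swap (v : K) (J : Fin N → K) (j k : Fin N) :
    (Fin.cons v (J ∘ Equiv.swap j k) : Fin (N + 1) → K) =
      (Fin.cons v J : Fin (N + 1) → K) ∘ Equiv.swap j.succ k.succ := by
  funext x
  refine Fin.cases ?_ (fun y => ?_) x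
  · rw [Function.comp_apply, Equiv.swap_apply_of_ne_of_ne (Fin.succ_ne_zero _).symm
      (Fin.succ_ne_zero _).symm]
    simp
  · rw [Function.comp_apply, ← (Fin.succ_injective N).map_swap]
    simp

/-- The cone over a chain with the given vertex. -/
def cone (v : K) : Chain K N →+ Chain K (N + 1) :=
  lift (fun J => mk (Fin.cons v J)) fun J j k h => by
    beta_reduce
    rw [cons_comp_swap, alternating_mk _ _ _ fun h' => h (Fin.succ_injective _ h')]

@[simp]
theorem cone_mk (v : K) (J : Fin N → K) : cone v (mk J) = mk (Fin.cons v J) := lift_mk _ _ _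

/-- On a string this is `bd_cons`. Consequently a cycle is the boundary of the cone over it, for any
choice of the apex. -/
theorem boundary_cone (v : K) (c : Chain K (N + 1)) :
    boundary (cone v c) = c - cone v (boundary c) := by
  have h : boundary.comp (cone v) = AddMonoidHom.id (Chain K (N + 1)) - (cone v).comp boundary := by
    refine hom_ext fun J => ?_
    simp only [AddMonoidHom.comp_apply, AddMonoidHom.sub_apply, AddMonoidHom.id_apply, cone_mk,
      boundary_mk, bd_cons, map_bd]
  exact DFunLike.congr_fun h c

/-- The image of a chain under a map. -/
def map (h : K → L) : Chain K N →+ Chain L N :=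
  lift (fun J => mk (h ∘ J)) (alternating_mk.comp_left h)

@[simp]
theorem map_mk (h : K → L) (J : Fin N → K) : map h (mk J) = mk (h ∘ J) := lift_mk _ _ _

theorem boundary_map (h : K → L) (c : Chain K (N + 1)) :
    boundary (map h c) = map h (boundary c) := by
  have : boundary.comp (map h) = (map h).comp (boundary (K := K) (N := N)) :=
    hom_ext fun J => by
      simp only [AddMonoidHom.comp_apply, map_mk, boundary_mk, map_bd]; rfl
  exact DFunLike.congr_fun this c

/-- Chains with vertices in `T`. -/
def supported (T : Set K) (N : ℕ) : AddSubgroup (Chain K N) :=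
  AddSubgroup.closure (mk '' {J | ∀ k, J k ∈ T})

theorem mk_mem_supported {T : Set K} {J : Fin N → K} (h : ∀ k, J k ∈ T) : mk J ∈ supported T N :=
  AddSubgroup.subset_closure ⟨J, h, rfl⟩

theorem supported_mono {T T' : Set K} (h : T ⊆ T') : supported T N ≤ supported T' N :=
  AddSubgroup.closure_mono (image_mono fun _ hJ k => h (hJ k))

theorem supported_le {T : Set K} {S : AddSubgroup (Chain K N)}
    (h : ∀ J : Fin N → K, (∀ k, J k ∈ T) → mk J ∈ S) : supported T N ≤ S :=
  (AddSubgroup.closure_le _).2 (by rintro _ ⟨J, hJ, rfl⟩; exact h J hJ)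

/-- Homomorphisms which agree on strings in `T` agree on chains with vertices in `T`. -/
theorem eq_of_supported {T : Set K} {f g : Chain K N →+ A}
    (h : ∀ J : Fin N → K, (∀ k, J k ∈ T) → f (mk J) = g (mk J)) {c : Chain K N}
    (hc : c ∈ supported T N) : f c = g c :=
  supported_le (S := f.eqLocus g) h hc

theorem bd_mem {S : AddSubgroup A} {F : (Fin N → K) → A} {I : Fin (N + 1) → K}
    (h : ∀ k : Fin (N + 1), F (I ∘ k.succAbove) ∈ S) : bd F I ∈ S :=
  sum_mem fun k _ => zsmul_mem (h k) _

theorem cone_mem_supported {T : Set K} {v : K} (hv : v ∈ T) {c : Chain K N}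
    (hc : c ∈ supported T N) : cone v c ∈ supported T (N + 1) := by
  refine supported_le (S := (supported T (N + 1)).comap (cone v)) (fun J hJ => ?_) hc
  rw [AddSubgroup.mem_comap, cone_mk]
  refine mk_mem_supported fun k => ?_
  refine Fin.cases ?_ (fun y => ?_) k
  · simpa
  · simpa using hJ y

theorem map_mem_supported {h : K → L} {T : Set K} {T' : Set L} (hT : MapsTo h T T') {c : Chain K N}
    (hc : c ∈ supported T N) : map h c ∈ supported T' N := by
  refine supported_le (S := (supported T' N).comap (map h)) (fun J hJ => ?_) hc
  rw [AddSubgroup.mem_comap, map_mk]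
  exact mk_mem_supported fun k => hT (hJ k)

end Chain

end Strings

end

/-! ### Local lifts between charts and transport of invariant forms -/

noncomputable section

variable {X : Type u} [TopologicalSpace X] {n m q : ℕ}

theorem SmoothMap.continuous {S : Set (EE n)} {T : Set (EE m)} {f : S → T} (hf : SmoothMap f) :
    Continuous f := by
  have h := ContDiffOn.continuousOn hf
  rw [continuousOn_iff_continuous_domRestrict] at h
  refine (Continuous.subtype_mk (p := (· ∈ T)) h fun x => mapsTo_extendMap _ x.2).congr ?_
  intro x; exact Subtype.ext (extendMap_apply _ x)

theorem pullback_apply {S : Set (EE n)} {T : Set (EE m)} (f : S → T) (θ : FormFun m q) (x : S) :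
    pullback f θ x = (θ (f x)).compContinuousLinearMap (fderiv ℝ (extendMap f) x) := by
  simp only [pullback, indicator_of_mem x.2, extendMap_apply]

theorem pullback_of_notMem {S : Set (EE n)} {T : Set (EE m)} (f : S → T) (θ : FormFun m q)
    {x : EE n} (hx : x ∉ S) : pullback f θ x = 0 := by
  simp [pullback, hx]

theorem pullback_apply_congr {S S' : Set (EE n)} {T T' : Set (EE m)} {f : S → T} {g : S' → T'}
    {θ η : FormFun m q} {x : EE n} (hx : x ∈ S) (hx' : x ∈ S')
    (h : extendMap f =ᶠ[𝓝 x] extendMap g) (hθ : θ (extendMap f x) = η (extendMap f x)) :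
    pullback f θ x = pullback g η x := by
  simp only [pullback, indicator_of_mem hx, indicator_of_mem hx']
  rw [← h.fderiv_eq, ← h.eq_of_nhds, hθ]

theorem pullback_id {S : Set (EE n)} (hS : IsOpen S) {θ : FormFun n q}
    (hθ : ∀ x, x ∉ S → θ x = 0) : pullback (id : S → S) θ = θ := by
  funext x
  by_cases hx : x ∈ S
  · refine (pullback_apply (id : S → S) θ ⟨x, hx⟩).trans ?_
    rw [fderiv_extendMap_id hS]
    rfl
  · rw [pullback_of_notMem _ _ hx, hθ x hx]

theorem smoothMap_inclusion {S T : Set (EE n)} (h : S ⊆ T) : SmoothMap (inclusion h) :=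
  contDiffOn_id.congr fun x hx => extendMap_apply (inclusion h) ⟨x, hx⟩

/-- Two smooth maps to a chart over the same map to the base pull back an invariant form to the same
form. -/
theorem pullback_eq_of_proj_eq {D : Chart X n} {S : Set (EE m)} (hS : IsOpen S) {f g : S → D.dom}
    (hf : SmoothMap f) (hg : SmoothMap g) (h : ∀ x, (D.proj (f x) : X) = D.proj (g x))
    {θ : FormFun n q} (hθ : θ ∈ D.invForms q) : pullback f θ = pullback g θ := by
  have := D.finite_group
  have : LocallyCompactSpace S := hS.locallyCompactSpace
  let A : D.group → Set S := fun h => {x | g x = (h : Equiv.Perm D.dom) (f x)}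
  have hA : ∀ h, IsClosed (A h) := fun h =>
    isClosed_eq hg.continuous ((D.smooth_group h h.2).continuous.comp hf.continuous)
  have hU : ⋃ h, A h = univ := by
    refine eq_univ_of_forall fun x => ?_
    obtain ⟨k, hk, hkx⟩ := (D.proj_eq_iff _ _).1 (Subtype.ext (h x))
    exact mem_iUnion.2 ⟨⟨k, hk⟩, hkx.symm⟩
  -- The closed sets on which `g` is a given group element times `f` are finite in number and cover
  -- `S`, so by Baire their interiors are jointly dense. On each interior, invariance of the form
  -- gives the equality, and continuity does the rest.
  have hd := dense_iUnion_interior_of_closed hA hU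
  have hl := (contDiffOn_pullback hf hS hθ.1).continuousOn
  have hk := (contDiffOn_pullback hg hS hθ.1).continuousOn
  rw [continuousOn_iff_continuous_domRestrict] at hl hk
  have key : S.domRestrict (pullback f θ) = S.domRestrict (pullback g θ) := by
    refine Continuous.ext_on hd hl hk fun x hx => ?_
    obtain ⟨k, hxk⟩ := mem_iUnion.1 hx
    have h1 : pullback f θ = pullback (((k : Equiv.Perm D.dom) : D.dom → D.dom) ∘ f) θ := by
      rw [pullback_comp (D.smooth_group k k.2) hf hS D.isOpen_dom, hθ.2.2 k k.2]
    simp only [domRestrict_apply]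
    rw [h1]
    refine pullback_apply_congr x.2 x.2 ?_ rfl
    have h3 : Subtype.val '' (interior (A k)) ∈ 𝓝 (x : EE m) :=
      (hS.isOpenMap_subtype_val _ isOpen_interior).mem_nhds ⟨x, hxk, rfl⟩
    filter_upwards [h3]
    rintro _ ⟨y, hy, rfl⟩
    rw [extendMap_apply, extendMap_apply]
    exact congrArg Subtype.val (interior_subset (s := A k) hy).symm
  funext x
  by_cases hx : x ∈ S
  · exact congrFun key ⟨x, hx⟩
  · simp [pullback, hx]

/-- A smooth map over the base from a neighbourhood of `z` in one chart to another chart. -/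
structure LocalLift (C D : Chart X n) (z : EE n) where
  S : Set (EE n)
  isOpen : IsOpen S
  mem : z ∈ S
  subset : S ⊆ C.dom
  toFun : S → D.dom
  smooth : SmoothMap toFun
  proj_eq : ∀ x : S, (D.proj (toFun x) : X) = C.proj ⟨x, subset x.2⟩

namespace LocalLift

variable {C D E : Chart X n} {z : EE n}

/-- A local lift is a local lift at every point of its domain. -/
def move (L : LocalLift C D z) {y : EE n} (hy : y ∈ L.S) : LocalLift C D y :=
  { L with mem := hy }

/-- An embedding as a local lift. -/
def ofEmb (e : C.Emb D) (hz : z ∈ C.dom) : LocalLift C D z :=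
  ⟨C.dom, C.isOpen_dom, hz, Subset.rfl, e.toFun, e.smooth, e.lift⟩

/-- Composition of a local lift with an embedding. -/
def compEmb (L : LocalLift C D z) (e : D.Emb E) : LocalLift C E z :=
  { L with
    toFun := e.toFun ∘ L.toFun
    smooth := e.smooth.comp L.smooth
    proj_eq := fun x => (e.lift _).trans (L.proj_eq x) }

/-- The part of the domain of an embedding over the domain of a local lift. -/
def embPreimage (e : C.Emb D) {y : C.dom} (L : LocalLift D E (e.toFun y)) : Set (EE n) :=
  C.dom ∩ extendMap e.toFun ⁻¹' L.S

/-- The restriction of an embedding to a map into the domain of a local lift. -/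
def embRestrict (e : C.Emb D) {y : C.dom} (L : LocalLift D E (e.toFun y)) :
    embPreimage e L → L.S := fun x => ⟨extendMap e.toFun x, x.2.2⟩

theorem smooth_embRestrict (e : C.Emb D) {y : C.dom} (L : LocalLift D E (e.toFun y)) :
    SmoothMap (embRestrict e L) :=
  (ContDiffOn.mono e.smooth inter_subset_left).congr fun x hx =>
    extendMap_apply (embRestrict e L) ⟨x, hx⟩

theorem isOpen_embPreimage (e : C.Emb D) {y : C.dom} (L : LocalLift D E (e.toFun y)) :
    IsOpen (embPreimage e L) :=
  (ContDiffOn.continuousOn e.smooth).isOpen_inter_preimage C.isOpen_dom L.isOpen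

/-- Composition of an embedding with a local lift. -/
def embComp (e : C.Emb D) {y : C.dom} (L : LocalLift D E (e.toFun y)) : LocalLift C E y where
  S := embPreimage e L
  isOpen := isOpen_embPreimage e L
  mem := ⟨y.2, by rw [mem_preimage, extendMap_apply]; exact L.mem⟩
  subset := inter_subset_left
  toFun := L.toFun ∘ embRestrict e L
  smooth := L.smooth.comp (smooth_embRestrict e L)
  proj_eq x := by
    have h1 := L.proj_eq (embRestrict e L x)
    have h2 := e.lift ⟨x, x.2.1⟩
    refine h1.trans (Eq.trans ?_ h2)
    exact congrArg (fun w => (D.proj w : X)) (Subtype.ext (extendMap_apply e.toFun ⟨x, x.2.1⟩))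

/-- An embedding of charts has local inverses. -/
theorem nonempty_inverse (e : C.Emb D) (y : C.dom) : Nonempty (LocalLift D C (e.toFun y)) := by
  -- An immersion between charts of the same dimension has invertible derivative.
  have hd : ∀ x : C.dom, ∃ A : EE n ≃L[ℝ] EE n,
      (A : EE n →L[ℝ] EE n) = fderiv ℝ (extendMap e.toFun) x := fun x =>
    ⟨(LinearEquiv.ofInjectiveEndo (fderiv ℝ (extendMap e.toFun) x : EE n →ₗ[ℝ] EE n)
      (e.immersive x)).toContinuousLinearEquiv, by ext; rfl⟩
  have hf : ∀ x : C.dom, ∃ A : EE n ≃L[ℝ] EE n,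
      HasFDerivAt (extendMap e.toFun) (A : EE n →L[ℝ] EE n) x := fun x => by
    obtain ⟨A, hA⟩ := hd x
    exact ⟨A, hA ▸ (e.smooth.differentiableAt C.isOpen_dom x).hasFDerivAt⟩
  obtain ⟨A, hA⟩ := hf y
  have hc := e.smooth.contDiffAt C.isOpen_dom y
  let φ := hc.toOpenPartialHomeomorph (extendMap e.toFun) hA (by simp)
  have hφ : ∀ x, φ x = extendMap e.toFun x := fun x => rfl
  have hy : (y : EE n) ∈ φ.source := hc.mem_toOpenPartialHomeomorph_source hA (by simp)
  have hval : ∀ z (h : z ∈ φ.target ∩ φ.symm ⁻¹' C.dom),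
      (e.toFun ⟨φ.symm z, h.2⟩ : EE n) = z := fun z h => by
    rw [← extendMap_apply, ← hφ]
    exact φ.right_inv h.1
  refine ⟨⟨φ.target ∩ φ.symm ⁻¹' C.dom, φ.isOpen_inter_preimage_symm C.isOpen_dom, ?_,
    fun z h => ?_, fun z => ⟨φ.symm z, z.2.2⟩, ?_, fun z => ?_⟩⟩
  · rw [← extendMap_apply, ← hφ]
    refine ⟨φ.map_source hy, ?_⟩
    rw [mem_preimage, φ.left_inv hy]
    exact y.2
  · rw [← hval z h]; exact (e.toFun _).2
  -- The derivative is invertible at every point of `C.dom`, so the inverse is smooth on the whole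
  -- open set and not only at the image of `y`.
  · have h1 : ContDiffOn ℝ ∞ φ.symm (φ.target ∩ φ.symm ⁻¹' C.dom) := by
      intro z hz
      obtain ⟨B, hB⟩ := hf ⟨φ.symm z, hz.2⟩
      exact (φ.contDiffAt_symm hz.1 hB
        (e.smooth.contDiffAt C.isOpen_dom ⟨φ.symm z, hz.2⟩)).contDiffWithinAt
    exact h1.congr fun z hz => extendMap_apply
      (fun z : ↥(φ.target ∩ φ.symm ⁻¹' C.dom) => (⟨φ.symm z, z.2.2⟩ : C.dom)) ⟨z, hz⟩
  · rw [← e.lift]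
    exact congrArg (fun w => (D.proj w : X)) (Subtype.ext (hval z z.2))

/-- A point `y` of `C` over the base point of `z` is mapped by `e` into the orbit of `z`. After
composition with a group element the embedding passes through `z` and can be inverted there. -/
theorem nonempty_of_emb (e : C.Emb D) (z : D.dom) (hz : (D.proj z : X) ∈ C.base) :
    Nonempty (LocalLift D C z) := by
  obtain ⟨y, hy⟩ := C.isQuotientMap_proj.surjective ⟨_, hz⟩
  have h1 : D.proj (e.toFun y) = D.proj z := Subtype.ext ((e.lift y).trans (congrArg Subtype.val hy))
  obtain ⟨g, hg, hgy⟩ := (D.proj_eq_iff _ _).1 h1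
  have h2 := nonempty_inverse (e.comp (Chart.Emb.ofGroup D g hg)) y
  rwa [show (e.comp (Chart.Emb.ofGroup D g hg)).toFun y = z from hgy] at h2

/-- Any two local lifts pull back an invariant form to forms which agree on the common domain. -/
theorem pullback_eq {y : EE n} (L : LocalLift C D y) (M : LocalLift C D z) {θ : FormFun n q}
    (hθ : θ ∈ D.invForms q) {x : EE n} (hx : x ∈ L.S) (hx' : x ∈ M.S) :
    pullback L.toFun θ x = pullback M.toFun θ x := by
  have hS := L.isOpen.inter M.isOpen
  have h := pullback_eq_of_proj_eq hS
    (L.smooth.comp (smoothMap_inclusion (inter_subset_left (s := L.S) (t := M.S))))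
    (M.smooth.comp (smoothMap_inclusion (inter_subset_right (s := L.S) (t := M.S))))
    (fun x => (L.proj_eq (inclusion inter_subset_left x)).trans
      (M.proj_eq (inclusion inter_subset_right x)).symm) hθ
  -- Shrinking the domain of a lift does not change its germ at `x`, hence not the pullback there.
  have key : ∀ {w : EE n} (N : LocalLift C D w) (hN : L.S ∩ M.S ⊆ N.S), x ∈ N.S →
      pullback (N.toFun ∘ inclusion hN) θ x = pullback N.toFun θ x := by
    intro w N hN hxN
    refine pullback_apply_congr ⟨hx, hx'⟩ hxN ?_ rfl
    filter_upwards [hS.mem_nhds ⟨hx, hx'⟩] with t ht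
    exact (extendMap_apply _ ⟨t, ht⟩).trans (extendMap_apply _ ⟨t, hN ht⟩).symm
  rw [← key L inter_subset_left hx, ← key M inter_subset_right hx', h]

end LocalLift

/-- The form on the part of the chart `C` over the base of `D` that is given by a form on `D`. -/
def transport (C D : Chart X n) (q : ℕ) : FormFun n q →+ FormFun n q where
  toFun θ z := open scoped Classical in
    if h : Nonempty (LocalLift C D z) then pullback h.some.toFun θ z else 0
  map_zero' := by
    funext z
    split_ifs with h
    · exact congrFun (map_zero (pullbackHom h.some.toFun q)) z
    · rfl
  map_add' a b := by
    funext z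
    by_cases h : Nonempty (LocalLift C D z)
    · simp only [dif_pos h, Pi.add_apply, pullback_add]
    · simp [dif_neg h]

section Transport

variable {C D E : Chart X n} {z : EE n} {θ : FormFun n q}

/-- The lifts chosen in `transport` vary from point to point without any continuity;
`LocalLift.pullback_eq` replaces them all by the one lift `L`, which makes smoothness and naturality
accessible. -/
theorem transport_eqOn (L : LocalLift C D z) (hθ : θ ∈ D.invForms q) :
    EqOn (transport C D q θ) (pullback L.toFun θ) L.S := by
  intro y hy
  have h : Nonempty (LocalLift C D y) := ⟨L.move hy⟩
  refine (dif_pos h).trans ?_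
  exact h.some.pullback_eq L hθ h.some.mem hy

theorem contDiffAt_transport (L : LocalLift C D z) (hθ : θ ∈ D.invForms q) :
    ContDiffAt ℝ ∞ (transport C D q θ) z :=
  ((contDiffOn_pullback L.smooth L.isOpen hθ.1).congr (transport_eqOn L hθ)).contDiffAt
    (L.isOpen.mem_nhds L.mem)

theorem transport_of_emb (e : C.Emb D) (hθ : θ ∈ D.invForms q) (hz : z ∈ C.dom) :
    transport C D q θ z = pullback e.toFun θ z :=
  transport_eqOn (LocalLift.ofEmb e hz) hθ hz

theorem transport_self (hθ : θ ∈ C.invForms q) (hz : z ∈ C.dom) : transport C C q θ z = θ z := by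
  rw [transport_of_emb (Chart.Emb.id C) hθ hz]
  exact congrFun (pullback_id C.isOpen_dom hθ.2.1) z

/-- A lift to `D` followed by `e` is a lift to `E`. -/
theorem transport_pullback (L : LocalLift C D z) (e : D.Emb E) (hθ : θ ∈ E.invForms q) :
    transport C D q (pullback e.toFun θ) z = transport C E q θ z := by
  rw [transport_eqOn L (pullback_mem_invForms e hθ) L.mem, transport_eqOn (L.compEmb e) hθ L.mem,
    ← pullback_comp e.smooth L.smooth L.isOpen D.isOpen_dom]
  rfl

/-- A lift at `e y` preceded by `e` is a lift at `y`. This naturality makes contracted cochains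
invariant and compatible with restriction. -/
theorem pullback_transport (e : C.Emb D) {y : C.dom} (L : LocalLift D E (e.toFun y))
    (hθ : θ ∈ E.invForms q) :
    (transport D E q θ (e.toFun y)).compContinuousLinearMap (fderiv ℝ (extendMap e.toFun) y) =
      transport C E q θ y := by
  have h1 := transport_eqOn (LocalLift.embComp e L) hθ (LocalLift.embComp e L).mem
  refine Eq.trans ?_ h1.symm
  refine Eq.trans ?_ (congrFun (pullback_comp L.smooth (LocalLift.smooth_embRestrict e L)
    (LocalLift.isOpen_embPreimage e L) L.isOpen θ).symm (y : EE n))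
  rw [transport_eqOn L hθ L.mem, ← pullback_apply]
  refine pullback_apply_congr y.2 (LocalLift.embComp e L).mem ?_ rfl
  filter_upwards [(LocalLift.isOpen_embPreimage e L).mem_nhds (LocalLift.embComp e L).mem] with t ht
  exact (extendMap_apply (LocalLift.embRestrict e L) ⟨t, ht⟩).symm

end Transport

/-- Pass through the chart of `J ⊔ K`, whose base is the intersection: invert its embedding into the
chart of `J` near `z`, then embed it into the chart of `K`. -/
theorem GoodAtlas.nonempty_localLift (U : GoodAtlas.{u, v} X n) (J K : U.Idx) (z : (U.ch J).dom)
    (hz : ((U.ch J).proj z : X) ∈ (U.ch K).base) :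
    Nonempty (LocalLift (U.ch J) (U.ch K) z) := by
  have hb : (U.ch (J ⊔ K)).base = (U.ch J).base ∩ (U.ch K).base := U.base_sup J K
  have h1 : (U.ch (J ⊔ K)).base ⊆ (U.ch J).base := hb.subset.trans inter_subset_left
  have h2 : (U.ch (J ⊔ K)).base ⊆ (U.ch K).base := hb.subset.trans inter_subset_right
  obtain ⟨L⟩ := LocalLift.nonempty_of_emb (U.emb h1) z (hb.superset ⟨((U.ch J).proj z).2, hz⟩)
  exact ⟨L.compEmb (U.emb h2)⟩

end

/-! ### Partitions of unity that are smooth in all charts -/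

noncomputable section

variable {X : Type u} [TopologicalSpace X] {n m q : ℕ}

namespace Chart

variable (C D : Chart X n)

theorem continuous_proj : Continuous fun x => (C.proj x : X) :=
  continuous_subtype_val.comp C.isQuotientMap_proj.continuous

/-- The points of a chart over an open subset of the base form a neighbourhood. -/
theorem preimage_mem_nhds {A : Set X} (hA : IsOpen A) (z : C.dom) (hz : (C.proj z : X) ∈ A) :
    ∀ᶠ t in 𝓝 (z : EE n), ∃ h : t ∈ C.dom, (C.proj ⟨t, h⟩ : X) ∈ A := by
  have h1 : IsOpen (Subtype.val '' {x : C.dom | (C.proj x : X) ∈ A}) :=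
    C.isOpen_dom.isOpenMap_subtype_val _ (hA.preimage C.continuous_proj)
  filter_upwards [h1.mem_nhds ⟨z, hz, rfl⟩]
  rintro _ ⟨t, ht, rfl⟩
  exact ⟨t.2, ht⟩

/-- A function on `X` as a function on a chart, extended by zero. -/
def pull (f : X → ℝ) : EE n → ℝ := Function.extend Subtype.val (fun x => f (C.proj x)) 0

theorem pull_apply (f : X → ℝ) (x : C.dom) : C.pull f x = f (C.proj x) :=
  Subtype.val_injective.extend_apply _ _ _

theorem pull_of_mem (f : X → ℝ) {t : EE n} (h : t ∈ C.dom) : C.pull f t = f (C.proj ⟨t, h⟩) :=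
  C.pull_apply f ⟨t, h⟩

variable {C D}

/-- A nonnegative smooth function on the chart `D` whose support is the preimage of `O` descends to
the base after summation over the group. Its extension by zero is smooth in another chart: over
`D.base` it is composed with a local lift, and at other points it vanishes nearby because the
closure of `O` lies in `D.base`. -/
theorem exists_smooth_support_eq {O : Set X} (hO : IsOpen O) (hOD : closure O ⊆ D.base) :
    ∃ f : X → ℝ, (∀ x, 0 ≤ f x) ∧ Function.support f = O ∧
      ∀ (C : Chart X n) (z : C.dom), ((C.proj z : X) ∈ D.base → Nonempty (LocalLift C D z)) →
        ContDiffAt ℝ ∞ (C.pull f) z := by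
  have := D.finite_group
  have := Fintype.ofFinite D.group
  have hW : IsOpen (Subtype.val '' {x : D.dom | (D.proj x : X) ∈ O}) :=
    D.isOpen_dom.isOpenMap_subtype_val _ (hO.preimage D.continuous_proj)
  obtain ⟨F, hFs, hFc, hFr⟩ := hW.exists_contDiff_support_eq (n := ⊤)
  have hF0 : ∀ x, 0 ≤ F x := fun x => (hFr ⟨x, rfl⟩).1
  have hFne : ∀ x : D.dom, F x ≠ 0 ↔ (D.proj x : X) ∈ O := fun x => by
    rw [← Function.mem_support, hFs]
    exact ⟨by rintro ⟨y, hy, hyx⟩; rwa [← Subtype.ext hyx], fun h => ⟨x, h, rfl⟩⟩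
  have hproj : ∀ (g : D.group) (x : D.dom), D.proj ((g : Equiv.Perm D.dom) x) = D.proj x :=
    fun g x => ((D.proj_eq_iff _ _).2 ⟨g, g.2, rfl⟩).symm
  let G : D.dom → ℝ := fun x => ∑ g : D.group, F ((g : Equiv.Perm D.dom) x)
  have hG : ∀ x y, D.proj x = D.proj y → G x = G y := by
    intro x y hxy
    obtain ⟨k, hk, rfl⟩ := (D.proj_eq_iff _ _).1 hxy
    refine Fintype.sum_equiv (Equiv.mulRight (⟨k, hk⟩ : D.group)⁻¹) _ _ fun g => ?_
    simp
  have hGne : ∀ x, G x ≠ 0 ↔ (D.proj x : X) ∈ O := fun x => by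
    constructor
    · intro h
      obtain ⟨g, -, hg⟩ := Finset.exists_ne_zero_of_sum_ne_zero h
      rw [← hproj g x]
      exact (hFne _).1 hg
    · intro h
      -- No cancellation occurs: all summands are nonnegative and the one of the identity is
      -- positive.
      refine ne_of_gt (Finset.sum_pos' (fun g _ => hF0 _) ⟨1, Finset.mem_univ _, ?_⟩)
      exact lt_of_le_of_ne (hF0 _) (Ne.symm ((hFne x).2 h))
  have hsurj := D.isQuotientMap_proj.surjective
  let f : X → ℝ := fun x => open scoped Classical in
    if h : x ∈ D.base then G (hsurj ⟨x, h⟩).choose else 0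
  have hf : ∀ y, f (D.proj y) = G y := fun y => by
    refine (dif_pos (D.proj y).2).trans (hG _ _ ?_)
    exact (hsurj ⟨_, (D.proj y).2⟩).choose_spec
  have hf' : ∀ x, x ∉ D.base → f x = 0 := fun x hx => dif_neg hx
  refine ⟨f, fun x => ?_, ?_, fun C z hz => ?_⟩
  · by_cases h : x ∈ D.base
    · obtain ⟨y, hy⟩ := hsurj ⟨x, h⟩
      have h1 := hf y
      rw [hy] at h1
      exact h1.symm ▸ Finset.sum_nonneg fun g _ => hF0 _
    · rw [hf' x h]
  · ext x
    rw [Function.mem_support]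
    by_cases h : x ∈ D.base
    · obtain ⟨y, hy⟩ := hsurj ⟨x, h⟩
      have h1 := hf y
      have h2 := hGne y
      rw [← h1, hy] at h2
      exact h2
    · simp only [hf' x h, ne_eq, not_true, false_iff]
      exact fun h1 => h (hOD (subset_closure h1))
  · by_cases h : (C.proj z : X) ∈ D.base
    · obtain ⟨L⟩ := hz h
      have h1 : ContDiffOn ℝ ∞ (fun t => ∑ g : D.group,
          F (extendMap (((g : Equiv.Perm D.dom) : D.dom → D.dom) ∘ L.toFun) t)) L.S :=
        ContDiffOn.sum fun g _ => (hFc).comp_contDiffOn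
          ((D.smooth_group g g.2).comp L.smooth)
      refine (h1.congr fun t ht => ?_).contDiffAt (L.isOpen.mem_nhds L.mem)
      rw [C.pull_of_mem _ (L.subset ht), ← L.proj_eq ⟨t, ht⟩, hf]
      refine Finset.sum_congr rfl fun g _ => ?_
      exact congrArg F (extendMap_apply (((g : Equiv.Perm D.dom) : D.dom → D.dom) ∘ L.toFun)
        ⟨t, ht⟩).symm
    · refine (contDiffAt_const (c := (0 : ℝ))).congr_of_eventuallyEq ?_
      have hO' := C.preimage_mem_nhds (isClosed_closure (s := O)).isOpen_compl z fun h1 => h (hOD h1)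
      filter_upwards [hO'] with t ht
      obtain ⟨h1, h2⟩ := ht
      rw [C.pull_of_mem _ h1]
      by_contra h3
      by_cases h4 : ((C.proj ⟨t, h1⟩ : C.base) : X) ∈ D.base
      · obtain ⟨y, hy⟩ := hsurj ⟨_, h4⟩
        have h5 := hf y
        rw [hy] at h5
        rw [h5] at h3
        have h6 := (hGne y).1 h3
        rw [hy] at h6
        exact h2 (subset_closure h6)
      · exact h3 (hf' _ h4)

end Chart

namespace GoodAtlas

variable (U : GoodAtlas.{u, v} X n)

/-- A partition of unity subordinate to the cover by the sets `U_{i}`, smooth in all charts. -/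
structure Partition where
  fn : U.V → X → ℝ
  smooth : ∀ i (J : U.Idx), ContDiffOn ℝ ∞ ((U.ch J).pull (fn i)) (U.ch J).dom
  tsupport_subset : ∀ i, tsupport (fn i) ⊆ (U.chart (FinIdx.single i)).base
  finite_support : ∀ x, (Function.support fun i => fn i x).Finite
  sum_eq_one : ∀ x, ∑ᶠ i, fn i x = 1

/-- Locally on a chart, all but finitely many members of the cover can be ignored. -/
theorem exists_finset_nhds (J : U.Idx) (z : (U.ch J).dom) :
    ∃ s : Finset U.V, ∀ᶠ t in 𝓝 (z : EE n), ∃ h : t ∈ (U.ch J).dom,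
      ∀ i, ((U.ch J).proj ⟨t, h⟩ : X) ∈ (U.chart (FinIdx.single i)).base → i ∈ s := by
  obtain ⟨N, hN, hfin⟩ := U.locallyFinite ((U.ch J).proj z : X)
  refine ⟨hfin.toFinset, ?_⟩
  filter_upwards [(U.ch J).preimage_mem_nhds isOpen_interior z (mem_interior_iff_mem_nhds.2 hN)]
    with t ht
  obtain ⟨h1, h2⟩ := ht
  exact ⟨h1, fun i hi => hfin.mem_toFinset.2 ⟨_, hi, interior_subset h2⟩⟩

/-- Shrink the cover so that the closures stay inside its members, take functions whose supports are
the shrunk sets, and divide by their locally finite sum, which is positive since the shrunk sets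
still cover. -/
theorem nonempty_partition [T2Space X] [ParacompactSpace X] : Nonempty U.Partition := by
  obtain ⟨O, hOU, hOo, hOc⟩ := exists_iUnion_eq_closure_subset
    (fun i => (U.chart (FinIdx.single i)).isOpen_base)
    (fun x => U.locallyFinite.point_finite x) U.cover
  choose f hf0 hfs hfc using fun i => Chart.exists_smooth_support_eq (hOo i) (hOc i)
  have hfc' : ∀ i (J : U.Idx) (z : (U.ch J).dom), ContDiffAt ℝ ∞ ((U.ch J).pull (f i)) z :=
    fun i J z => hfc i (U.ch J) z fun hz => U.nonempty_localLift J (FinIdx.single i) z hz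
  have hsub : ∀ i x, f i x ≠ 0 → x ∈ (U.chart (FinIdx.single i)).base := fun i x hx =>
    hOc i (subset_closure ((hfs i).subset hx))
  have hfin : ∀ x, (Function.support fun i => f i x).Finite := fun x =>
    (U.locallyFinite.point_finite x).subset fun i hi => hsub i x hi
  let F : X → ℝ := fun x => ∑ᶠ i, f i x
  have hF : ∀ x, 0 < F x := fun x => by
    obtain ⟨i, hi⟩ := mem_iUnion.1 (hOU.superset (mem_univ x))
    refine finsum_pos (fun i => hf0 i x) ⟨i, lt_of_le_of_ne (hf0 i x) (Ne.symm ?_)⟩ (hfin x)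
    exact (hfs i).superset hi
  have hFc : ∀ (J : U.Idx) (z : (U.ch J).dom), ContDiffAt ℝ ∞ ((U.ch J).pull F) z := by
    intro J z
    obtain ⟨s, hs⟩ := U.exists_finset_nhds J z
    have h1 : ContDiffAt ℝ ∞ (fun t => ∑ i ∈ s, (U.ch J).pull (f i) t) (z : EE n) :=
      ContDiffAt.sum fun i _ => hfc' i J z
    refine h1.congr_of_eventuallyEq ?_
    filter_upwards [hs] with t ht
    obtain ⟨h2, h3⟩ := ht
    simp only [Chart.pull_of_mem _ _ h2]
    exact finsum_eq_sum_of_support_subset _ fun i hi => h3 i (hsub i _ hi)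
  refine ⟨⟨fun i x => f i x / F x, fun i J z hz => ?_, fun i => ?_, fun x => ?_, fun x => ?_⟩⟩
  · refine ContDiffAt.contDiffWithinAt ?_
    refine ((hfc' i J ⟨z, hz⟩).div (hFc J ⟨z, hz⟩) ?_).congr_of_eventuallyEq ?_
    · rw [Chart.pull_apply]; exact (hF _).ne'
    · filter_upwards [(U.ch J).isOpen_dom.mem_nhds hz] with t ht
      simp only [Chart.pull_of_mem _ _ ht, Pi.div_apply]
  · refine Subset.trans (closure_mono fun x hx => ?_) (hOc i)
    refine (hfs i).subset fun h => hx ?_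
    simp only [h, zero_div]
  · refine (hfin x).subset fun i hi h => hi ?_
    simp only [h, zero_div]
  · rw [show (∑ᶠ i, f i x / F x) = ∑ᶠ i, f i x * (F x)⁻¹ from rfl, ← finsum_mul' _ _ (hfin x)]
    exact mul_inv_cancel₀ (hF x).ne'

end GoodAtlas

end

/-! ### The double complex and its two subcomplexes -/

noncomputable section

variable {X : Type u} [TopologicalSpace X] {n m q : ℕ}

theorem extD_apply {S : Set (EE n)} (θ : FormFun n q) {x : EE n} (hx : x ∈ S) :
    extD S θ x = extDeriv θ x := by
  simp [extD, hx]

theorem extD_pullback {S : Set (EE n)} {T : Set (EE m)} {f : S → T} (hf : SmoothMap f)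
    (hS : IsOpen S) (hT : IsOpen T) {θ : FormFun m q} (hθ : ContDiffOn ℝ ∞ θ T) :
    extD S (pullback f θ) = pullback f (extD T θ) := by
  funext x
  by_cases hx : x ∈ S
  · have h2 : pullback f θ =ᶠ[𝓝 x] fun x =>
        (θ (extendMap f x)).compContinuousLinearMap (fderiv ℝ (extendMap f) x) :=
      Filter.eventuallyEq_of_mem (hS.mem_nhds hx) fun y hy => by simp [pullback, hy]
    have hfx := mapsTo_extendMap f hx
    simp only [pullback, extD, indicator_of_mem hx, indicator_of_mem hfx]
    change extDeriv (pullback f θ) x = _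
    rw [h2.extDeriv_eq, extDeriv_pullback (r := ∞)
      ((hθ.contDiffAt (hT.mem_nhds hfx)).differentiableAt (by simp))
      (hf.contDiffAt hS ⟨x, hx⟩) (by simp; exact WithTop.coe_le_coe.2 le_top)]
  · simp [pullback, extD, hx]

theorem extD_extD {S : Set (EE n)} (hS : IsOpen S) {θ : FormFun n q} (hθ : ContDiffOn ℝ ∞ θ S) :
    extD S (extD S θ) = 0 := by
  funext x
  by_cases hx : x ∈ S
  · have h : extD S θ =ᶠ[𝓝 x] extDeriv θ :=
      Filter.eventuallyEq_of_mem (hS.mem_nhds hx) fun y hy => extD_apply θ hy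
    rw [extD_apply _ hx, h.extDeriv_eq]
    exact extDeriv_extDeriv_apply (hθ.contDiffAt (hS.mem_nhds hx)) (by simp; exact WithTop.coe_le_coe.2 le_top)
  · simp [extD, hx]

theorem pullback_constForm {S : Set (EE n)} {T : Set (EE m)} (f : S → T) (c : ℝ) :
    pullback f (GoodAtlas.constForm T c) = GoodAtlas.constForm S c := by
  funext x
  by_cases hx : x ∈ S
  · simp only [pullback, GoodAtlas.constForm, indicator_of_mem hx,
      indicator_of_mem (mapsTo_extendMap f hx)]
    rfl
  · simp [pullback, GoodAtlas.constForm, hx]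

theorem extD_constForm {S : Set (EE n)} (hS : IsOpen S) (c : ℝ) :
    extD S (GoodAtlas.constForm S c) = 0 := by
  funext x
  by_cases hx : x ∈ S
  · have h : GoodAtlas.constForm S c =ᶠ[𝓝 x]
        fun _ => ContinuousAlternatingMap.constOfIsEmpty ℝ (EE n) (Fin 0) c :=
      Filter.eventuallyEq_of_mem (hS.mem_nhds hx) fun y hy => by simp [GoodAtlas.constForm, hy]
    rw [extD_apply _ hx, h.extDeriv_eq]
    simp only [extDeriv, fderiv_fun_const, Pi.zero_apply]
    exact (ContinuousAlternatingMap.alternatizeUncurryFinCLM ℝ (EE n) ℝ).map_zero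
  · simp [extD, hx]

/-- The group of integer constants on a set. -/
def intConst (S : Set (EE n)) : AddSubgroup (FormFun n 0) where
  carrier := {θ | ∃ c : ℤ, θ = GoodAtlas.constForm S c}
  zero_mem' := ⟨0, by
    funext x; by_cases hx : x ∈ S <;> simp [GoodAtlas.constForm, hx]; rfl⟩
  add_mem' := by
    rintro _ _ ⟨c, rfl⟩ ⟨d, rfl⟩
    refine ⟨c + d, ?_⟩
    funext x; by_cases hx : x ∈ S <;> simp [GoodAtlas.constForm, hx]; rfl
  neg_mem' := by
    rintro _ ⟨c, rfl⟩
    refine ⟨-c, ?_⟩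
    funext x; by_cases hx : x ∈ S <;> simp [GoodAtlas.constForm, hx]; rfl

theorem pullback_mem_intConst {S : Set (EE n)} {T : Set (EE m)} (f : S → T) {θ : FormFun m 0}
    (hθ : θ ∈ intConst T) : pullback f θ ∈ intConst S := by
  obtain ⟨c, rfl⟩ := hθ
  exact ⟨c, pullback_constForm f c⟩

/-- The exterior derivative on invariant forms. -/
def Chart.extDHom (C : Chart X n) (q : ℕ) : C.invForms q →+ C.invForms (q + 1) :=
  AddMonoidHom.mk' (fun θ => ⟨extD C.dom θ.1, extD_mem_invForms θ.2⟩) fun a b =>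
    Subtype.ext (extD_add C.isOpen_dom a.2.1 b.2.1)

theorem Chart.extD_bd {K : Type*} (C : Chart X n) {N : ℕ} {F : (Fin N → K) → FormFun n q}
    {I : Fin (N + 1) → K} (hF : ∀ J, F J ∈ C.invForms q) :
    extD C.dom (bd F I) = bd (fun J => extD C.dom (F J)) I := by
  have h := map_bd ((C.invForms (q + 1)).subtype.comp (C.extDHom q))
    (fun J => (⟨F J, hF J⟩ : C.invForms q)) I
  have h2 := map_bd (C.invForms q).subtype (fun J => (⟨F J, hF J⟩ : C.invForms q)) I
  refine Eq.trans ?_ h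
  exact congrArg (extD C.dom) h2.symm

namespace GoodAtlas

variable (U : GoodAtlas.{u, v} X n)

theorem cup_const (J : U.Idx) : U.cup (fun _ : Fin 1 => J) = J :=
  le_antisymm (Finset.sup'_le _ _ fun _ _ => le_rfl) (U.le_cup (fun _ : Fin 1 => J) 0)

theorem base_cup_comp_subset {p r : ℕ} (I : Fin (p + 1) → U.Idx) {J : Fin (r + 1) → U.Idx}
    (h : ∀ k, ∃ j, J k = I j) : (U.ch (U.cup I)).base ⊆ (U.ch (U.cup J)).base :=
  U.subset_base_cup _ fun k => by
    obtain ⟨j, hj⟩ := h k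
    rw [hj]; exact U.base_anti (U.le_cup I j)

/-- The member of a cochain at the string `J`, restricted to the chart with index `L`, where possible. -/
def ev (L : U.Idx) {p q : ℕ} (θ : (Fin (p + 1) → U.Idx) → FormFun n q) (J : Fin (p + 1) → U.Idx) :
    FormFun n q :=
  open scoped Classical in
  if h : (U.ch L).base ⊆ (U.ch (U.cup J)).base then U.restr h (θ J) else 0

variable {U} {p : ℕ} {L M : U.Idx} {J : Fin (p + 1) → U.Idx}

theorem ev_of_subset (θ : (Fin (p + 1) → U.Idx) → FormFun n q)
    (h : (U.ch L).base ⊆ (U.ch (U.cup J)).base) : U.ev L θ J = U.restr h (θ J) := dif_pos h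

theorem ev_eq {θ : (Fin (p + 1) → U.Idx) → FormFun n q} (e : (U.ch L).Emb (U.ch (U.cup J)))
    (hθ : θ J ∈ (U.ch (U.cup J)).invForms q) : U.ev L θ J = pullback e.toFun (θ J) :=
  (ev_of_subset θ e.base_subset).trans (pullback_emb_eq _ e hθ)

theorem ev_mem {θ : (Fin (p + 1) → U.Idx) → FormFun n q}
    (hθ : θ J ∈ (U.ch (U.cup J)).invForms q) : U.ev L θ J ∈ (U.ch L).invForms q := by
  by_cases h : (U.ch L).base ⊆ (U.ch (U.cup J)).base
  · rw [ev_of_subset θ h]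
    exact pullback_mem_invForms _ hθ
  · rw [ev, dif_neg h]; exact zero_mem _

theorem pullback_ev {θ : (Fin (p + 1) → U.Idx) → FormFun n q} (e : (U.ch L).Emb (U.ch M))
    (hθ : θ J ∈ (U.ch (U.cup J)).invForms q) (h : (U.ch M).base ⊆ (U.ch (U.cup J)).base) :
    pullback e.toFun (U.ev M θ J) = U.ev L θ J := by
  rw [ev_eq (U.emb h) hθ, ev_eq (e.comp (U.emb h)) hθ]
  exact (pullback_comp (Chart.Emb.smooth (U.emb h)) e.smooth (U.ch L).isOpen_dom
    (U.ch M).isOpen_dom _).symm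

/-- Whether the restriction is possible depends only on the union of the string, so the default
value zero does not disturb alternation. -/
theorem alternating_ev (L : U.Idx) (θ : U.cochain p q) : Alternating (U.ev L θ.1) := by
  intro J j k hjk
  by_cases h : (U.ch L).base ⊆ (U.ch (U.cup J)).base
  · have h' : (U.ch L).base ⊆ (U.ch (U.cup (J ∘ Equiv.swap j k))).base := by
      rwa [U.cup_comp_perm]
    rw [ev_of_subset _ h, ev_of_subset _ h', θ.2.2 J j k hjk, restr_neg,
      U.restr_congr rfl (U.cup_comp_perm J _) h' h]
  · have h' : ¬ (U.ch L).base ⊆ (U.ch (U.cup (J ∘ Equiv.swap j k))).base := by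
      rwa [U.cup_comp_perm]
    rw [ev, ev, dif_neg h, dif_neg h', neg_zero]

theorem ev_extDer (L : U.Idx) (θ : U.cochain p q) (J : Fin (p + 1) → U.Idx) :
    U.ev L (U.extDer p q θ).1 J = extD (U.ch L).dom (U.ev L θ.1 J) := by
  by_cases h : (U.ch L).base ⊆ (U.ch (U.cup J)).base
  · rw [ev_of_subset _ h, ev_of_subset _ h]
    exact (extD_pullback (Chart.Emb.smooth (U.emb h)) (U.ch L).isOpen_dom
      (U.ch (U.cup J)).isOpen_dom (θ.2.1 J).1).symm
  · rw [ev, ev, dif_neg h, dif_neg h]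
    exact (congrArg Subtype.val (map_zero ((U.ch L).extDHom q))).symm

/-- Once all members are read on one fixed chart, the Čech differential is the formal operator `bd`,
and its identities become those of `bd`. -/
theorem deltaFun_eq_bd (θ : (Fin (p + 1) → U.Idx) → FormFun n q) (I : Fin (p + 2) → U.Idx) :
    U.deltaFun θ I = bd (U.ev (U.cup I) θ) I :=
  Finset.sum_congr rfl fun k _ => by rw [ev_of_subset _ (U.base_cup_subset I k.succAbove)]

theorem ev_deltaFun (θ : U.cochain p q) {I : Fin (p + 2) → U.Idx}
    (h : (U.ch L).base ⊆ (U.ch (U.cup I)).base) :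
    U.ev L (U.deltaFun θ.1) I = bd (U.ev L θ.1) I := by
  rw [ev_of_subset _ h, deltaFun_eq_bd]
  refine (map_bd (pullbackHom (embFun (U.emb h)) q) _ _).trans (bd_congr fun k => ?_)
  exact pullback_ev (U.emb h) (θ.2.1 _) (U.base_cup_subset I k.succAbove)

theorem delta_delta (θ : U.cochain p q) : U.delta (p + 1) q (U.delta p q θ) = 0 := by
  refine Subtype.ext (funext fun I => ?_)
  change U.deltaFun (U.deltaFun θ.1) I = 0
  rw [deltaFun_eq_bd, bd_congr (G := bd (U.ev (U.cup I) θ.1))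
    fun k => ev_deltaFun θ (U.base_cup_subset I k.succAbove), bd_bd]

theorem extDer_extDer (θ : U.cochain p q) : U.extDer p (q + 1) (U.extDer p q θ) = 0 :=
  Subtype.ext (funext fun I => extD_extD (U.ch (U.cup I)).isOpen_dom (θ.2.1 I).1)

theorem extDer_delta (θ : U.cochain p q) :
    U.extDer (p + 1) q (U.delta p q θ) = U.delta p (q + 1) (U.extDer p q θ) := by
  refine Subtype.ext (funext fun I => ?_)
  change extD _ (U.deltaFun θ.1 I) = U.deltaFun (U.extDer p q θ).1 I
  rw [deltaFun_eq_bd, deltaFun_eq_bd, Chart.extD_bd _ fun J => ev_mem (θ.2.1 J)]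
  exact bd_congr fun k => (ev_extDer _ θ _).symm

variable (U) in
-- The squares of both differentials vanish and the differentials commute; since `δ` raises `p` by
-- one, the sign `(-1)^p` makes the mixed terms cancel.
theorem totalD_totalD (k : ℕ) (θ : U.Tot k) : U.totalD (k + 1) (U.totalD k θ) = 0 := by
  funext ⟨⟨p, q⟩, h⟩
  rcases p with _ | _ | p <;> rcases q with _ | _ | q
  · rfl
  · simp only at h; omega
  · exact extDer_extDer _
  · simp only at h; omega
  · change U.delta 0 1 (U.extDer 0 0 _) + (-1 : ℤ) ^ 1 • U.extDer 1 0 (U.delta 0 0 _) = 0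
    rw [extDer_delta]; simp
  · change U.delta 0 (q + 2) (U.extDer 0 (q + 1) _) + (-1 : ℤ) ^ 1 • U.extDer 1 (q + 1)
      (U.delta 0 (q + 1) _ + (-1 : ℤ) ^ 1 • U.extDer 1 q _) = 0
    rw [map_add, map_zsmul, extDer_extDer, extDer_delta]; simp
  · exact delta_delta _
  · change U.delta (p + 1) 1 (U.delta p 1 _ + (-1 : ℤ) ^ (p + 1) • U.extDer (p + 1) 0 _) +
      (-1 : ℤ) ^ (p + 2) • U.extDer (p + 2) 0 (U.delta (p + 1) 0 _) = 0
    rw [map_add, map_zsmul, delta_delta, extDer_delta]; simp [pow_succ]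
  · change U.delta (p + 1) (q + 2) (U.delta p (q + 2) _ +
        (-1 : ℤ) ^ (p + 1) • U.extDer (p + 1) (q + 1) _) +
      (-1 : ℤ) ^ (p + 2) • U.extDer (p + 2) (q + 1) (U.delta (p + 1) (q + 1) _ +
        (-1 : ℤ) ^ (p + 2) • U.extDer (p + 2) q _) = 0
    rw [map_add, map_add, map_zsmul, map_zsmul, delta_delta, extDer_delta, extDer_extDer]
    simp [pow_succ]

/-- Cochains of degree zero that are compatible with all embeddings. -/
def Compatible (η : U.cochain 0 q) : Prop :=
  ∀ {I J : U.Idx} (l : I ⟶ J), pullback (embFun l) (η.1 fun _ => J) = η.1 fun _ => I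

theorem invForms_const (η : U.cochain 0 q) (J : U.Idx) :
    (η.1 fun _ => J) ∈ (U.ch J).invForms q := by
  have h := η.2.1 fun _ => J
  rwa [cup_const] at h

theorem ev_const (η : U.cochain 0 q) {I J : U.Idx} (l : I ⟶ J) :
    U.ev I η.1 (fun _ => J) = pullback (embFun l) (η.1 fun _ => J) := by
  have h : (U.ch I).base ⊆ (U.ch J).base := Chart.Emb.base_subset l
  have h' : (U.ch I).base ⊆ (U.ch (U.cup fun _ : Fin 1 => J)).base := by rwa [cup_const]
  rw [ev_of_subset _ h', U.restr_congr rfl (U.cup_const J) h' h]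
  exact pullback_emb_eq _ _ (invForms_const η J)

theorem eq_const (J : Fin 1 → U.Idx) : J = fun _ => J 0 :=
  funext fun k => by rw [Subsingleton.elim k 0]

/-- Both members that occur restrict, on the chart of the union, to the member of the family at the
union. -/
theorem Compatible.delta_eq_zero {η : U.cochain 0 q} (hη : Compatible η) : U.delta 0 q η = 0 := by
  refine Subtype.ext (funext fun I => ?_)
  change U.deltaFun η.1 I = 0
  have h : ∀ k : Fin 2, U.ev (U.cup I) η.1 (I ∘ k.succAbove) = η.1 fun _ => U.cup I := by
    intro k
    rw [eq_const (I ∘ k.succAbove)]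
    have hb : (U.ch (U.cup I)).base ⊆ (U.ch ((I ∘ k.succAbove) 0)).base :=
      U.base_anti (U.le_cup I (k.succAbove 0))
    rw [ev_const η (U.emb hb), hη]
  rw [deltaFun_eq_bd, bd, Fin.sum_univ_two, h, h]
  simp

/-- Given an embedding of charts from `I` to `J`, the union `M` of the two has the same base as `I`,
so the chart of `I` embeds into that of `M`. Closedness at the string `I, J` says that the two
members agree on `M`, and this is pulled back to `I`. -/
theorem compatible_of_delta_eq_zero {η : U.cochain 0 q} (hη : U.delta 0 q η = 0) :
    Compatible η := by
  intro I J l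
  have h0 : U.deltaFun η.1 (![I, J]) = 0 := congrFun (congrArg Subtype.val hη) _
  have hl : (U.ch I).base ⊆ (U.ch J).base := Chart.Emb.base_subset l
  set M := U.cup ![I, J] with hM
  have hIM : (U.ch I).base ⊆ (U.ch M).base := U.subset_base_cup _ fun k => by
    fin_cases k
    · exact Subset.rfl
    · exact hl
  have hMI : (U.ch M).base ⊆ (U.ch I).base := U.base_anti (U.le_cup ![I, J] 0)
  have hMJ : (U.ch M).base ⊆ (U.ch J).base := U.base_anti (U.le_cup ![I, J] 1)
  have e0 : ![I, J] ∘ (0 : Fin 2).succAbove = fun _ => J := by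
    funext k; rw [Subsingleton.elim k 0]; rfl
  have e1 : ![I, J] ∘ (1 : Fin 2).succAbove = fun _ => I := by
    funext k; rw [Subsingleton.elim k 0]; rfl
  rw [deltaFun_eq_bd, bd, Fin.sum_univ_two, e0, e1] at h0
  have h1 : U.ev M η.1 (fun _ => J) = U.ev M η.1 fun _ => I := by
    rw [← sub_eq_zero, ← h0]; simp [sub_eq_add_neg, hM]
  have h2 := congrArg (pullback (embFun (U.emb hIM))) h1
  have hc : ∀ K : U.Idx, (η.1 fun _ => K) ∈ (U.ch (U.cup fun _ : Fin 1 => K)).invForms q :=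
    fun K => η.2.1 _
  rw [show embFun (U.emb hIM) = Chart.Emb.toFun (U.emb hIM) from rfl,
    pullback_ev _ (hc J) (by rwa [cup_const]), pullback_ev _ (hc I) (by rwa [cup_const]),
    ev_const η l, ev_const η (𝟙 I)] at h2
  rw [h2]
  exact pullback_id (U.ch I).isOpen_dom (invForms_const η I).2.1

theorem Compatible.extDer {η : U.cochain 0 q} (hη : Compatible η) :
    Compatible (U.extDer 0 q η) := by
  intro I J l
  change pullback _ (extD _ _) = extD _ _
  rw [cup_const, cup_const, ← hη l]
  exact (extD_pullback (Chart.Emb.smooth l) (U.ch I).isOpen_dom (U.ch J).isOpen_dom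
    (invForms_const η J).1).symm

variable (U) in
theorem totalD_mem_globalForms (k : ℕ) {θ : U.Tot k} (hθ : θ ∈ U.globalForms k) :
    U.totalD k θ ∈ U.globalForms (k + 1) := by
  have hc : Compatible (θ ⟨(0, k), zero_add k⟩) := hθ.2
  refine ⟨?_, hc.extDer⟩
  rintro ⟨⟨p, q⟩, h⟩ hp
  obtain _ | p := p
  · exact absurd rfl hp
  have hδ : ∀ h', U.delta p q (θ ⟨(p, q), h'⟩) = 0 := fun h' => by
    obtain _ | p := p
    · obtain rfl : q = k := by simpa using h'
      exact hc.delta_eq_zero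
    · rw [hθ.1 _ (Nat.succ_ne_zero p), map_zero]
  obtain _ | q := q
  · exact hδ _
  · change U.delta p (q + 1) _ + (-1 : ℤ) ^ (p + 1) • U.extDer (p + 1) q _ = 0
    rw [hδ, hθ.1 _ (Nat.succ_ne_zero p), map_zero, smul_zero, zero_add]

theorem ev_mem_intConst {θ : (Fin (p + 1) → U.Idx) → FormFun n 0}
    (hθ : θ J ∈ intConst (U.ch (U.cup J)).dom) : U.ev L θ J ∈ intConst (U.ch L).dom := by
  by_cases h : (U.ch L).base ⊆ (U.ch (U.cup J)).base
  · rw [ev_of_subset θ h]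
    exact pullback_mem_intConst _ hθ
  · rw [ev, dif_neg h]; exact zero_mem _

variable (U) in
theorem totalD_mem_intCochains (k : ℕ) {θ : U.Tot k} (hθ : θ ∈ U.intCochains k) :
    U.totalD k θ ∈ U.intCochains (k + 1) := by
  have hd : ∀ (p q : ℕ) (h : p + q = k), U.extDer p q (θ ⟨(p, q), h⟩) = 0 := by
    intro p q h
    obtain _ | q := q
    · obtain rfl : p = k := by simpa using h
      refine Subtype.ext (funext fun I => ?_)
      obtain ⟨c, hc⟩ := hθ.2 I
      change extD _ _ = 0
      rw [hc, extD_constForm (U.ch _).isOpen_dom]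
    · rw [hθ.1 _ (Nat.succ_ne_zero q), map_zero]
  refine ⟨?_, fun I => ?_⟩
  · rintro ⟨⟨p, q⟩, h⟩ hq
    obtain _ | q := q
    · exact absurd rfl hq
    obtain _ | p := p
    · exact hd _ _ _
    · change U.delta p (q + 1) _ + (-1 : ℤ) ^ (p + 1) • U.extDer (p + 1) q _ = 0
      rw [hd, hθ.1 _ (Nat.succ_ne_zero q), map_zero, smul_zero, zero_add]
  · change U.deltaFun (θ ⟨(k, 0), add_zero k⟩).1 I ∈ intConst _
    rw [deltaFun_eq_bd]
    exact Chain.bd_mem fun j => ev_mem_intConst (hθ.2 _)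

end GoodAtlas

end

/-! ### Exactness of the rows and cohomology of the global forms -/

noncomputable section

variable {X : Type u} [TopologicalSpace X] {n m q : ℕ}

namespace GoodAtlas

variable {U : GoodAtlas.{u, v} X n} {p : ℕ}

/-- The index of a member of the cover. -/
def vertex (i : U.V) : U.Idx := FinIdx.single i

namespace Partition

variable (ρ : U.Partition)

/-- A summand of the contraction of a cochain along a partition of unity. -/
def term (η : (Fin (p + 2) → U.Idx) → FormFun n q) (L : U.Idx) (I : Fin (p + 1) → U.Idx) (i : U.V)
    (z : EE n) : (EE n) [⋀^Fin q]→L[ℝ] ℝ :=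
  (U.ch L).pull (ρ.fn i) z •
    transport (U.ch L) (U.ch (U.cup (Fin.cons (vertex i) I : Fin (p + 2) → U.Idx))) q
      (η (Fin.cons (vertex i) I)) z

/-- The contraction of a cochain along a partition of unity: the sum over the cover of the products of
the members of the partition with the members of the cochain, as a form on the chart of `L`. -/
def contract (η : (Fin (p + 2) → U.Idx) → FormFun n q) (L : U.Idx) (I : Fin (p + 1) → U.Idx) :
    FormFun n q := fun z => ∑ᶠ i, ρ.term η L I i z

variable {ρ} {η : (Fin (p + 2) → U.Idx) → FormFun n q} {L M : U.Idx} {I : Fin (p + 1) → U.Idx}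

theorem mem_base_of_ne_zero {i : U.V} {z : (U.ch L).dom} (h : (U.ch L).pull (ρ.fn i) z ≠ 0) :
    ((U.ch L).proj z : X) ∈ (U.ch (vertex i)).base := by
  rw [Chart.pull_apply] at h
  exact ρ.tsupport_subset i (subset_closure h)

theorem nonempty_localLift_cons {i : U.V} {z : (U.ch L).dom}
    (hL : (U.ch L).base ⊆ (U.ch (U.cup I)).base)
    (h : ((U.ch L).proj z : X) ∈ (U.ch (vertex i)).base) :
    Nonempty (LocalLift (U.ch L) (U.ch (U.cup (Fin.cons (vertex i) I : Fin (p + 2) → U.Idx))) z) := by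
  refine U.nonempty_localLift _ _ z ?_
  have h1 : (U.ch L).base ∩ (U.ch (vertex i)).base ⊆
      (U.ch (U.cup (Fin.cons (vertex i) I : Fin (p + 2) → U.Idx))).base := by
    refine U.subset_base_cup _ fun k => ?_
    refine Fin.cases ?_ (fun j => ?_) k
    · exact inter_subset_right
    · exact inter_subset_left.trans (hL.trans (U.base_anti (U.le_cup I j)))
  exact h1 ⟨((U.ch L).proj z).2, h⟩

theorem support_term_subset (z : (U.ch L).dom) :
    (Function.support fun i => ρ.term η L I i z) ⊆
      Function.support fun i => ρ.fn i ((U.ch L).proj z) := fun i hi h => hi <| by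
  simp only at h
  simp only [term, Chart.pull_apply, h, zero_smul]

theorem contract_of_notMem {z : EE n} (hz : z ∉ (U.ch L).dom) : ρ.contract η L I z = 0 := by
  have h : ∀ i, ρ.term η L I i z = 0 := fun i => by
    rw [term, Chart.pull, Function.extend_apply' _ _ _ (by rintro ⟨y, rfl⟩; exact hz y.2)]
    simp
  simp only [contract, h, finsum_zero]

/-- Over the closed support of `ρ.fn i` a local lift exists and the transported form is smooth;
elsewhere the factor vanishes near the point. -/
theorem contDiffAt_term (hη : ∀ J, η J ∈ (U.ch (U.cup J)).invForms q)
    (hL : (U.ch L).base ⊆ (U.ch (U.cup I)).base) (i : U.V) (z : (U.ch L).dom) :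
    ContDiffAt ℝ ∞ (ρ.term η L I i) z := by
  by_cases h : ((U.ch L).proj z : X) ∈ tsupport (ρ.fn i)
  · obtain ⟨l⟩ := nonempty_localLift_cons hL (ρ.tsupport_subset i h)
    exact ((ρ.smooth i L).contDiffAt ((U.ch L).isOpen_dom.mem_nhds z.2)).smul
      (contDiffAt_transport l (hη _))
  · refine (contDiffAt_const (c := 0)).congr_of_eventuallyEq ?_
    filter_upwards [(U.ch L).preimage_mem_nhds (isClosed_tsupport (ρ.fn i)).isOpen_compl z h]
      with t ht
    obtain ⟨h1, h2⟩ := ht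
    rw [term, (U.ch L).pull_of_mem _ h1, image_eq_zero_of_notMem_tsupport h2, zero_smul]

theorem contDiffOn_contract (hη : ∀ J, η J ∈ (U.ch (U.cup J)).invForms q)
    (hL : (U.ch L).base ⊆ (U.ch (U.cup I)).base) :
    ContDiffOn ℝ ∞ (ρ.contract η L I) (U.ch L).dom := by
  intro z hz
  obtain ⟨s, hs⟩ := U.exists_finset_nhds L ⟨z, hz⟩
  have h1 : ContDiffAt ℝ ∞ (fun t => ∑ i ∈ s, ρ.term η L I i t) z :=
    ContDiffAt.sum fun i _ => contDiffAt_term hη hL i ⟨z, hz⟩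
  refine (h1.congr_of_eventuallyEq ?_).contDiffWithinAt
  filter_upwards [hs] with t ht
  obtain ⟨h2, h3⟩ := ht
  refine finsum_eq_sum_of_support_subset _ fun i hi => h3 i ?_
  exact ρ.tsupport_subset i (subset_closure (support_term_subset ⟨t, h2⟩ hi))

/-- At a point, pullback is linear and passes through the finite sum; on each summand it is
`pullback_transport`. For group elements this gives invariance of the contraction, for other
embeddings its compatibility with restriction. -/
theorem pullback_contract (hη : ∀ J, η J ∈ (U.ch (U.cup J)).invForms q)
    (e : (U.ch L).Emb (U.ch M)) (hM : (U.ch M).base ⊆ (U.ch (U.cup I)).base) :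
    pullback e.toFun (ρ.contract η M I) = ρ.contract η L I := by
  funext z
  by_cases hz : z ∈ (U.ch L).dom
  · obtain ⟨z, rfl⟩ : ∃ y : (U.ch L).dom, (y : EE n) = z := ⟨⟨z, hz⟩, rfl⟩
    rw [pullback_apply]
    let A := ContinuousAlternatingMap.compContinuousLinearMapCLM (F := ℝ) (ι := Fin q)
      (fderiv ℝ (extendMap e.toFun) z)
    have hfin : (Function.support fun i => ρ.term η M I i (e.toFun z)).Finite :=
      (ρ.finite_support _).subset (support_term_subset _)
    refine (AddMonoidHom.map_finsum A.toLinearMap.toAddMonoidHom hfin).trans (finsum_congr fun i => ?_)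
    have hp : (U.ch M).pull (ρ.fn i) (e.toFun z) = (U.ch L).pull (ρ.fn i) z := by
      rw [Chart.pull_apply, Chart.pull_apply, e.lift]
    by_cases h0 : (U.ch L).pull (ρ.fn i) z = 0
    · simp only [term, hp, h0, zero_smul]
      exact map_zero A
    · obtain ⟨l⟩ := nonempty_localLift_cons hM (mem_base_of_ne_zero (hp ▸ h0))
      refine (A.map_smul _ _).trans ?_
      rw [hp]
      exact congrArg _ (pullback_transport e l (hη _))
  · rw [pullback_of_notMem _ _ hz, contract_of_notMem hz]

variable (ρ) in
/-- The contraction of alternating cochains along a partition of unity. -/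
def contractCochain (η : U.cochain (p + 1) q) : U.cochain p q :=
  ⟨fun I => ρ.contract η.1 (U.cup I) I, fun I =>
    ⟨contDiffOn_contract η.2.1 Subset.rfl, fun _ hz => contract_of_notMem hz, fun g hg =>
      pullback_contract η.2.1 (Chart.Emb.ofGroup _ g hg) Subset.rfl⟩, fun I j k hjk => by
    beta_reduce
    rw [cup_comp_perm]
    funext z
    refine Eq.trans ?_ (finsum_neg_distrib _)
    refine finsum_congr fun i => ?_
    rw [term, Chain.cons_comp_swap,
      η.2.2 _ _ _ fun h => hjk (Fin.succ_injective _ h), cup_comp_perm, map_neg]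
    exact smul_neg _ _⟩

/-- Closedness at the string `i, I` expresses `η_I` as the alternating sum of the members at `i`
followed by the faces of `I`, all read on the chart of `{i} ∪ I`. Near a point where `ρ_i` is
nonzero there is a local lift to that chart, so the identity can be transported; the weights add up
to one. -/
theorem contract_bd (η : U.cochain (p + 1) q) (hη : U.delta (p + 1) q η = 0)
    (I : Fin (p + 2) → U.Idx) :
    bd (fun J => ρ.contract η.1 (U.cup I) J) I = η.1 I := by
  funext z
  by_cases hz : z ∈ (U.ch (U.cup I)).dom
  · obtain ⟨z, rfl⟩ : ∃ y : (U.ch (U.cup I)).dom, (y : EE n) = z := ⟨⟨z, hz⟩, rfl⟩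
    let L := U.cup I
    let s := (ρ.finite_support ((U.ch L).proj z)).toFinset
    have hs : ∀ J : Fin (p + 1) → U.Idx,
        ρ.contract η.1 L J z = ∑ i ∈ s, ρ.term η.1 L J i z := fun J =>
      finsum_eq_sum_of_support_subset _ (by
        rw [Set.Finite.coe_toFinset]; exact support_term_subset z)
    have h1 : bd (fun J => ρ.contract η.1 L J) I z =
        ∑ i ∈ s, bd (fun J => ρ.term η.1 L J i z) I := by
      refine (map_bd (Pi.evalAddMonoidHom (fun _ : EE n => (EE n) [⋀^Fin q]→L[ℝ] ℝ) z) _ I).trans ?_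
      simp only [Pi.evalAddMonoidHom_apply, hs]
      simp only [bd, Finset.smul_sum]
      exact Finset.sum_comm
    have h2 : ∀ i ∈ s, bd (fun J => ρ.term η.1 L J i z) I = (U.ch L).pull (ρ.fn i) z • η.1 I z := by
      intro i hi
      have hi' : ρ.fn i ((U.ch L).proj z) ≠ 0 := by simpa [s] using hi
      have hiL := ρ.tsupport_subset i (subset_closure hi')
      have hsm : ∀ F : (Fin (p + 1) → U.Idx) → (EE n) [⋀^Fin q]→L[ℝ] ℝ,
          bd (fun J => (U.ch L).pull (ρ.fn i) z • F J) I = (U.ch L).pull (ρ.fn i) z • bd F I :=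
        fun F => by simp only [bd, Finset.smul_sum, smul_comm ((U.ch L).pull (ρ.fn i) z)]
      refine (hsm _).trans (congrArg _ ?_)
      set M := U.cup (Fin.cons (vertex i) I : Fin (p + 3) → U.Idx) with hM
      obtain ⟨l⟩ := nonempty_localLift_cons (I := I) (z := z) Subset.rfl hiL
      have hMI : (U.ch M).base ⊆ (U.ch (U.cup I)).base :=
        U.base_cup_comp_subset _ fun k => ⟨k.succ, by simp⟩
      have hMk : ∀ k : Fin (p + 2), (U.ch M).base ⊆
          (U.ch (U.cup (Fin.cons (vertex i) (I ∘ k.succAbove) : Fin (p + 2) → U.Idx))).base := by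
        intro k
        rw [← cons_comp_succAbove_succ]
        exact U.base_cup_subset _ _
      -- In the vanishing differential at `Fin.cons (vertex i) I`, the face that omits `i` balances
      -- those that keep it.
      have h3 : bd (fun J => U.ev M η.1 (Fin.cons (vertex i) J)) I = U.ev M η.1 I := by
        have h4 := congrFun (congrArg Subtype.val hη) (Fin.cons (vertex i) I)
        change U.deltaFun η.1 _ = 0 at h4
        rw [deltaFun_eq_bd, bd_cons, sub_eq_zero] at h4
        exact h4.symm
      have h5 := map_bd ((Pi.evalAddMonoidHom (fun _ : EE n => (EE n) [⋀^Fin q]→L[ℝ] ℝ)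
        (z : EE n)).comp (transport (U.ch L) (U.ch M) q))
        (fun J => U.ev M η.1 (Fin.cons (vertex i) J)) I
      rw [h3] at h5
      have h6 : transport (U.ch L) (U.ch M) q (U.ev M η.1 I) z = η.1 I z := by
        rw [ev_eq (U.emb hMI) (η.2.1 I), transport_pullback l _ (η.2.1 I),
          transport_self (η.2.1 I) z.2]
      refine Eq.trans (Eq.trans ?_ h5.symm) h6
      refine bd_congr fun k => ?_
      change _ = transport (U.ch L) (U.ch M) q (U.ev M η.1 _) z
      rw [ev_eq (U.emb (hMk k)) (η.2.1 _), transport_pullback l _ (η.2.1 _)]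
    refine h1.trans ?_
    rw [Finset.sum_congr rfl h2, ← Finset.sum_smul]
    simp only [Chart.pull_apply]
    rw [← finsum_eq_sum_of_support_subset _ (by rw [Set.Finite.coe_toFinset]), ρ.sum_eq_one,
      one_smul]
  · have hb : bd (fun J => ρ.contract η.1 (U.cup I) J) I z = 0 := by
      refine (map_bd (Pi.evalAddMonoidHom (fun _ : EE n => (EE n) [⋀^Fin q]→L[ℝ] ℝ) z) _ I).trans ?_
      simp only [Pi.evalAddMonoidHom_apply, contract_of_notMem hz]
      simp [bd]
    rw [hb, (η.2.1 I).2.1 z hz]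

/-- The rows of the double complex are exact. -/
theorem delta_contractCochain (η : U.cochain (p + 1) q) (hη : U.delta (p + 1) q η = 0) :
    U.delta p q (ρ.contractCochain η) = η := by
  refine Subtype.ext (funext fun I => ?_)
  change U.deltaFun (ρ.contractCochain η).1 I = η.1 I
  rw [deltaFun_eq_bd, ← contract_bd (ρ := ρ) η hη I]
  refine bd_congr fun k => ?_
  have h := U.base_cup_subset I k.succAbove
  rw [ev_of_subset _ h]
  exact pullback_contract η.2.1 (U.emb h) Subset.rfl

end Partition

variable (U) in
/-- The image of the total differential. -/
def coboundaries : ∀ k, AddSubgroup (U.Tot k)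
  | 0 => ⊥
  | k + 1 => (U.totalD k).range

/-- A total cochain whose differential is concentrated in the column `p = 0` is cohomologous to a global
form. -/
theorem exists_globalForm (ρ : U.Partition) (k : ℕ) (r : ℕ) (x : U.Tot k)
    (hr : ∀ b : Bideg k, r < b.1.1 → x b = 0)
    (hx : ∀ b : Bideg (k + 1), b.1.1 ≠ 0 → U.totalD k x b = 0) :
    ∃ e ∈ U.globalForms k, x - e ∈ U.coboundaries k := by
  induction r generalizing x with
  | zero =>
    refine ⟨x, ⟨fun b hb => hr b (Nat.pos_of_ne_zero hb), ?_⟩, by rw [sub_self]; exact zero_mem _⟩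
    refine compatible_of_delta_eq_zero ?_
    -- Only column zero is left, and the component of the differential in bidegree `(1, k)` is its
    -- Čech differential.
    have h1 := hx ⟨(1, k), by simp only; omega⟩ one_ne_zero
    obtain _ | k := k
    · exact h1
    · change U.delta 0 (k + 1) _ + (-1 : ℤ) ^ 1 • U.extDer 1 k _ = 0 at h1
      rwa [hr ⟨(1, k), _⟩ zero_lt_one, map_zero, smul_zero, add_zero] at h1
  | succ r ih =>
    by_cases hk : r + 1 ≤ k
    · obtain ⟨q, rfl⟩ : ∃ q, k = r + q + 1 := ⟨k - (r + 1), by omega⟩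
      have hb : r + 1 + q = r + q + 1 := by omega
      -- Column `r + 1` is the last that may be nonzero, so the Čech differential of its entry is a
      -- full component of the total differential of `x`, outside column zero.
      have hδ : U.delta (r + 1) q (x ⟨(r + 1, q), hb⟩) = 0 := by
        have h1 := hx ⟨(r + 2, q), by simp only; omega⟩ (Nat.succ_ne_zero _)
        obtain _ | q := q
        · exact h1
        · change U.delta (r + 1) (q + 1) _ + (-1 : ℤ) ^ (r + 2) • U.extDer (r + 2) q _ = 0 at h1
          rwa [hr ⟨(r + 2, q), _⟩ (Nat.lt_succ_self (r + 1)), map_zero, smul_zero, add_zero] at h1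
      -- The Čech differential of the contraction is the entry in column `r + 1`, and its exterior
      -- derivative lies in column `r`. Subtracting the total differential of `y` thus clears column
      -- `r + 1`.
      let y : U.Tot (r + q) :=
        Pi.single ⟨(r, q), rfl⟩ (ρ.contractCochain (x ⟨(r + 1, q), hb⟩))
      have hy : ∀ b : Bideg (r + q), b.1.1 ≠ r → y b = 0 := fun b hb =>
        Pi.single_eq_of_ne (by rintro rfl; exact hb rfl) _
      have hyr : y ⟨(r, q), rfl⟩ = ρ.contractCochain (x ⟨(r + 1, q), hb⟩) := Pi.single_eq_same _ _
      have hx1 : ∀ b : Bideg (r + q + 1), r < b.1.1 → (x - U.totalD (r + q) y) b = 0 := by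
        rintro ⟨⟨p, q'⟩, hpq⟩ hp
        obtain _ | p := p
        · exact absurd hp (Nat.not_lt_zero _)
        have hkey : ∀ h', x ⟨(p + 1, q'), hpq⟩ = U.delta p q' (y ⟨(p, q'), h'⟩) := by
          intro h'
          by_cases hpr : p = r
          · subst hpr
            obtain rfl : q' = q := by simp only at h'; omega
            rw [hyr, Partition.delta_contractCochain _ hδ]
          · have hp' : r < p + 1 := hp
            rw [hy _ hpr, map_zero]
            exact hr _ (by simp only; omega)
        obtain _ | q' := q'
        · exact sub_eq_zero.2 (hkey _)
        · have h1 : U.totalD (r + q) y ⟨(p + 1, q' + 1), hpq⟩ =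
              U.delta p (q' + 1) (y ⟨(p, q' + 1), by simp only at hpq ⊢; omega⟩) +
              (-1 : ℤ) ^ (p + 1) • U.extDer (p + 1) q'
                (y ⟨(p + 1, q'), by simp only at hpq ⊢; omega⟩) := rfl
          have hp' : r < p + 1 := hp
          rw [Pi.sub_apply, h1, ← hkey, hy _ (by simp only; omega), map_zero, smul_zero, add_zero,
            sub_self]
      obtain ⟨e, he, hxe⟩ := ih (x - U.totalD (r + q) y) hx1 fun b hb => by
        rw [map_sub, totalD_totalD, sub_zero]
        exact hx b hb
      refine ⟨e, he, ?_⟩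
      rw [show x - e = (x - U.totalD (r + q) y - e) + U.totalD (r + q) y by abel]
      exact add_mem hxe ⟨y, rfl⟩
    -- In total degree `k ≤ r` there is no column `r + 1`.
    · refine ih x (fun b hb => hr b ?_) hx
      have := b.2
      omega

end GoodAtlas

/-- `exists_globalForm` serves twice: it replaces a primitive of a global form by a global
primitive, and a cocycle by a cohomologous global form. The two subcomplexes lie in the bidegrees
`(0, k)` and `(k, 0)`, which differ for positive `k`. -/
theorem GPreOrb.isSparkComplex (U : GPreOrb.{u, v}) : U.sparkTriple.IsSparkComplex := by
  have := U.t2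
  have := U.paracompact
  obtain ⟨ρ⟩ := U.atlas.nonempty_partition
  have hcob : ∀ k, U.sparkTriple.coboundaries k = U.atlas.coboundaries k := by
    rintro (_ | k) <;> rfl
  have key : ∀ k (x : U.atlas.Tot k),
      (∀ b : Bideg (k + 1), b.1.1 ≠ 0 → U.atlas.totalD k x b = 0) →
      ∃ e ∈ U.atlas.globalForms k, x - e ∈ U.atlas.coboundaries k := fun k x =>
    GoodAtlas.exists_globalForm ρ k k x fun b hb => by have := b.2; omega
  have hdc : ∀ k, ∀ x ∈ U.atlas.coboundaries k, U.atlas.totalD k x = 0 := by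
    rintro (_ | k) x hx
    · rw [AddSubgroup.mem_bot.1 hx, map_zero]
    · obtain ⟨y, rfl⟩ := hx
      exact U.atlas.totalD_totalD k y
  have hdx : ∀ k (x e : U.atlas.Tot k), x - e ∈ U.atlas.coboundaries k →
      U.atlas.totalD k x = U.atlas.totalD k e := fun k x e h => by
    rw [← sub_eq_zero, ← map_sub, hdc k _ h]
  refine ⟨U.atlas.totalD_totalD, fun k x => U.atlas.totalD_mem_globalForms k,
    fun k x => U.atlas.totalD_mem_intCochains k, fun k hk => ?_, fun k e he hc => ?_,
    fun k x hx => ?_⟩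
  · refine (AddSubgroup.eq_bot_iff_forall _).2 ?_
    rintro θ ⟨hI, hE⟩
    funext b
    by_cases hb : b.1.1 = 0
    · exact hI.1 b (by have := b.2; omega)
    · exact hE.1 b hb
  · obtain _ | k := k
    · exact hc
    · obtain ⟨x, rfl⟩ := hc
      obtain ⟨e, he', hxe⟩ := key k x fun b hb => he.1 b hb
      exact ⟨e, he', (hdx k x e hxe).symm⟩
  · obtain ⟨e, he, hxe⟩ := key k x fun b _ => congrFun hx b
    exact ⟨e, he, (hdx k x e hxe).symm.trans hx, (hcob k).symm ▸ hxe⟩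

end

/-! ### Cochains evaluated at chains, and pullback along compatible systems -/

noncomputable section

variable {X : Type u} [TopologicalSpace X] {Y : Type u} [TopologicalSpace Y]
  {Z : Type u} [TopologicalSpace Z] {n m l q : ℕ}

theorem Chain.mem_of_mk {K : Type*} {N : ℕ} {S : AddSubgroup (Chain K N)} (h : ∀ J, Chain.mk J ∈ S)
    (c : Chain K N) : c ∈ S := by
  have h1 : QuotientAddGroup.mk' S = 0 :=
    Chain.hom_ext fun J => (QuotientAddGroup.eq_zero_iff _).2 (h J)
  exact (QuotientAddGroup.eq_zero_iff _).1 (DFunLike.congr_fun h1 c)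

instance : IsAddTorsionFree ((EE n) [⋀^Fin q]→L[ℝ] ℝ) := .of_module_rat _

instance (C : Chart X n) : IsAddTorsionFree (C.invForms q) where
  nsmul_right_injective k hk a b h := by
    refine Subtype.ext (nsmul_right_injective hk ?_)
    exact congrArg Subtype.val h

namespace GoodAtlas

variable {V : GoodAtlas.{u, v} Y m} {L M : V.Idx} {p r : ℕ}

/-- The evaluation of an alternating cochain at chains, as forms on the chart with index `L`. -/
def pair (L : V.Idx) (η : V.cochain r q) : Chain V.Idx (r + 1) →+ (V.ch L).invForms q :=
  Chain.lift (fun J => ⟨V.ev L η.1 J, ev_mem (η.2.1 J)⟩) fun J j k h =>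
    Subtype.ext (alternating_ev L η J j k h)

theorem pair_mk (η : V.cochain r q) (J : Fin (r + 1) → V.Idx) :
    (pair L η (Chain.mk J)).1 = V.ev L η.1 J :=
  congrArg Subtype.val (Chain.lift_mk _ _ J)

theorem smooth_embFun (e : L ⟶ M) : SmoothMap (embFun e) := Chart.Emb.smooth e

variable (V) in
/-- The indices of the charts over the base of the chart with index `L`. -/
def near (L : V.Idx) : Set V.Idx := {J | (V.ch L).base ⊆ (V.ch J).base}

theorem near_mono (h : (V.ch L).base ⊆ (V.ch M).base) : V.near M ⊆ V.near L := fun _ hJ => h.trans hJ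

theorem ev_of_emb (e : L ⟶ M) (η : V.cochain r q) {J : Fin (r + 1) → V.Idx} (hM : M = V.cup J) :
    V.ev L η.1 J = pullback (embFun e) (η.1 J) := by
  subst hM
  exact ev_eq e (η.2.1 J)

/-- For vertices near `L` the string and all its faces can be restricted to the chart of `L`.
Without this condition a face might be restrictable while the whole string has the default value
zero. -/
theorem pair_boundary (η : V.cochain r q) {c : Chain V.Idx (r + 2)}
    (hc : c ∈ Chain.supported (V.near L) (r + 2)) :
    pair L η (Chain.boundary c) = pair L (V.delta r q η) c := by
  refine Chain.eq_of_supported (f := (pair L η).comp Chain.boundary) (fun J hJ => ?_) hc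
  refine Subtype.ext ?_
  rw [pair_mk, AddMonoidHom.comp_apply, Chain.boundary_mk]
  refine Eq.trans ?_ (ev_deltaFun η (V.subset_base_cup J hJ)).symm
  refine (congrArg Subtype.val (map_bd (pair L η) _ J)).trans ?_
  refine (map_bd ((V.ch L).invForms q).subtype _ J).trans (bd_congr fun k => ?_)
  exact pair_mk η _

theorem pair_extDer (η : V.cochain r q) (c : Chain V.Idx (r + 1)) :
    (pair L (V.extDer r q η) c).1 = extD (V.ch L).dom (pair L η c).1 := by
  have h : pair L (V.extDer r q η) = ((V.ch L).extDHom q).comp (pair L η) :=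
    Chain.hom_ext fun J => Subtype.ext <| by
      rw [pair_mk, ev_extDer, ← pair_mk]
      rfl
  rw [h]; rfl

theorem pullback_pair (e : L ⟶ M) (η : V.cochain r q) {c : Chain V.Idx (r + 1)}
    (hc : c ∈ Chain.supported (V.near M) (r + 1)) :
    pullback (embFun e) (pair M η c).1 = (pair L η c).1 := by
  refine Chain.eq_of_supported (f := (pullbackHom (embFun e) q).comp
    (((V.ch M).invForms q).subtype.comp (pair M η)))
    (g := ((V.ch L).invForms q).subtype.comp (pair L η)) (fun J hJ => ?_) hc
  refine (congrArg (pullback (embFun e)) (pair_mk η J)).trans (Eq.trans ?_ (pair_mk η J).symm)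
  exact pullback_ev e (η.2.1 J) (V.subset_base_cup J hJ)

theorem pair_add (a b : V.cochain r q) (c : Chain V.Idx (r + 1)) :
    pair L (a + b) c = pair L a c + pair L b c := by
  have h : pair L (a + b) = pair L a + pair L b := by
    refine Chain.hom_ext fun J => Subtype.ext ?_
    refine (pair_mk _ J).trans ?_
    refine Eq.trans ?_ (congrArg₂ (· + ·) (pair_mk a J) (pair_mk b J)).symm
    by_cases h : (V.ch L).base ⊆ (V.ch (V.cup J)).base
    · simp only [ev_of_subset _ h]
      exact pullback_add _ _ _
    · simp [ev, h]
  rw [h]; rfl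

theorem pair_mem_intConst {η : V.cochain r 0} (hη : ∀ J, η.1 J ∈ intConst (V.ch (V.cup J)).dom)
    (c : Chain V.Idx (r + 1)) : (pair L η c).1 ∈ intConst (V.ch L).dom :=
  Chain.mem_of_mk (S := (intConst (V.ch L).dom).comap
    (((V.ch L).invForms 0).subtype.comp (pair L η))) (fun J => by
      change (pair L η (Chain.mk J)).1 ∈ intConst (V.ch L).dom
      rw [pair_mk]
      exact ev_mem_intConst (hη J)) c

end GoodAtlas

namespace CompatSys

variable {U : GoodAtlas.{u, v} X n} {V : GoodAtlas.{u, v} Y m} (f : CompatSys U V) {p r : ℕ}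

open GoodAtlas

theorem obj_cup (I : Fin (p + 1) → U.Idx) :
    f.functor.obj (U.cup I) = V.cup (f.functor.obj ∘ I) :=
  Finset.apply_sup'_eq_sup'_comp Finset.univ_nonempty f.functor.obj f.map_sup

theorem pullback_emb_lift {I J : U.Idx} (e : I ⟶ J) (θ : FormFun m q) :
    pullback (embFun e) (pullback (f.lift J) θ) =
      pullback (f.lift I) (pullback (embFun (f.functor.map e)) θ) := by
  rw [← pullback_comp (f.smooth_lift J) (smooth_embFun e) (U.ch I).isOpen_dom (U.ch J).isOpen_dom,
    ← pullback_comp (smooth_embFun (f.functor.map e)) (f.smooth_lift I) (U.ch I).isOpen_dom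
      (V.ch _).isOpen_dom]
  exact congrArg (pullback · θ) (funext fun x => f.lift_emb e x)

/-- A group element is an embedding of the chart into itself, and the functor turns it into an
embedding of the target chart into itself, which fixes invariant forms. -/
theorem pullback_lift_mem {I : U.Idx} {θ : FormFun m q}
    (hθ : θ ∈ (V.ch (f.functor.obj I)).invForms q) :
    pullback (f.lift I) θ ∈ (U.ch I).invForms q := by
  refine ⟨contDiffOn_pullback (f.smooth_lift I) (U.ch I).isOpen_dom hθ.1,
    fun x hx => pullback_of_notMem _ _ hx, fun g hg => ?_⟩
  let e : I ⟶ I := Chart.Emb.ofGroup (U.ch I) g hg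
  refine (f.pullback_emb_lift e θ).trans (congrArg _ ?_)
  refine (pullback_emb_eq (f.functor.map e) (𝟙 (f.functor.obj I)) hθ).trans ?_
  exact pullback_id (V.ch _).isOpen_dom hθ.2.1

/-- The evaluation of a cochain at chains, pulled back to the chart with index `L`. -/
def evalAt (L : U.Idx) (η : V.cochain r q) : Chain V.Idx (r + 1) →+ FormFun n q :=
  (pullbackHom (f.lift L) q).comp
    (((V.ch (f.functor.obj L)).invForms q).subtype.comp (pair (f.functor.obj L) η))

variable {f} {L M : U.Idx}

theorem evalAt_apply (η : V.cochain r q) (c : Chain V.Idx (r + 1)) :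
    f.evalAt L η c = pullback (f.lift L) (pair (f.functor.obj L) η c).1 := rfl

theorem evalAt_mk (η : V.cochain r q) (J : Fin (r + 1) → V.Idx) :
    f.evalAt L η (Chain.mk J) = pullback (f.lift L) (V.ev (f.functor.obj L) η.1 J) := by
  rw [evalAt_apply, pair_mk]

theorem evalAt_mem (η : V.cochain r q) (c : Chain V.Idx (r + 1)) :
    f.evalAt L η c ∈ (U.ch L).invForms q :=
  f.pullback_lift_mem (pair (f.functor.obj L) η c).2

theorem pullback_evalAt (e : L ⟶ M) (η : V.cochain r q) {c : Chain V.Idx (r + 1)}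
    (hc : c ∈ Chain.supported (V.near (f.functor.obj M)) (r + 1)) :
    pullback (embFun e) (f.evalAt M η c) = f.evalAt L η c := by
  rw [evalAt_apply, evalAt_apply, pullback_emb_lift, pullback_pair _ _ hc]

theorem evalAt_boundary (η : V.cochain r q) {c : Chain V.Idx (r + 2)}
    (hc : c ∈ Chain.supported (V.near (f.functor.obj L)) (r + 2)) :
    f.evalAt L η (Chain.boundary c) = f.evalAt L (V.delta r q η) c := by
  rw [evalAt_apply, pair_boundary η hc]; rfl

theorem evalAt_extDer (η : V.cochain r q) (c : Chain V.Idx (r + 1)) :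
    f.evalAt L (V.extDer r q η) c = extD (U.ch L).dom (f.evalAt L η c) := by
  rw [evalAt_apply, pair_extDer]
  exact (extD_pullback (f.smooth_lift L) (U.ch L).isOpen_dom (V.ch _).isOpen_dom
    (pair (f.functor.obj L) η c).2.1).symm

/-- The transformation embeds the chart of `f (∪ I)` into that of `g (∪ I)`, the union of the string
`g ∘ I`, and the lifting of `g` is that of `f` followed by this embedding. Pullback along `g`
thereby becomes an evaluation relative to `f`. -/
theorem evalAt_mk_trans {g : CompatSys U V} (a : f ⟶ g) (η : V.cochain r q)
    (I : Fin (r + 1) → U.Idx) :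
    f.evalAt (U.cup I) η (Chain.mk (g.functor.obj ∘ I)) = g.pullbackFun η.1 I := by
  rw [evalAt_mk, ev_of_emb (a.nat.app (U.cup I)) η (g.obj_cup I),
    ← pullback_comp (smooth_embFun (a.nat.app (U.cup I))) (f.smooth_lift _)
      (U.ch _).isOpen_dom (V.ch _).isOpen_dom]
  exact congrArg (pullback · _) (funext fun x => (a.lift_eq _ x).symm)

variable (f)

/-- The operator on cochains that is given by a family of chains. -/
def real (φ : (Fin (p + 1) → U.Idx) → Chain V.Idx (r + 1)) (hφ : Alternating φ) (q : ℕ) :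
    V.cochain r q →+ U.cochain p q :=
  AddMonoidHom.mk' (fun η => ⟨fun I => f.evalAt (U.cup I) η (φ I),
    fun I => evalAt_mem η (φ I), fun I j k h => by
      beta_reduce
      rw [U.cup_comp_perm, hφ I j k h, map_neg]⟩) fun a b =>
    Subtype.ext <| funext fun I => by
      change f.evalAt _ (a + b) _ = f.evalAt _ a _ + f.evalAt _ b _
      rw [evalAt_apply, GoodAtlas.pair_add]
      exact pullback_add _ _ _

/-- Families of chains with vertices over the base of the image of the union. -/
def Carried (φ : (Fin (p + 1) → U.Idx) → Chain V.Idx r) : Prop :=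
  ∀ I, φ I ∈ Chain.supported (V.near (f.functor.obj (U.cup I))) r

variable {f}

theorem near_obj_cup_comp (I : Fin (p + 2) → U.Idx) (k : Fin (p + 2)) :
    V.near (f.functor.obj (U.cup (I ∘ k.succAbove))) ⊆ V.near (f.functor.obj (U.cup I)) :=
  near_mono (V.base_anti (f.obj_mono (Finset.sup'_le _ _ fun _ _ => U.le_cup I _)))

theorem Carried.bd {φ : (Fin (p + 1) → U.Idx) → Chain V.Idx r} (hφ : f.Carried φ) :
    f.Carried (bd φ) := fun I => Chain.bd_mem fun k =>
  Chain.supported_mono (near_obj_cup_comp I k) (hφ (I ∘ k.succAbove))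

theorem carried_mk_obj :
    f.Carried (fun I => Chain.mk (f.functor.obj ∘ I) : (Fin (p + 1) → U.Idx) → _) :=
  fun I => Chain.mk_mem_supported fun k => V.base_anti (f.obj_mono (U.le_cup I k))

theorem real_delta {φ : (Fin (p + 1) → U.Idx) → Chain V.Idx (r + 2)} (hφ : Alternating φ)
    (hc : f.Carried φ) (η : V.cochain r q) :
    f.real φ hφ q (V.delta r q η) =
      f.real (fun I => Chain.boundary (φ I)) (hφ.map Chain.boundary) q η :=
  Subtype.ext <| funext fun I => (evalAt_boundary η (hc I)).symm

/-- The values at the faces of `I` are restricted to the chart of the union of `I`; since the chains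
are carried, this is the same as evaluating them on that chart directly. -/
theorem delta_real {φ : (Fin (p + 1) → U.Idx) → Chain V.Idx (r + 1)} (hφ : Alternating φ)
    (hc : f.Carried φ) (η : V.cochain r q) :
    U.delta p q (f.real φ hφ q η) = f.real (bd φ) hφ.bd q η := by
  refine Subtype.ext (funext fun I => ?_)
  change U.deltaFun (f.real φ hφ q η).1 I = f.evalAt _ η _
  rw [deltaFun_eq_bd, map_bd]
  refine bd_congr fun k => ?_
  have h := U.base_cup_subset I k.succAbove
  rw [ev_of_subset _ h]
  exact pullback_evalAt (U.emb h) η (hc _)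

theorem extDer_real {φ : (Fin (p + 1) → U.Idx) → Chain V.Idx (r + 1)} (hφ : Alternating φ)
    (η : V.cochain r q) :
    U.extDer p q (f.real φ hφ q η) = f.real φ hφ (q + 1) (V.extDer r q η) :=
  Subtype.ext <| funext fun _ => (evalAt_extDer η _).symm

theorem real_congr {φ ψ : (Fin (p + 1) → U.Idx) → Chain V.Idx (r + 1)} {hφ : Alternating φ}
    {hψ : Alternating ψ} (h : φ = ψ) (η : V.cochain r q) : f.real φ hφ q η = f.real ψ hψ q η := by
  subst h; rfl

theorem real_sub {φ ψ : (Fin (p + 1) → U.Idx) → Chain V.Idx (r + 1)} (hφ : Alternating φ)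
    (hψ : Alternating ψ) (η : V.cochain r q) :
    f.real (φ - ψ) (hφ.sub hψ) q η = f.real φ hφ q η - f.real ψ hψ q η :=
  Subtype.ext <| funext fun I => map_sub (f.evalAt (U.cup I) η) _ _

theorem real_add {φ ψ : (Fin (p + 1) → U.Idx) → Chain V.Idx (r + 1)} (hφ : Alternating φ)
    (hψ : Alternating ψ) (η : V.cochain r q) :
    f.real (φ + ψ) (hφ.add hψ) q η = f.real φ hφ q η + f.real ψ hψ q η :=
  Subtype.ext <| funext fun I => map_add (f.evalAt (U.cup I) η) _ _

variable (f)

theorem alternating_mk_obj :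
    Alternating fun I : Fin (p + 1) → U.Idx => Chain.mk (f.functor.obj ∘ I) :=
  Chain.alternating_mk.comp_left _

/-- Pullback of alternating cochains along a compatible system. -/
def pullbackCochain (p q : ℕ) : V.cochain p q →+ U.cochain p q :=
  f.real (fun I => Chain.mk (f.functor.obj ∘ I)) f.alternating_mk_obj q

variable {f}

theorem pullbackCochain_val (η : V.cochain p q) :
    (f.pullbackCochain p q η).1 = f.pullbackFun η.1 :=
  funext fun I => evalAt_mk_trans (𝟙 f) η I

theorem real_mk_obj {g : CompatSys U V} (a : f ⟶ g) (η : V.cochain p q) :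
    f.real (fun I => Chain.mk (g.functor.obj ∘ I)) g.alternating_mk_obj q η =
      g.pullbackCochain p q η :=
  Subtype.ext <| (funext fun I => evalAt_mk_trans a η I).trans (pullbackCochain_val η).symm

variable (f)

/-- The operator on total cochains that is given by families of chains of degree `s`. -/
def realTot (s : ℕ) (φ : ∀ p, (Fin (p + 1) → U.Idx) → Chain V.Idx (p + s + 1))
    (hφ : ∀ p, Alternating (φ p)) (k : ℕ) : V.Tot (k + s) →+ U.Tot k :=
  AddMonoidHom.mk' (fun θ b => f.real (φ b.1.1) (hφ b.1.1) b.1.2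
    (θ ⟨(b.1.1 + s, b.1.2), by have := b.2; simp only; omega⟩)) fun _ _ =>
    funext fun _ => map_add (f.real _ _ _) _ _

variable {f}

/-- Chains have integer coefficients, and pullback keeps constants. -/
theorem realTot_mem_intCochains {s : ℕ} (φ : ∀ p, (Fin (p + 1) → U.Idx) → Chain V.Idx (p + s + 1))
    (hφ : ∀ p, Alternating (φ p)) (k : ℕ) {θ : V.Tot (k + s)} (hθ : θ ∈ V.intCochains (k + s)) :
    f.realTot s φ hφ k θ ∈ U.intCochains k := by
  refine ⟨fun b hb => ?_, fun I => ?_⟩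
  · change f.real _ (hφ _) _ _ = 0
    rw [hθ.1 _ hb, map_zero]
  · exact pullback_mem_intConst _ (pair_mem_intConst hθ.2 _)

/-- An operator of positive degree only reads components of positive Čech degree, where global forms
vanish. -/
theorem realTot_eq_zero {s : ℕ} (φ : ∀ p, (Fin (p + 1) → U.Idx) → Chain V.Idx (p + s + 1))
    (hφ : ∀ p, Alternating (φ p)) (k : ℕ) (hs : s ≠ 0) {θ : V.Tot (k + s)}
    (hθ : θ ∈ V.globalForms (k + s)) : f.realTot s φ hφ k θ = 0 := by
  funext b
  change f.real _ (hφ _) _ _ = 0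
  rw [hθ.1 _ (by simp only; omega), map_zero]

theorem boundary_mk_obj (I : Fin (p + 2) → U.Idx) :
    Chain.boundary (Chain.mk (f.functor.obj ∘ I)) =
      bd (fun J : Fin (p + 1) → U.Idx => Chain.mk (f.functor.obj ∘ J)) I :=
  Chain.boundary_mk _

variable (f)

/-- Pullback of total cochains along a compatible system. -/
def pullbackTot (k : ℕ) : V.Tot k →+ U.Tot k :=
  f.realTot 0 (fun _ I => Chain.mk (f.functor.obj ∘ I)) (fun _ => f.alternating_mk_obj) k

/-- On both sides the family of chains is the alternating sum of the images of the faces of `I`. -/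
theorem delta_pullbackCochain (η : V.cochain p q) :
    U.delta p q (f.pullbackCochain p q η) = f.pullbackCochain (p + 1) q (V.delta p q η) :=
  (delta_real _ carried_mk_obj η).trans <| Eq.symm <|
    (real_delta _ carried_mk_obj η).trans (real_congr (funext boundary_mk_obj) η)

theorem pullbackTot_totalD (k : ℕ) (θ : V.Tot k) :
    f.pullbackTot (k + 1) (V.totalD k θ) = U.totalD k (f.pullbackTot k θ) := by
  funext ⟨⟨p, q⟩, h⟩
  rcases p with _ | p <;> rcases q with _ | q
  · exact map_zero (f.pullbackCochain 0 0)
  · exact (extDer_real f.alternating_mk_obj _).symm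
  · exact (f.delta_pullbackCochain _).symm
  · refine (map_add (f.pullbackCochain (p + 1) (q + 1)) _ _).trans ?_
    refine congrArg₂ (· + ·) (f.delta_pullbackCochain _).symm ?_
    refine (map_zsmul (f.pullbackCochain (p + 1) (q + 1)) _ _).trans (congrArg _ ?_)
    exact (extDer_real f.alternating_mk_obj _).symm

theorem pullbackTot_mem_globalForms (k : ℕ) {θ : V.Tot k} (hθ : θ ∈ V.globalForms k) :
    f.pullbackTot k θ ∈ U.globalForms k := by
  refine ⟨fun b hb => ?_, fun {I J} l => ?_⟩
  · change f.real _ f.alternating_mk_obj _ _ = 0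
    exact (congrArg _ (hθ.1 b hb)).trans (map_zero _)
  · have h : ∀ K : U.Idx, (f.pullbackTot k θ ⟨(0, k), zero_add k⟩).1 (fun _ => K) =
        pullback (f.lift K) ((θ ⟨(0, k), zero_add k⟩).1 fun _ => f.functor.obj K) := fun K => by
      refine (congrFun (pullbackCochain_val (f := f) (θ ⟨(0, k), zero_add k⟩)) fun _ => K).trans ?_
      rw [pullbackFun, cup_const]
    rw [h, h, pullback_emb_lift, hθ.2]

end CompatSys

end

/-! ### Chain homotopies: acyclic carriers and the prism -/

noncomputable section

variable {X : Type u} [TopologicalSpace X] {Y : Type u} [TopologicalSpace Y]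
  {Z : Type u} [TopologicalSpace Z] {n m l q : ℕ}

namespace CompatSys

variable {U : GoodAtlas.{u, v} X n} {V : GoodAtlas.{u, v} Y m} {f g : CompatSys U V} {p r k : ℕ}

open GoodAtlas

/-- Chain homotopies between the maps of strings given by two compatible systems, with vertices over the
images of the unions. -/
structure ChainHtpy (f g : CompatSys U V) where
  fn : ∀ N, (Fin N → U.Idx) → Chain V.Idx (N + 1)
  alternating : ∀ N, Alternating (fn N)
  carried : ∀ p, f.Carried (p := p) (fn (p + 1))
  zero : ∀ I, fn 0 I = 0
  boundary : ∀ N (I : Fin (N + 1) → U.Idx), Chain.boundary (fn (N + 1) I) + bd (fn N) I =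
    Chain.mk (g.functor.obj ∘ I) - Chain.mk (f.functor.obj ∘ I)

namespace ChainHtpy

theorem boundary_one (P : ChainHtpy f g) (I : Fin 1 → U.Idx) :
    Chain.boundary (P.fn 1 I) = Chain.mk (g.functor.obj ∘ I) - Chain.mk (f.functor.obj ∘ I) := by
  rw [← P.boundary, bd_singleton, P.zero, add_zero]

/-- The operator on cochains of a chain homotopy. -/
def op (P : ChainHtpy f g) (p q : ℕ) : V.cochain (p + 1) q →+ U.cochain p q :=
  f.real (P.fn (p + 1)) (P.alternating (p + 1)) q

theorem op_delta_zero (P : ChainHtpy f g) (a : f ⟶ g) (η : V.cochain 0 q) :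
    P.op 0 q (V.delta 0 q η) = g.pullbackCochain 0 q η - f.pullbackCochain 0 q η := by
  rw [← real_mk_obj a, pullbackCochain, ← real_sub]
  exact (real_delta _ (P.carried 0) η).trans (real_congr (funext P.boundary_one) η)

/-- With `real_mk_obj a` all four terms are operators relative to `f`, and the identity is the
boundary relation of the chains. -/
theorem delta_op_add (P : ChainHtpy f g) (a : f ⟶ g) (η : V.cochain (p + 1) q) :
    U.delta p q (P.op p q η) + P.op (p + 1) q (V.delta (p + 1) q η) =
      g.pullbackCochain (p + 1) q η - f.pullbackCochain (p + 1) q η := by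
  rw [← real_mk_obj a, pullbackCochain, ← real_sub, op, op, delta_real _ (P.carried p),
    real_delta _ (P.carried (p + 1)), ← real_add]
  refine real_congr (funext fun I => ?_) η
  exact (add_comm _ _).trans (P.boundary (p + 1) I)

theorem extDer_op (P : ChainHtpy f g) (η : V.cochain (p + 1) q) :
    U.extDer p q (P.op p q η) = P.op p (q + 1) (V.extDer (p + 1) q η) := extDer_real _ η

/-- The operator on total cochains of a chain homotopy. -/
def tot (P : ChainHtpy f g) (k : ℕ) : V.Tot (k + 1) →+ U.Tot k :=
  f.realTot 1 (fun p => P.fn (p + 1)) (fun p => P.alternating (p + 1)) k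

theorem tot_totalD_zero (P : ChainHtpy f g) (a : f ⟶ g) (θ : V.Tot 0) :
    P.tot 0 (V.totalD 0 θ) = g.pullbackTot 0 θ - f.pullbackTot 0 θ := by
  funext ⟨⟨p, q⟩, h⟩
  obtain ⟨rfl, rfl⟩ : p = 0 ∧ q = 0 := by simp only at h; omega
  exact P.op_delta_zero a _

/-- The operator commutes with the exterior derivative but lowers `p` by one, so the two terms with
an exterior derivative carry opposite signs and cancel; `delta_op_add` remains. -/
theorem totalD_tot_add (P : ChainHtpy f g) (a : f ⟶ g) (k : ℕ) (θ : V.Tot (k + 1)) :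
    U.totalD k (P.tot k θ) + P.tot (k + 1) (V.totalD (k + 1) θ) =
      g.pullbackTot (k + 1) θ - f.pullbackTot (k + 1) θ := by
  funext ⟨⟨p, q⟩, h⟩
  rcases p with _ | p <;> rcases q with _ | q
  · simp only at h; omega
  · have e : ∀ (ζ : V.cochain 0 (q + 1)) (ξ : V.cochain 1 q),
        U.extDer 0 q (P.op 0 q ξ) +
          P.op 0 (q + 1) (V.delta 0 (q + 1) ζ + (-1 : ℤ) ^ 1 • V.extDer 1 q ξ) =
        g.pullbackCochain 0 (q + 1) ζ - f.pullbackCochain 0 (q + 1) ζ := fun ζ ξ => by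
      rw [map_add, map_zsmul, op_delta_zero P a, extDer_op, pow_one, neg_one_smul]; abel
    exact e _ _
  · exact P.delta_op_add a _
  · have e : ∀ (ζ : V.cochain (p + 1) (q + 1)) (ξ : V.cochain (p + 2) q),
        (U.delta p (q + 1) (P.op p (q + 1) ζ) +
          (-1 : ℤ) ^ (p + 1) • U.extDer (p + 1) q (P.op (p + 1) q ξ)) +
          P.op (p + 1) (q + 1) (V.delta (p + 1) (q + 1) ζ +
            (-1 : ℤ) ^ (p + 2) • V.extDer (p + 2) q ξ) =
        g.pullbackCochain (p + 1) (q + 1) ζ - f.pullbackCochain (p + 1) (q + 1) ζ := fun ζ ξ => by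
      rw [map_add, map_zsmul, ← delta_op_add P a, extDer_op, pow_succ _ (p + 1), mul_neg_one,
        neg_smul]
      abel
    exact e _ _

/-- Two chain homotopies differ by the boundary of this family of chains. -/
def fill (P Q : ChainHtpy f g) : ∀ N, (Fin N → U.Idx) → Chain V.Idx (N + 2)
  | 0 => fun _ => 0
  | N + 1 => fun I => Chain.cone (f.functor.obj (U.cup I))
      (bd (fill P Q N) I - (Q.fn (N + 1) I - P.fn (N + 1) I))

variable (P Q : ChainHtpy f g)

theorem fill_succ (N : ℕ) (I : Fin (N + 1) → U.Idx) :
    fill P Q (N + 1) I = Chain.cone (f.functor.obj (U.cup I))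
      (bd (fill P Q N) I - (Q.fn (N + 1) I - P.fn (N + 1) I)) := rfl

/-- The apex of the cone depends only on the union of `I`, hence is unchanged by permutations. -/
theorem alternating_fill : ∀ N, Alternating (fill P Q N)
  | 0 => fun _ j => j.elim0
  | N + 1 => fun I j k h => by
    simp only [fill]
    rw [U.cup_comp_perm, (alternating_fill N).bd I j k h, Q.alternating _ I j k h,
      P.alternating _ I j k h, ← map_neg]
    congr 1
    abel

theorem bd_fill_zero (I : Fin 1 → U.Idx) : bd (fill P Q 0) I = 0 := bd_singleton _ _

/-- The apex `f (∪ I)` is trivially near itself; this is what makes the carrier acyclic. -/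
theorem carried_fill : ∀ p, f.Carried (p := p) (fill P Q (p + 1))
  | 0 => fun I => by
    refine Chain.cone_mem_supported Subset.rfl (sub_mem ?_ (sub_mem (Q.carried 0 I) (P.carried 0 I)))
    rw [bd_fill_zero]; exact zero_mem _
  | p + 1 => fun I => Chain.cone_mem_supported Subset.rfl
    (sub_mem (Carried.bd (carried_fill p) I) (sub_mem (Q.carried _ I) (P.carried _ I)))

/-- The chain that is coned off is a cycle, by induction and because `P` and `Q` satisfy the same
boundary relation. A cycle is the boundary of its cone. -/
theorem boundary_fill : ∀ N (I : Fin (N + 1) → U.Idx), Chain.boundary (fill P Q (N + 1) I) =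
    bd (fill P Q N) I - (Q.fn (N + 1) I - P.fn (N + 1) I)
  | 0, I => by
    rw [fill_succ, Chain.boundary_cone, bd_fill_zero, zero_sub, map_neg, map_sub, boundary_one,
      boundary_one, sub_self, neg_zero, map_zero, sub_zero]
  | N + 1, I => by
    have h : (fun J => Chain.boundary (fill P Q (N + 1) J)) =
        bd (fill P Q N) - (Q.fn (N + 1) - P.fn (N + 1)) := funext (boundary_fill N)
    have hz : Chain.boundary (bd (fill P Q (N + 1)) I - (Q.fn (N + 2) I - P.fn (N + 2) I)) = 0 := by
      rw [map_sub, map_bd, h, bd_sub, bd_sub, bd_bd, map_sub, ← add_left_inj (bd (Q.fn (N + 1)) I)]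
      have hP := P.boundary (N + 1) I
      have hQ := Q.boundary (N + 1) I
      rw [eq_sub_of_add_eq hP, eq_sub_of_add_eq hQ]
      abel
    rw [fill_succ, Chain.boundary_cone, hz, map_zero, sub_zero]

/-- The operator on cochains of the difference of two chain homotopies. -/
def fillOp (p q : ℕ) : V.cochain (p + 2) q →+ U.cochain p q :=
  f.real (fill P Q (p + 1)) (alternating_fill P Q (p + 1)) q

/-- The operator on total cochains of the difference of two chain homotopies. -/
def fillTot (k : ℕ) : V.Tot (k + 2) →+ U.Tot k :=
  f.realTot 2 (fun p => fill P Q (p + 1)) (fun p => alternating_fill P Q (p + 1)) k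

theorem fillOp_delta_zero (η : V.cochain 1 q) :
    - fillOp P Q 0 q (V.delta 1 q η) = Q.op 0 q η - P.op 0 q η := by
  rw [op, op, ← real_sub, neg_eq_iff_eq_neg, fillOp, real_delta _ (carried_fill P Q 0), ← sub_eq_zero,
    sub_neg_eq_add, ← real_add]
  refine Eq.trans (real_congr (ψ := 0) (hψ := fun _ _ _ _ => neg_zero.symm) ?_ η) ?_
  · funext I
    rw [Pi.add_apply, boundary_fill, bd_fill_zero, Pi.sub_apply, zero_sub]
    exact neg_add_cancel _
  · exact Subtype.ext (funext fun I => map_zero (f.evalAt (U.cup I) η))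

theorem delta_fillOp_sub (η : V.cochain (p + 2) q) :
    U.delta p q (fillOp P Q p q η) - fillOp P Q (p + 1) q (V.delta (p + 2) q η) =
      Q.op (p + 1) q η - P.op (p + 1) q η := by
  rw [op, op, ← real_sub, fillOp, fillOp, delta_real _ (carried_fill P Q p),
    real_delta _ (carried_fill P Q (p + 1)), ← real_sub]
  refine real_congr (funext fun I => ?_) η
  rw [Pi.sub_apply, boundary_fill]
  exact sub_sub_cancel _ _

theorem extDer_fillOp (η : V.cochain (p + 2) q) :
    U.extDer p q (fillOp P Q p q η) = fillOp P Q p (q + 1) (V.extDer (p + 2) q η) :=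
  extDer_real _ η

theorem fillTot_totalD_zero (θ : V.Tot 1) :
    - fillTot P Q 0 (V.totalD 1 θ) = Q.tot 0 θ - P.tot 0 θ := by
  funext ⟨⟨p, q⟩, h⟩
  obtain ⟨rfl, rfl⟩ : p = 0 ∧ q = 0 := by simp only at h; omega
  exact fillOp_delta_zero P Q _

/-- Here `p` drops by two, so the terms with an exterior derivative have equal signs and cancel in
the difference; this matches the sign in `dΓ - Γd`. -/
theorem totalD_fillTot_sub (k : ℕ) (θ : V.Tot (k + 2)) :
    U.totalD k (fillTot P Q k θ) - fillTot P Q (k + 1) (V.totalD (k + 2) θ) =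
      Q.tot (k + 1) θ - P.tot (k + 1) θ := by
  funext ⟨⟨p, q⟩, h⟩
  rcases p with _ | p <;> rcases q with _ | q
  · simp only at h; omega
  · have e : ∀ (ζ : V.cochain 1 (q + 1)) (ξ : V.cochain 2 q),
        U.extDer 0 q (fillOp P Q 0 q ξ) -
          fillOp P Q 0 (q + 1) (V.delta 1 (q + 1) ζ + (-1 : ℤ) ^ 2 • V.extDer 2 q ξ) =
        Q.op 0 (q + 1) ζ - P.op 0 (q + 1) ζ := fun ζ ξ => by
      rw [map_add, map_zsmul, ← fillOp_delta_zero, extDer_fillOp, neg_one_sq, one_smul]; abel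
    exact e _ _
  · exact delta_fillOp_sub P Q _
  · have e : ∀ (ζ : V.cochain (p + 2) (q + 1)) (ξ : V.cochain (p + 3) q),
        (U.delta p (q + 1) (fillOp P Q p (q + 1) ζ) +
          (-1 : ℤ) ^ (p + 1) • U.extDer (p + 1) q (fillOp P Q (p + 1) q ξ)) -
          fillOp P Q (p + 1) (q + 1) (V.delta (p + 2) (q + 1) ζ +
            (-1 : ℤ) ^ (p + 3) • V.extDer (p + 3) q ξ) =
        Q.op (p + 1) (q + 1) ζ - P.op (p + 1) (q + 1) ζ := fun ζ ξ => by
      rw [map_add, map_zsmul, ← delta_fillOp_sub, extDer_fillOp, pow_add _ (p + 1) 2, neg_one_sq,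
        mul_one]
      abel
    exact e _ _

end ChainHtpy

/-- The alternating sum of the strings `f I₀, …, f I_j, g I_j, …, g I_p`. -/
def prismChain (f g : CompatSys U V) : ∀ {N}, (Fin N → U.Idx) → Chain V.Idx (N + 1)
  | 0, _ => 0
  | N + 1, I => ∑ j : Fin (N + 1), (-1 : ℤ) ^ (j : ℕ) • Chain.mk (mixed f g I j)

theorem prismChain_succ (I : Fin (p + 1) → U.Idx) : prismChain f g I =
    ∑ j : Fin (p + 1), (-1 : ℤ) ^ (j : ℕ) • Chain.mk (mixed f g I j) := rfl

theorem mixed_cons_zero (i : U.Idx) (I : Fin p → U.Idx) :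
    mixed f g (Fin.cons i I : Fin (p + 1) → U.Idx) 0 =
      Fin.cons (f.functor.obj i) (g.functor.obj ∘ (Fin.cons i I : Fin (p + 1) → U.Idx)) := by
  funext k
  refine Fin.cases ?_ (fun y => ?_) k
  · simp [mixed]
  · simp [mixed]

theorem mixed_cons_succ (i : U.Idx) (I : Fin (p + 1) → U.Idx) (j : Fin (p + 1)) :
    mixed f g (Fin.cons i I : Fin (p + 2) → U.Idx) j.succ =
      Fin.cons (f.functor.obj i) (mixed f g I j) := by
  funext k
  refine Fin.cases ?_ (fun y => ?_) k
  · simp [mixed]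
  · simp [mixed, Fin.succ_predAbove_succ]

/-- Every mixed string starts with `f i`. The summand `j = 0` continues with the whole string under
`g`, the others with a mixed string of `I` whose position is shifted by one. -/
theorem prismChain_cons (i : U.Idx) {N : ℕ} (I : Fin N → U.Idx) :
    prismChain f g (Fin.cons i I : Fin (N + 1) → U.Idx) = Chain.cone (f.functor.obj i)
      (Chain.mk (g.functor.obj ∘ (Fin.cons i I : Fin (N + 1) → U.Idx)) - prismChain f g I) := by
  rw [prismChain_succ, Fin.sum_univ_succ, mixed_cons_zero]
  obtain _ | N := N
  · simp [prismChain]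
  · rw [map_sub, Chain.cone_mk, prismChain_succ, map_sum, sub_eq_add_neg, ← Finset.sum_neg_distrib]
    simp only [mixed_cons_succ, map_zsmul, Chain.cone_mk]
    simp [pow_succ]

/-- Induction by the recursion `prismChain_cons` and the cone formula. No order is involved; it is
needed only because `prismChain` itself is not alternating in the string. -/
theorem boundary_prismChain : ∀ {N : ℕ} (I : Fin (N + 1) → U.Idx),
    Chain.boundary (prismChain f g I) + bd (prismChain f g) I =
      Chain.mk (g.functor.obj ∘ I) - Chain.mk (f.functor.obj ∘ I)
  | 0, I => by
    rw [← Fin.cons_self_tail I, prismChain_cons, Chain.boundary_cone, bd_singleton]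
    simp only [prismChain, sub_zero, add_zero, Chain.boundary_mk, bd_singleton, Chain.cone_mk]
    rw [cons_comp f.functor.obj, Subsingleton.elim (f.functor.obj ∘ Fin.tail I) Fin.elim0]
  | N + 1, I => by
    rw [← Fin.cons_self_tail I]
    generalize I 0 = i
    generalize Fin.tail I = J
    have ih := boundary_prismChain J
    rw [bd_cons, prismChain_cons, Chain.boundary_cone, map_sub, Chain.boundary_mk, ← bd_comp, bd_cons]
    have h : (fun J : Fin N → U.Idx => prismChain f g (Fin.cons i J : Fin (N + 1) → U.Idx)) =
        fun J => Chain.cone (f.functor.obj i)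
          (((fun J => Chain.mk (g.functor.obj ∘ (Fin.cons i J : Fin (N + 1) → U.Idx))) -
            prismChain f g : (Fin N → U.Idx) → Chain V.Idx (N + 1)) J) := funext fun J => prismChain_cons i J
    rw [h, ← map_bd, bd_sub, eq_sub_of_add_eq ih, cons_comp f.functor.obj, ← Chain.cone_mk]
    simp only [map_sub]
    abel

/-- The chain homotopy that is given by the prism operator on strings increasing for `r`. -/
def prismHtpy (a : f ⟶ g) (r : U.Idx → U.Idx → Prop) [IsStrictTotalOrder U.Idx r] :
    ChainHtpy f g where
  fn N := altExt r (prismChain f g)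
  alternating N := alternating_altExt r _
  carried p I := by
    unfold altExt
    split_ifs
    · refine zsmul_mem (sum_mem fun j _ => zsmul_mem (Chain.mk_mem_supported fun k => ?_) _) _
      -- The mixed strings are formed from the sorted string, which has the same union.
      rw [← U.cup_comp_perm I (sorter r I)]
      exact (base_subset_mixed a _ j).trans (V.base_anti (V.le_cup _ k))
    · exact zero_mem _
  zero I := by
    rw [altExt_of_increasing _ fun i => i.elim0]; rfl
  boundary N I := by
    have h := Alternating.ext_of_increasing r
      (F := fun I => Chain.boundary (altExt r (prismChain f g) I) + bd (altExt r (prismChain f g)) I)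
      (G := fun I : Fin (N + 1) → U.Idx =>
        Chain.mk (g.functor.obj ∘ I) - Chain.mk (f.functor.obj ∘ I))
      (((alternating_altExt r _).map _).add (alternating_altExt r _).bd)
      (Alternating.sub (Chain.alternating_mk.comp_left _) (Chain.alternating_mk.comp_left _))
      fun I hI => by
        -- Faces of increasing strings are increasing, so the alternating extension can be dropped
        -- in both terms.
        rw [altExt_of_increasing _ hI, bd_congr (G := prismChain f g) fun k =>
          altExt_of_increasing _ fun i j hij => hI _ _ (Fin.strictMono_succAbove k hij)]
        exact boundary_prismChain I
    exact congrFun h I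

theorem evalAt_prismChain (a : f ⟶ g) (η : V.cochain (p + 1) q) (I : Fin (p + 1) → U.Idx) :
    f.evalAt (U.cup I) η (prismChain f g I) = CompatSys.prism a η.1 I := by
  rw [prismChain_succ, map_sum]
  refine Finset.sum_congr rfl fun j _ => ?_
  rw [map_zsmul, evalAt_mk, ev_of_subset]

end CompatSys

end

/-! ### Composition of chain homotopies and the 2-functor -/

noncomputable section

variable {X : Type u} [TopologicalSpace X] {Y : Type u} [TopologicalSpace Y]
  {Z : Type u} [TopologicalSpace Z] {n m l q : ℕ}

namespace CompatSys

variable {U : GoodAtlas.{u, v} X n} {V : GoodAtlas.{u, v} Y m} {W : GoodAtlas.{u, v} Z l} {p r k : ℕ}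

open GoodAtlas

/-- Chains near `g L` may be read on the chart of `g L` or, through the embedding given by `a`, on
that of `f L`; the liftings of `f` and `g` differ by this embedding. -/
theorem evalAt_trans {f g : CompatSys U V} (a : f ⟶ g) {L : U.Idx} (η : V.cochain r q)
    {c : Chain V.Idx (r + 1)} (hc : c ∈ Chain.supported (V.near (g.functor.obj L)) (r + 1)) :
    f.evalAt L η c = g.evalAt L η c := by
  rw [evalAt_apply, evalAt_apply, ← pullback_pair (a.nat.app L) η hc,
    ← pullback_comp (smooth_embFun (a.nat.app L)) (f.smooth_lift _) (U.ch _).isOpen_dom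
      (V.ch _).isOpen_dom]
  exact congrArg (pullback · _) (funext fun x => (a.lift_eq _ x).symm)

theorem evalAt_comp (f : CompatSys U V) (g : CompatSys V W) (L : U.Idx) (η : W.cochain r q)
    (c : Chain W.Idx (r + 1)) :
    (f.comp g).evalAt L η c = pullback (f.lift L) (g.evalAt (f.functor.obj L) η c) :=
  pullback_comp (g.smooth_lift _) (f.smooth_lift _) (U.ch _).isOpen_dom (V.ch _).isOpen_dom _

/-- Nested bases come from an embedding, and the functor maps it to an embedding of the image
charts, whose bases are then nested as well. -/
theorem mapsTo_near (h : CompatSys V W) (L : V.Idx) :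
    MapsTo h.functor.obj (V.near L) (W.near (h.functor.obj L)) := fun _ hJ =>
  Chart.Emb.base_subset (h.functor.map (V.emb hJ))

theorem pair_pullbackCochain (h : CompatSys V W) {L : V.Idx} (η : W.cochain r q)
    {c : Chain V.Idx (r + 1)} (hc : c ∈ Chain.supported (V.near L) (r + 1)) :
    (pair L (h.pullbackCochain r q η) c).1 = h.evalAt L η (Chain.map h.functor.obj c) := by
  refine Chain.eq_of_supported (f := ((V.ch L).invForms q).subtype.comp
    (pair L (h.pullbackCochain r q η))) (g := (h.evalAt L η).comp (Chain.map h.functor.obj))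
    (fun J hJ => ?_) hc
  refine (pair_mk _ J).trans ?_
  rw [AddMonoidHom.comp_apply, Chain.map_mk, evalAt_mk]
  have e : L ⟶ V.cup J := V.emb (V.subset_base_cup J hJ)
  rw [ev_of_emb e _ rfl, pullbackCochain_val, pullbackFun, pullback_emb_lift,
    ev_of_emb (h.functor.map e) _ (h.obj_cup J)]
  rfl

theorem evalAt_pullbackCochain (f : CompatSys U V) (h : CompatSys V W) {L : U.Idx}
    (η : W.cochain r q) {c : Chain V.Idx (r + 1)}
    (hc : c ∈ Chain.supported (V.near (f.functor.obj L)) (r + 1)) :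
    f.evalAt L (h.pullbackCochain r q η) c =
      (f.comp h).evalAt L η (Chain.map h.functor.obj c) := by
  rw [evalAt_comp, evalAt_apply, pair_pullbackCochain h η hc]

theorem pullbackCochain_id (η : U.cochain p q) : (CompatSys.id U).pullbackCochain p q η = η :=
  Subtype.ext <| (pullbackCochain_val η).trans <| funext fun I =>
    pullback_id (U.ch _).isOpen_dom (η.2.1 I).2.1

theorem pullbackCochain_comp (f : CompatSys U V) (g : CompatSys V W) (η : W.cochain p q) :
    (f.comp g).pullbackCochain p q η = f.pullbackCochain p q (g.pullbackCochain p q η) := by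
  refine Subtype.ext ?_
  rw [pullbackCochain_val, pullbackCochain_val, pullbackCochain_val]
  funext I
  rw [pullbackFun, pullbackFun, pullbackFun]
  have h := f.obj_cup I
  refine (pullback_comp (g.smooth_lift _) (f.smooth_lift _) (U.ch _).isOpen_dom
    (V.ch _).isOpen_dom _).trans ?_
  exact congrArg (pullback (f.lift (U.cup I)))
    (congrArg (fun L => pullback (g.lift L) (η.1 (g.functor.obj ∘ f.functor.obj ∘ I) )) h)

namespace ChainHtpy

/-- The zero chain homotopy. -/
def refl (f : CompatSys U V) : ChainHtpy f f where
  fn _ _ := 0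
  alternating _ _ _ _ _ := neg_zero.symm
  carried _ _ := zero_mem _
  zero _ := rfl
  boundary _ _ := by simp [bd]

theorem tot_refl (f : CompatSys U V) (k : ℕ) (θ : V.Tot (k + 1)) : (refl f).tot k θ = 0 :=
  funext fun _ => Subtype.ext <| funext fun _ => map_zero (f.evalAt _ _)

/-- Vertical composition of chain homotopies. -/
def trans {f g h : CompatSys U V} (a : f ⟶ g) (P : ChainHtpy f g) (Q : ChainHtpy g h) :
    ChainHtpy f h where
  fn N := Q.fn N + P.fn N
  alternating N := (Q.alternating N).add (P.alternating N)
  -- Chains near `g (∪ I)` are near `f (∪ I)`, because the transformation embeds the latter chart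
  -- into the former.
  carried p I := add_mem (Chain.supported_mono
    (near_mono (Chart.Emb.base_subset (a.nat.app (U.cup I)))) (Q.carried p I)) (P.carried p I)
  zero I := by rw [Pi.add_apply, P.zero, Q.zero, add_zero]
  boundary N I := by
    rw [bd_add, Pi.add_apply, map_add, add_add_add_comm, P.boundary, Q.boundary,
      sub_add_sub_cancel]

theorem tot_trans {f g h : CompatSys U V} (a : f ⟶ g) (P : ChainHtpy f g) (Q : ChainHtpy g h)
    (k : ℕ) (θ : V.Tot (k + 1)) : (trans a P Q).tot k θ = Q.tot k θ + P.tot k θ := by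
  funext ⟨⟨p, q⟩, _⟩
  refine Subtype.ext (funext fun I => ?_)
  refine (map_add (f.evalAt (U.cup I) _) _ _).trans ?_
  exact congrArg (· + _) (evalAt_trans a _ (Q.carried p I))

/-- Precomposition of a chain homotopy with a compatible system. -/
def whiskerLeft (h : CompatSys U V) {f g : CompatSys V W} (P : ChainHtpy f g) :
    ChainHtpy (h.comp f) (h.comp g) where
  fn N I := P.fn N (h.functor.obj ∘ I)
  alternating N := (P.alternating N).comp_left _
  carried p I := by
    have h1 := P.carried p (h.functor.obj ∘ I)
    rwa [← h.obj_cup] at h1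
  zero _ := P.zero _
  boundary N _ := P.boundary N _

theorem tot_whiskerLeft (h : CompatSys U V) {f g : CompatSys V W} (P : ChainHtpy f g) (k : ℕ)
    (θ : W.Tot (k + 1)) : (P.whiskerLeft h).tot k θ = h.pullbackTot k (P.tot k θ) := by
  funext ⟨⟨p, q⟩, _⟩
  refine Subtype.ext (funext fun I => ?_)
  refine Eq.trans ?_ (congrFun (pullbackCochain_val (f := h) _) I).symm
  exact (evalAt_comp h f (U.cup I) _ _).trans <| congrArg (pullback (h.lift (U.cup I)))
    (congrArg (fun L => f.evalAt L _ _) (h.obj_cup I))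

/-- Postcomposition of a chain homotopy with a compatible system. -/
def whiskerRight {f g : CompatSys U V} (P : ChainHtpy f g) (h : CompatSys V W) :
    ChainHtpy (f.comp h) (g.comp h) where
  fn N I := Chain.map h.functor.obj (P.fn N I)
  alternating N := (P.alternating N).map _
  carried p I := Chain.map_mem_supported (h.mapsTo_near _) (P.carried p I)
  zero I := by rw [P.zero, map_zero]
  boundary N I := by
    rw [Chain.boundary_map, ← map_bd, ← map_add, P.boundary, map_sub, Chain.map_mk, Chain.map_mk]
    rfl

theorem tot_whiskerRight {f g : CompatSys U V} (P : ChainHtpy f g) (h : CompatSys V W) (k : ℕ)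
    (θ : W.Tot (k + 1)) : (P.whiskerRight h).tot k θ = P.tot k (h.pullbackTot (k + 1) θ) := by
  funext ⟨⟨p, q⟩, _⟩
  exact Subtype.ext <| funext fun I => (evalAt_pullbackCochain f h _ (P.carried p I)).symm

end ChainHtpy

end CompatSys

/-- The spark complex of a good atlas. -/
abbrev GPreOrb.spark (U : GPreOrb.{u, v}) : SpCx.{v} := U.toSpCx GPreOrb.isSparkComplex

open CompatSys

variable {U V W : GPreOrb.{u, v}}

/-- The spark homomorphism of a compatible system. -/
def sparkMap (f : U ⟶ V) : V.spark ⟶ U.spark :=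
  { toFun := pullbackTot f
    comm := pullbackTot_totalD f
    map_E := fun k _ hx => pullbackTot_mem_globalForms f k hx
    map_I := fun k _ hx => realTot_mem_intCochains _ _ k hx : SparkHom V.spark U.spark }

/-- The spark homotopy of a chain homotopy. -/
def CompatSys.ChainHtpy.toSpark {f g : U ⟶ V} (P : ChainHtpy f g) (a : f ⟶ g) :
    SparkHomotopy (sparkMap f) (sparkMap g) where
  toFun := P.tot
  eq_zero := P.tot_totalD_zero a
  eq_succ := P.totalD_tot_add a
  vanish_E k _ hx := realTot_eq_zero _ _ k one_ne_zero hx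
  map_I k _ hx := realTot_mem_intCochains _ _ k hx

/-- The operator of `fill` is the required homotopy. Independence of the order and all laws for
2-cells reduce to this. -/
theorem toClass_eq_of_chainHtpy {f g : U ⟶ V} {H H' : SparkHomotopy (sparkMap f) (sparkMap g)}
    (P P' : ChainHtpy f g) (h : ∀ k (θ : V.atlas.Tot (k + 1)), H.toFun k θ = P.tot k θ)
    (h' : ∀ k (θ : V.atlas.Tot (k + 1)), H'.toFun k θ = P'.tot k θ) : H.toClass = H'.toClass :=
  Quotient.sound ⟨{
    toFun := ChainHtpy.fillTot P P'
    eq_zero := fun x => (ChainHtpy.fillTot_totalD_zero P P' x).trans <|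
      congrArg₂ (· - ·) (h' 0 x).symm (h 0 x).symm
    eq_succ := fun k x => (ChainHtpy.totalD_fillTot_sub P P' k x).trans <|
      congrArg₂ (· - ·) (h' (k + 1) x).symm (h (k + 1) x).symm
    vanish_E := fun k _ hx => realTot_eq_zero _ _ k two_ne_zero hx
    map_I := fun k _ hx => realTot_mem_intCochains _ _ k hx }⟩

/-- The class of spark homotopies of a natural transformation. -/
def sparkMap₂ {f g : U ⟶ V} (a : f ⟶ g) : sparkMap f ⟶ sparkMap g :=
  ((prismHtpy a WellOrderingRel).toSpark a).toClass

theorem sparkMap₂_eq {f g : U ⟶ V} (a : f ⟶ g) (H : SparkHomotopy (sparkMap f) (sparkMap g))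
    (P : ChainHtpy f g) (h : ∀ k (θ : V.atlas.Tot (k + 1)), H.toFun k θ = P.tot k θ) :
    sparkMap₂ a = H.toClass :=
  toClass_eq_of_chainHtpy (prismHtpy a WellOrderingRel) P (fun _ _ => rfl) h

/-- The 1-cells at the ends of the two classes agree only by a proved equation, such as
`sparkMap_comp`; once it is substituted, equal components give equal classes. -/
theorem toClass_eq_eqToHom {S T : SpCx.{w}} {f g f' g' : S ⟶ T} (hf : f = f') (hg : g = g')
    (P : SparkHomotopy f g) (P' : SparkHomotopy f' g') (h : ∀ k x, P.toFun k x = P'.toFun k x) :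
    (P.toClass : f ⟶ g) = eqToHom hf ≫ (P'.toClass : f' ⟶ g') ≫ eqToHom hg.symm := by
  subst hf hg
  obtain rfl : P = P' := SparkHomotopy.ext (funext fun k => AddMonoidHom.ext (h k))
  simp

theorem sparkMap_id (U : GPreOrb.{u, v}) : sparkMap (𝟙 U) = 𝟙 U.spark :=
  SparkHom.ext <| funext fun _ => AddMonoidHom.ext fun _ => funext fun _ => pullbackCochain_id _

theorem sparkMap_comp (f : U ⟶ V) (g : V ⟶ W) : sparkMap (f ≫ g) = sparkMap g ≫ sparkMap f :=
  SparkHom.ext <| funext fun _ => AddMonoidHom.ext fun _ => funext fun _ =>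
    pullbackCochain_comp f g _

theorem sparkMap₂_id (f : U ⟶ V) : sparkMap₂ (𝟙 f) = 𝟙 (sparkMap f) :=
  sparkMap₂_eq _ (SparkHomotopy.refl _) (ChainHtpy.refl f) fun k θ => (ChainHtpy.tot_refl f k θ).symm

/-- The sum of two prism operators need not be the prism operator of the composite, but it comes
from a chain homotopy with the same ends. -/
theorem sparkMap₂_comp {f g h : U ⟶ V} (a : f ⟶ g) (b : g ⟶ h) :
    sparkMap₂ (a ≫ b) = sparkMap₂ a ≫ sparkMap₂ b :=
  sparkMap₂_eq _ (((prismHtpy a WellOrderingRel).toSpark a).trans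
    ((prismHtpy b WellOrderingRel).toSpark b)) (ChainHtpy.trans a _ _)
    fun k θ => (ChainHtpy.tot_trans a _ _ k θ).symm

/-- Whiskering changes sides because 1-cells are reversed. The whiskered prism homotopy is a chain
homotopy for the whiskered transformation, so it represents its class. -/
theorem sparkMap₂_whiskerLeft (f : U ⟶ V) {g h : V ⟶ W} (a : g ⟶ h) :
    sparkMap₂ (Bicategory.whiskerLeft f a) = eqToHom (sparkMap_comp f g) ≫
      Bicategory.whiskerRight (sparkMap₂ a) (sparkMap f) ≫ eqToHom (sparkMap_comp f h).symm := by
  have e := toClass_eq_eqToHom (sparkMap_comp f g) (sparkMap_comp f h)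
    (((prismHtpy a WellOrderingRel).whiskerLeft f).toSpark (Bicategory.whiskerLeft f a))
    (((prismHtpy a WellOrderingRel).toSpark a).postComp (sparkMap f))
    fun k x => ChainHtpy.tot_whiskerLeft f _ k x
  exact (sparkMap₂_eq _ _ _ fun _ _ => rfl).trans e

theorem sparkMap₂_whiskerRight {f g : U ⟶ V} (a : f ⟶ g) (h : V ⟶ W) :
    sparkMap₂ (Bicategory.whiskerRight a h) = eqToHom (sparkMap_comp f h) ≫
      Bicategory.whiskerLeft (sparkMap h) (sparkMap₂ a) ≫ eqToHom (sparkMap_comp g h).symm := by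
  have e := toClass_eq_eqToHom (sparkMap_comp f h) (sparkMap_comp g h)
    (((prismHtpy a WellOrderingRel).whiskerRight h).toSpark (Bicategory.whiskerRight a h))
    (((prismHtpy a WellOrderingRel).toSpark a).preComp (sparkMap h))
    fun k x => ChainHtpy.tot_whiskerRight _ h k x
  exact (sparkMap₂_eq _ _ _ fun _ _ => rfl).trans e

instance : Bicategory.Strict GPreOrb.{u, v}ᵒᵖ where
  id_comp _ := rfl
  comp_id _ := rfl
  assoc _ _ _ := rfl
  leftUnitor_eqToIso _ := rfl
  rightUnitor_eqToIso _ := rfl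
  associator_eqToIso _ _ _ := rfl

/-- The 2-functor from good atlases to spark complexes. -/
def sparkFunctor : StrictPseudofunctor GPreOrb.{u, v}ᵒᵖ SpCx.{v} :=
  StrictPseudofunctor.mk''
    { obj := fun U => U.unop.spark
      map := fun f => sparkMap f.unop
      map₂ := fun a => sparkMap₂ a.unop2
      map₂_id := fun f => sparkMap₂_id f.unop
      map₂_comp := fun a b => sparkMap₂_comp a.unop2 b.unop2
      map_id := fun U => sparkMap_id U.unop
      map_comp := fun f g => sparkMap_comp g.unop f.unop
      map₂_whisker_left := fun f _ _ a => sparkMap₂_whiskerRight a.unop2 f.unop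
      map₂_whisker_right := fun a f => sparkMap₂_whiskerLeft f.unop a.unop2 }

end

end SparkOrb

theorem mainTheorem1 :
    ∃ (hS : ∀ U : GPreOrb.{u, v}, U.sparkTriple.IsSparkComplex)
      (map : ∀ {U W : GPreOrb.{u, v}}, (U ⟶ W) → (W.toSpCx hS ⟶ U.toSpCx hS))
      (map₂ : ∀ {U W : GPreOrb.{u, v}} {f g : U ⟶ W}, (f ⟶ g) → (map f ⟶ map g)),
      (∀ {U W : GPreOrb.{u, v}} (f : U ⟶ W) (k : ℕ) (θ : W.atlas.Tot k) (b : Bideg k),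
        (SparkHom.toFun (map f) k θ b).1 = CompatSys.pullbackFun f (θ b).1) ∧
      (∀ {U W : GPreOrb.{u, v}} {f g : U ⟶ W} (α : f ⟶ g)
        (r : U.atlas.Idx → U.atlas.Idx → Prop), IsStrictTotalOrder U.atlas.Idx r →
        ∃ H : SparkHomotopy (map f) (map g), map₂ α = H.toClass ∧
          ∀ (k p q : ℕ) (h : p + q = k) (h' : p + 1 + q = k + 1) (θ : W.atlas.Tot (k + 1))
            (I : Fin (p + 1) → U.atlas.Idx), (∀ i j, i < j → r (I i) (I j)) →
            (H.toFun k θ ⟨(p, q), h⟩).1 I = CompatSys.prism α (θ ⟨(p + 1, q), h'⟩).1 I) ∧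
      ∃ S : StrictPseudofunctor GPreOrb.{u, v}ᵒᵖ SpCx.{v},
        S.toPrelaxFunctorStruct =
          { obj := fun U => U.unop.toSpCx hS
            map := fun f => map f.unop
            map₂ := fun α => map₂ α.unop2 } := by
  refine ⟨GPreOrb.isSparkComplex, fun f => sparkMap f, fun a => sparkMap₂ a,
    fun f k θ b => CompatSys.pullbackCochain_val (f := f) (θ b), fun {U W f g} α r hr => ?_,
    sparkFunctor, rfl⟩
  -- The prism homotopy of the given order represents the class that `sparkMap₂` defines with a
  -- fixed well-ordering.
  refine ⟨(CompatSys.prismHtpy α r).toSpark α, sparkMap₂_eq α _ _ fun _ _ => rfl, ?_⟩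
  intro k p q h h' θ I hI
  refine Eq.trans ?_ (CompatSys.evalAt_prismChain α (θ ⟨(p + 1, q), h'⟩) I)
  exact congrArg (CompatSys.evalAt f (U.atlas.cup I) (θ ⟨(p + 1, q), h'⟩))
    (altExt_of_increasing (CompatSys.prismChain f g) hI)
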